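/- Let $p,m\ge 0$ be integers (only $p,m\geq 1$ is of interest) and let $g:(0,1]\to(0,\infty)$ be measurable, bounded, bounded away from zero ($\inf_{(0,1]} g>0$), and piecewise Lipschitz: $(0,1]$ is a finite union of mutually disjoint intervals on each of which $g$ is Lipschitz. Let $(\epsilon_t)_{t\in\mathbb Z}$ be iid with $E(\epsilon_t)=0$, $\mathrm{Var}(\epsilon_t)=1$ and $E|\epsilon_t|^s<\infty$ for some $s>8$; $\epsilon$ denotes a generic copy of $\epsilon_t$. For each sample size $n$ put $h_t=g(t/n)$ and let the sample $x_{-p+1},\dots,x_0,x_1,\dots,x_n$ (the dependence on $n$ is suppressed) satisfy, for $1\le t\le n$, $$x_t=a_{01}x_{t-1}+\dots+a_{0p}x_{t-p}+u_t,\qquad u_t=\tilde h_t\epsilon_t,\qquad \tilde h_t^2=h_t^2+\alpha_{01}u_{t-1}^2+\dots+\alpha_{0m}u_{t-m}^2,$$ where $\alpha_{0j}\ge 0$, $1-\sum_{i=1}^p a_{0i}z^i\neq 0$ for all complex $|z|\le 1$, and the initial values $(x_{-p+1},\dots,x_0)$ are random variables independent of $(\epsilon_t)_{t\ge1}$ and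 bounded in probability uniformly in $n$ (the latter is automatic if they do not depend on $n$). For $\theta=(a_1,\dots,a_p)'$ and $\vartheta=(\alpha_1,\dots,\alpha_m)'$ let $u_t(\theta)=x_t-a_1x_{t-1}-\dots-a_px_{t-p}$ for $t\ge1$, $u_t(\theta)=0$ for $t\le 0$, $\tilde h_t^2(\theta,\vartheta)=h_t^2+\sum_{j=1}^m\alpha_ju_{t-j}^2(\theta)$, and $$\mathcal L(\theta,\vartheta)=-\frac12\sum_{t=1}^n\left\{\frac{u_t^2(\theta)}{\tilde h_t^2(\theta,\vartheta)}+\log \tilde h_t^2(\theta,\vartheta)\right\},\qquad \mathcal S(\theta)=\frac1{\sqrt n}\,\frac{\partial\mathcal L}{\partial\vartheta}(\theta,\vartheta)\Big|_{\vartheta=0}\in\mathbb R^m .$$ Let $\hat\theta$ be the generalized least-squares estimator computed with the true $h_t$, $$\hat\theta'=\Big\{\sum_{t=1}^nh_t^{-2}x_t\underline x_{t-1}'\Big\}\Big\{\sum_{t=1}^nh_t^{-2}\underline x_{t-1}\underline x_{t-1}'\Big\}^{-1},\qquad \underline x_t=(x_t,\dots,x_{t-p+1})'$$ (with the convention that $\hat\theta=0$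 when the matrix is singular). Assume the null hypothesis $H_0$: $\alpha_{01}=\dots=\alpha_{0m}=0$. Then, as $n\to\infty$, $\mathcal S(\hat\theta)$ converges in law to $\mathcal N(0,\Sigma)$, where $\Sigma$ is the positive semidefinite $m\times m$ matrix equal to $\frac{\mathrm{Var}(\epsilon^2)}{4}$ times the matrix with $E(\epsilon^4)$ on the diagonal and $1$ off the diagonal. -/

import Mathlib

open MeasureTheory ProbabilityTheory Filter

namespace ARCHTest

noncomputable section

/-- The interval `(0,1]` is a finite disjoint union of intervals (possibly reduced to a point)
on each of which `g` is Lipschitz. -/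
def PiecewiseLipschitz (g : ℝ → ℝ) : Prop :=
  ∃ (q : ℕ) (I : Fin q → Set ℝ),
    (∀ l, (I l).OrdConnected) ∧
    (Pairwise fun k l => Disjoint (I k) (I l)) ∧
    (⋃ l, I l) = Set.Ioc (0 : ℝ) 1 ∧
    ∀ l, ∃ K : NNReal, LipschitzOnWith K g (I l)

/-- The deterministic scale function `g` on `(0,1]`: measurable, bounded, bounded away from zero
and piecewise Lipschitz. Values outside `(0,1]` are never used. -/
structure IsScaleFunction (g : ℝ → ℝ) : Prop where
  measurable : Measurable fun r : Set.Ioc (0 : ℝ) 1 => g r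
  bounded_below : ∃ c : ℝ, 0 < c ∧ ∀ r ∈ Set.Ioc (0 : ℝ) 1, c ≤ g r
  bounded_above : ∃ C : ℝ, ∀ r ∈ Set.Ioc (0 : ℝ) 1, |g r| ≤ C
  piecewise_lipschitz : PiecewiseLipschitz g

/-- `(ε_t)` is iid, centred, of unit variance, with `E|ε|^s < ∞` for some `s > 8`. -/
structure IsInnovation {Ω : Type*} [MeasurableSpace Ω] (P : Measure Ω) (ε : ℤ → Ω → ℝ) :
    Prop where
  measurable : ∀ t, Measurable (ε t)
  indep : iIndepFun ε P
  identDistrib : ∀ t, IdentDistrib (ε t) (ε 0) P P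
  mean_zero : ∫ ω, ε 0 ω ∂P = 0
  unit_variance : variance (ε 0) P = 1
  moment : ∃ s : ℝ, 8 < s ∧ Integrable (fun ω => |ε 0 ω| ^ s) P

/-- `h_t = g(t/n)`. -/
def scale (g : ℝ → ℝ) (n : ℕ) (t : ℤ) : ℝ := g ((t : ℝ) / (n : ℝ))

/-- `1 - a₁ z - … - a_p z^p ≠ 0` for all complex `z` with `|z| ≤ 1`. -/
def IsStable {p : ℕ} (a : Fin p → ℝ) : Prop :=
  ∀ z : ℂ, ‖z‖ ≤ 1 → 1 - ∑ i : Fin p, (a i : ℂ) * z ^ ((i : ℕ) + 1) ≠ 0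

/-- The autoregressive model with (possibly) ARCH errors, as a triangular array: row `n` is the
sample `x n (-p+1), …, x n 0, x n 1, …, x n n`, and for `1 ≤ t ≤ n`,
`x_t = a₁ x_{t-1} + … + a_p x_{t-p} + u_t`, `u_t = h̃_t ε_t`,
`h̃_t² = h_t² + α₁ u_{t-1}² + … + α_m u_{t-m}²`.
The initial values `x n (-p+1), …, x n 0` are random variables independent of
`(ε_t)_{t ≥ 1}` and bounded in probability (automatic if they do not depend on `n`). Nothing is
required of the presample errors `u n t`, `t ≤ 0`. -/
structure IsARARCH {Ω : Type*} [MeasurableSpace Ω] (P : Measure Ω) (g : ℝ → ℝ) (ε : ℤ → Ω → ℝ)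
    {p m : ℕ} (a : Fin p → ℝ) (α : Fin m → ℝ) (x u : ℕ → ℤ → Ω → ℝ) : Prop where
  stable : IsStable a
  nonneg : ∀ j, 0 ≤ α j
  ar_eq : ∀ (n : ℕ) (t : ℤ), 1 ≤ t → t ≤ n → ∀ ω,
    x n t ω = (∑ i : Fin p, a i * x n (t - ((i : ℕ) + 1 : ℤ)) ω) + u n t ω
  error_eq : ∀ (n : ℕ) (t : ℤ), 1 ≤ t → t ≤ n → ∀ ω,
    u n t ω =
      √(scale g n t ^ 2 + ∑ j : Fin m, α j * u n (t - ((j : ℕ) + 1 : ℤ)) ω ^ 2) * ε t ω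
  init_measurable : ∀ (n : ℕ) (i : Fin p), Measurable (x n (-((i : ℕ) : ℤ)))
  init_indep : ∀ n : ℕ, IndepFun (fun ω (i : Fin p) => x n (-((i : ℕ) : ℤ)) ω)
    (fun ω (k : ℕ) => ε ((k : ℤ) + 1) ω) P
  init_tight : ∀ δ : ℝ, 0 < δ → ∃ C : ℝ, ∀ (n : ℕ) (i : Fin p),
    P.real {ω | C < |x n (-((i : ℕ) : ℤ)) ω|} ≤ δ

/-- `u_t(θ) = x_t - a₁ x_{t-1} - … - a_p x_{t-p}` for `t ≥ 1`, and `u_t(θ) = 0` for `t ≤ 0`. -/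
def residual {p : ℕ} (x : ℤ → ℝ) (θ : Fin p → ℝ) (t : ℤ) : ℝ :=
  if 1 ≤ t then x t - ∑ i : Fin p, θ i * x (t - ((i : ℕ) + 1 : ℤ)) else 0

/-- `h̃_t²(φ) = h_t² + α₁ u_{t-1}²(θ) + … + α_m u_{t-m}²(θ)`, where `φ = (θ, ϑ)`,
`ϑ = (α₁, …, α_m)`. -/
def archVariance {p m : ℕ} (h x : ℤ → ℝ) (θ : Fin p → ℝ) (ϑ : Fin m → ℝ) (t : ℤ) : ℝ :=
  h t ^ 2 + ∑ j : Fin m, ϑ j * residual x θ (t - ((j : ℕ) + 1 : ℤ)) ^ 2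

/-- The Gaussian quasi log-likelihood (up to a constant),
`-½ ∑_{t=1}^n (u_t²(θ) / h̃_t²(φ) + log h̃_t²(φ))`. -/
def quasiLogLik {p m : ℕ} (n : ℕ) (h x : ℤ → ℝ) (θ : Fin p → ℝ) (ϑ : Fin m → ℝ) : ℝ :=
  -(1 / 2) * ∑ t ∈ Finset.Icc (1 : ℤ) n,
    (residual x θ t ^ 2 / archVariance h x θ ϑ t + Real.log (archVariance h x θ ϑ t))

/-- The normalized score `S(θ) = n^{-1/2} ∂L/∂ϑ` at `φ = (θ, 0)`, in `ℝ^m`. -/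
def score {p : ℕ} (m n : ℕ) (h x : ℤ → ℝ) (θ : Fin p → ℝ) : EuclideanSpace ℝ (Fin m) :=
  WithLp.toLp 2 fun j =>
    1 / √(n : ℝ) * deriv (fun s : ℝ => quasiLogLik n h x θ (Pi.single j s : Fin m → ℝ)) 0

/-- The vector of lags `(x_t, …, x_{t-p+1})`. -/
def lags (p : ℕ) (x : ℤ → ℝ) (t : ℤ) : Fin p → ℝ := fun i => x (t - ((i : ℕ) : ℤ))

open Matrix in
/-- The generalized least-squares estimator
`{∑ h_t⁻² x_t X_{t-1}} {∑ h_t⁻² X_{t-1} X_{t-1}'}⁻¹`, with `X_{t-1} = (x_{t-1}, …, x_{t-p})`. -/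
def gls (p n : ℕ) (h x : ℤ → ℝ) : Fin p → ℝ :=
  (∑ t ∈ Finset.Icc (1 : ℤ) n, ((h t ^ 2)⁻¹ * x t) • lags p x (t - 1)) ᵥ*
    (∑ t ∈ Finset.Icc (1 : ℤ) n,
      (h t ^ 2)⁻¹ • vecMulVec (lags p x (t - 1)) (lags p x (t - 1)))⁻¹

/-- `Var(e²)/4` times the `m × m` matrix with `E(e⁴)` on the diagonal and `1` off it. -/
def asymptoticCov {Ω : Type*} [MeasurableSpace Ω] (P : Measure Ω) (e : Ω → ℝ) (m : ℕ) :
    Matrix (Fin m) (Fin m) ℝ :=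
  (variance (fun ω => e ω ^ 2) P / 4) •
    Matrix.of fun i j : Fin m => if i = j then ∫ ω, e ω ^ 4 ∂P else 1

end

end ARCHTest

/-! Under the null, `u_t = h_t ε_t`, and differentiating the likelihood gives a score whose `j`-th
component is `n^{-1/2}` times the sum of `½ h_t⁻² u_{t-j}²(θ) (u_t²(θ)/h_t² - 1)`. At the true `θ`
the summand is `½ (h_{t-j}²/h_t²) ε_{t-j}² (ε_t² - 1)`, a martingale difference. The proof shows
that two modifications of the unnormalized sum cost only `O_P(1)`, hence vanish after division by
`√n`, and then proves a central limit theorem for what is left.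

Scale ratios. A piecewise Lipschitz `g` makes the sum over `t` of `(h_{t-j}²/h_t² - 1)²` bounded in
`n` (`IsScaleFunction.exists_sum_scaleRatio_le`), so replacing every ratio by `1` changes the
martingale by a sum of bounded variance.

Estimated parameter. Expand the summand in `d = θ̂ - a`. The terms linear in `d` are `d` paired with
martingale sums of size `√n`; the remaining ones are at most `‖d‖²` and `‖d‖⁴` times sums of size
`n` (`abs_score_term_sub_le`). All are `O_P(1)` once `√n d = O_P(1)`. That rate needs the empirical
second-moment matrix of the state to be bounded below by a multiple of `n`. No limit of this matrix
is computed: shifting time by one step shows that its quadratic form at `d` dominates, up to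
`O_P(√n) ‖d‖²`, its value at `d A` plus a multiple of `n` times the squared first coordinate, `A`
being the companion matrix. Iterating `p` times and using that the first coordinates of `d, d A, …,
d A^{p-1}` determine `d` gives the bound (`exists_quadratic_lower_bound`, `quadratic_recursion`).
Stability controls the state by an exponentially damped sum of innovations with bounded eighth
moments; initial values have no moments and are truncated.

Central limit theorem. For a linear combination of the components, adding one summand multiplies the
characteristic function at `θ` by `1 - θ²σ²/2` up to `O(|θ|³)`. The conditional variance may be
replaced by its mean because it involves only the last `m` innovations. With `θ = n^{-1/2}` the `n`
errors add up to `O(n^{-1/2})`. Lévy's continuity theorem and Slutsky's lemma conclude. -/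

namespace ARCHTest

open scoped Topology

/-! ### Boundedness in probability. -/

section BoundedInProbability

variable {Ω : Type*} [MeasurableSpace Ω] {P : Measure Ω}

/-- `Z n = O_P(1)`. -/
def BddInProb (P : Measure Ω) (Z : ℕ → Ω → ℝ) : Prop :=
  ∀ δ : ℝ, 0 < δ → ∃ C : ℝ, ∀ᶠ n in atTop, P.real {ω | C < |Z n ω|} ≤ δ

theorem BddInProb.exists_pos {Z : ℕ → Ω → ℝ} [IsFiniteMeasure P] (h : BddInProb P Z) {δ : ℝ}
    (hδ : 0 < δ) : ∃ C : ℝ, 0 < C ∧ ∀ᶠ n in atTop, P.real {ω | C < |Z n ω|} ≤ δ := by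
  obtain ⟨C, hC⟩ := h δ hδ
  refine ⟨max C 1, by positivity, hC.mono fun n hn => le_trans ?_ hn⟩
  exact measureReal_mono fun ω (hω : max C 1 < _) => lt_of_le_of_lt (le_max_left _ _) hω

theorem BddInProb.of_le_on [IsFiniteMeasure P] {Z Z' : ℕ → Ω → ℝ} (h : BddInProb P Z')
    (B : ℕ → Set Ω) (hB : ∀ δ : ℝ, 0 < δ → ∀ᶠ n in atTop, P.real (B n) ≤ δ)
    (hle : ∀ n, ∀ ω ∉ B n, |Z n ω| ≤ |Z' n ω|) : BddInProb P Z := by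
  intro δ hδ
  obtain ⟨C, hC⟩ := h (δ / 2) (half_pos hδ)
  refine ⟨C, ?_⟩
  filter_upwards [hC, hB (δ / 2) (half_pos hδ)] with n h1 h2
  calc P.real {ω | C < |Z n ω|} ≤ P.real ({ω | C < |Z' n ω|} ∪ B n) := by
        refine measureReal_mono fun ω (hω : C < _) => ?_
        by_cases hb : ω ∈ B n
        · exact Or.inr hb
        · exact Or.inl (lt_of_lt_of_le hω (hle n ω hb))
    _ ≤ _ := (measureReal_union_le _ _).trans (by linarith)

theorem BddInProb.mono [IsFiniteMeasure P] {Z Z' : ℕ → Ω → ℝ} (h : BddInProb P Z')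
    (hle : ∀ n ω, |Z n ω| ≤ |Z' n ω|) : BddInProb P Z :=
  h.of_le_on (fun _ => ∅) (fun δ hδ => by simp [hδ.le]) fun n ω _ => hle n ω

theorem BddInProb.add [IsFiniteMeasure P] {Z Z' : ℕ → Ω → ℝ} (h : BddInProb P Z)
    (h' : BddInProb P Z') : BddInProb P fun n ω => Z n ω + Z' n ω := by
  intro δ hδ
  obtain ⟨C, hC⟩ := h (δ / 2) (half_pos hδ)
  obtain ⟨C', hC'⟩ := h' (δ / 2) (half_pos hδ)
  refine ⟨C + C', ?_⟩
  filter_upwards [hC, hC'] with n h1 h2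
  calc P.real {ω | C + C' < |Z n ω + Z' n ω|}
      ≤ P.real ({ω | C < |Z n ω|} ∪ {ω | C' < |Z' n ω|}) := by
        refine measureReal_mono fun ω (hω : C + C' < |Z n ω + Z' n ω|) => ?_
        by_contra hcon
        simp only [Set.mem_union, Set.mem_ofPred_eq, not_or, not_lt] at hcon
        linarith [abs_add_le (Z n ω) (Z' n ω)]
    _ ≤ _ := (measureReal_union_le _ _).trans (by linarith)

theorem BddInProb.mul [IsFiniteMeasure P] {Z Z' : ℕ → Ω → ℝ} (h : BddInProb P Z)
    (h' : BddInProb P Z') : BddInProb P fun n ω => Z n ω * Z' n ω := by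
  intro δ hδ
  obtain ⟨C, hC0, hC⟩ := h.exists_pos (half_pos hδ)
  obtain ⟨C', hC0', hC'⟩ := h'.exists_pos (half_pos hδ)
  refine ⟨C * C', ?_⟩
  filter_upwards [hC, hC'] with n h1 h2
  calc P.real {ω | C * C' < |Z n ω * Z' n ω|}
      ≤ P.real ({ω | C < |Z n ω|} ∪ {ω | C' < |Z' n ω|}) := by
        refine measureReal_mono fun ω (hω : C * C' < |Z n ω * Z' n ω|) => ?_
        by_contra hcon
        simp only [Set.mem_union, Set.mem_ofPred_eq, not_or, not_lt] at hcon
        rw [abs_mul] at hω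
        exact absurd (mul_le_mul hcon.1 hcon.2 (abs_nonneg _) hC0.le) (not_le.2 hω)
    _ ≤ _ := (measureReal_union_le _ _).trans (by linarith)

theorem BddInProb.const (c : ℝ) : BddInProb P fun _ _ => c := by
  intro δ hδ
  exact ⟨|c|, by simp [hδ.le]⟩

theorem BddInProb.abs {Z : ℕ → Ω → ℝ} (h : BddInProb P Z) : BddInProb P fun n ω => |Z n ω| := by
  simpa [BddInProb] using h

theorem BddInProb.sum [IsFiniteMeasure P] {ι : Type*} (s : Finset ι) {Z : ι → ℕ → Ω → ℝ}
    (h : ∀ i ∈ s, BddInProb P (Z i)) : BddInProb P fun n ω => ∑ i ∈ s, Z i n ω := by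
  classical
  induction s using Finset.induction_on with
  | empty => simpa using BddInProb.const 0
  | insert i s hi ih =>
    simp only [Finset.sum_insert hi]
    exact (h i (Finset.mem_insert_self _ _)).add
      (ih fun l hl => h l (Finset.mem_insert_of_mem hl))

theorem BddInProb.of_integral_le [IsFiniteMeasure P] {Z : ℕ → Ω → ℝ} {K : ℝ}
    (hint : ∀ n, Integrable (Z n) P) (hK : ∀ n, ∫ ω, |Z n ω| ∂P ≤ K) : BddInProb P Z := by
  intro δ hδ
  have hK0 : 0 ≤ K := (integral_nonneg fun ω => abs_nonneg (Z 0 ω)).trans (hK 0)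
  -- Markov's inequality; `K + 1` instead of `K` keeps the threshold positive when `K = 0`.
  refine ⟨(K + 1) / δ, Eventually.of_forall fun n => ?_⟩
  have hpos : 0 < (K + 1) / δ := by positivity
  have hm := mul_meas_ge_le_integral_of_nonneg (μ := P) (f := fun ω => |Z n ω|)
    (Eventually.of_forall fun ω => abs_nonneg _) (hint n).abs ((K + 1) / δ)
  have h1 : P.real {ω | (K + 1) / δ < |Z n ω|} ≤ P.real {ω | (K + 1) / δ ≤ |Z n ω|} :=
    measureReal_mono fun ω (hω : (K + 1) / δ < |Z n ω|) => show (K + 1) / δ ≤ |Z n ω| from hω.le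
  have h2 : (K + 1) / δ * P.real {ω | (K + 1) / δ ≤ |Z n ω|} ≤ K + 1 :=
    hm.trans ((hK n).trans (by linarith))
  have h3 : P.real {ω | (K + 1) / δ ≤ |Z n ω|} ≤ (K + 1) / ((K + 1) / δ) := by
    rw [le_div_iff₀ hpos]; linarith
  have h4 : (K + 1) / ((K + 1) / δ) = δ := by field_simp
  linarith

theorem BddInProb.of_integral_sq_le [IsFiniteMeasure P] {Z : ℕ → Ω → ℝ} {K : ℝ}
    (hint : ∀ n, Integrable (fun ω => Z n ω ^ 2) P) (hK : ∀ n, ∫ ω, Z n ω ^ 2 ∂P ≤ K) :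
    BddInProb P Z := by
  have h : BddInProb P fun n ω => Z n ω ^ 2 :=
    BddInProb.of_integral_le hint fun n => by simpa using hK n
  have h' := h.add (BddInProb.const 1)
  refine h'.mono fun n ω => ?_
  rw [abs_of_nonneg (by positivity : 0 ≤ Z n ω ^ 2 + 1)]
  nlinarith [sq_abs (Z n ω), sq_nonneg (|Z n ω| - 1), abs_nonneg (Z n ω)]

/-- The indicator equals one outside an event of small probability. This is what allows moment
bounds although the initial state, which plays the role of `M`, has no moments. -/
theorem BddInProb.of_truncation [IsFiniteMeasure P] {Z M : ℕ → Ω → ℝ} (hM : BddInProb P M)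
    (h : ∀ C : ℝ, BddInProb P fun n ω => {ω | |M n ω| ≤ C}.indicator 1 ω * Z n ω) :
    BddInProb P Z := by
  intro δ hδ
  obtain ⟨C, hC⟩ := hM (δ / 2) (half_pos hδ)
  obtain ⟨C', hC'⟩ := h C (δ / 2) (half_pos hδ)
  refine ⟨C', ?_⟩
  filter_upwards [hC, hC'] with n h1 h2
  refine le_trans (measureReal_mono (s₂ := {ω | C < |M n ω|} ∪
    {ω | C' < |{ω | |M n ω| ≤ C}.indicator 1 ω * Z n ω|}) fun ω (hω : C' < |Z n ω|) => ?_)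
    ((measureReal_union_le _ _).trans (by linarith))
  by_cases hb : |M n ω| ≤ C
  · right
    simpa [hb] using hω
  · exact Or.inl (not_le.1 hb)

theorem BddInProb.eventually_small [IsFiniteMeasure P] {Z : ℕ → Ω → ℝ} (h : BddInProb P Z)
    {c : ℕ → ℝ} (hc : Tendsto c atTop (𝓝 0)) {η δ : ℝ} (hη : 0 < η) (hδ : 0 < δ) :
    ∀ᶠ n in atTop, P.real {ω | η ≤ |c n * Z n ω|} ≤ δ := by
  obtain ⟨C, hC0, hC⟩ := h.exists_pos hδ
  have hcn : ∀ᶠ n in atTop, |c n| < η / C := by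
    have := hc.abs
    rw [abs_zero] at this
    exact this.eventually_lt_const (by positivity)
  filter_upwards [hC, hcn] with n h1 h2
  refine le_trans (measureReal_mono fun ω (hω : η ≤ _) => ?_) h1
  by_contra hcon
  simp only [Set.mem_ofPred_eq, not_lt] at hcon
  rw [abs_mul] at hω
  have : |c n| * |Z n ω| ≤ |c n| * C := by gcongr
  have : |c n| * C < η := by rwa [lt_div_iff₀ hC0] at h2
  linarith

theorem BddInProb.tendstoInMeasure [IsFiniteMeasure P] {Z : ℕ → Ω → ℝ} (h : BddInProb P Z)
    {c : ℕ → ℝ} (hc : Tendsto c atTop (𝓝 0)) {E : Type*} [NormedAddCommGroup E]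
    {Y : ℕ → Ω → E} (hY : ∀ n ω, ‖Y n ω‖ ≤ |c n * Z n ω|) :
    TendstoInMeasure P Y atTop fun _ => 0 := by
  rw [tendstoInMeasure_iff_norm]
  intro η hη
  have key : Tendsto (fun n => P.real {ω | η ≤ ‖Y n ω - 0‖}) atTop (𝓝 0) := by
    rw [tendsto_order]
    refine ⟨fun a ha => Eventually.of_forall fun n => ha.trans_le measureReal_nonneg,
      fun a ha => ?_⟩
    filter_upwards [h.eventually_small hc hη (half_pos ha)] with n hn
    refine lt_of_le_of_lt ((measureReal_mono fun ω (hω : η ≤ _) => ?_).trans hn) (half_lt_self ha)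
    rw [sub_zero] at hω
    exact hω.trans (hY n ω)
  have := (ENNReal.tendsto_toReal_iff (fun n => measure_ne_top P _) ENNReal.zero_ne_top).1
    (by simpa [Measure.real] using key)
  simpa using this

end BoundedInProbability

/-! ### Second moments of martingale sums. -/

section MartingaleSums

variable {Ω : Type*} [mΩ : MeasurableSpace Ω] {P : Measure Ω}

theorem indepFun_of_indep {m₁ m₂ : MeasurableSpace Ω} {β γ : Type*} [MeasurableSpace β]
    [MeasurableSpace γ] {f : Ω → β} {g : Ω → γ} (h : Indep m₁ m₂ P) (hf : Measurable[m₁] f)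
    (hg : Measurable[m₂] g) : IndepFun f g P :=
  (IndepFun_iff_Indep f g P).2 (indep_of_indep_of_le h hf.comap_le hg.comap_le)

theorem integrable_sq_mul_of_indep [IsProbabilityMeasure P] {Z η : Ω → ℝ}
    (h : IndepFun Z η P) (hZm : Measurable Z) (hηm : Measurable η)
    (hZ : MemLp Z 2 P) (hη : MemLp η 2 P) :
    MemLp (fun ω => Z ω * η ω) 2 P ∧
      ∫ ω, (Z ω * η ω) ^ 2 ∂P = (∫ ω, Z ω ^ 2 ∂P) * ∫ ω, η ω ^ 2 ∂P := by
  have h2 : IndepFun (fun ω => Z ω ^ 2) (fun ω => η ω ^ 2) P :=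
    h.comp (φ := fun x : ℝ => x ^ 2) (ψ := fun x : ℝ => x ^ 2) (by fun_prop) (by fun_prop)
  have hint := h2.integrable_mul hZ.integrable_sq hη.integrable_sq
  constructor
  · refine (memLp_two_iff_integrable_sq (f := fun ω => Z ω * η ω)
    (hZm.mul hηm).aestronglyMeasurable).2 ?_
    simpa [mul_pow] using! hint
  · simp only [mul_pow]
    exact h2.integral_fun_mul_eq_mul_integral hZ.integrable_sq.aestronglyMeasurable
      hη.integrable_sq.aestronglyMeasurable

/-- Second moment of a sum of martingale differences `Z k * η k`. -/
theorem memLp_martingale_sum [IsProbabilityMeasure P] {F : ℕ → MeasurableSpace Ω}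
    (hF : ∀ k, F k ≤ mΩ) (hmono : Monotone F) {η Z : ℕ → Ω → ℝ}
    (hη : ∀ k, Measurable[F (k + 1)] (η k))
    (hind : ∀ k, Indep (F k) (MeasurableSpace.comap (η k) inferInstance) P)
    (hη0 : ∀ k, ∫ ω, η k ω ∂P = 0) (hη2 : ∀ k, MemLp (η k) 2 P) {n : ℕ}
    (hZ : ∀ k < n, Measurable[F k] (Z k)) (hZ2 : ∀ k < n, MemLp (Z k) 2 P) :
    Measurable[F n] (fun ω => ∑ k ∈ Finset.range n, Z k ω * η k ω) ∧
    MemLp (fun ω => ∑ k ∈ Finset.range n, Z k ω * η k ω) 2 P ∧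
    ∫ ω, (∑ k ∈ Finset.range n, Z k ω * η k ω) ^ 2 ∂P =
      ∑ k ∈ Finset.range n, (∫ ω, Z k ω ^ 2 ∂P) * ∫ ω, η k ω ^ 2 ∂P := by
  induction n with
  | zero => simp
  | succ n ih =>
    obtain ⟨h1, h2, h3⟩ := ih (fun k hk => hZ k (hk.trans n.lt_succ_self))
      fun k hk => hZ2 k (hk.trans n.lt_succ_self)
    set S : Ω → ℝ := fun ω => ∑ k ∈ Finset.range n, Z k ω * η k ω with hS
    have hZn := hZ n n.lt_succ_self
    have hZ2n := hZ2 n n.lt_succ_self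
    have hηm : Measurable[MeasurableSpace.comap (η n) inferInstance] (η n) :=
      comap_measurable _
    have hi : IndepFun (Z n) (η n) P := indepFun_of_indep (hind n) hZn hηm
    obtain ⟨h4, h5⟩ := integrable_sq_mul_of_indep hi (hZn.mono (hF n) le_rfl)
      ((hη n).mono (hF _) le_rfl) hZ2n (hη2 n)
    have hSZ : Measurable[F n] (fun ω => S ω * Z n ω) := Measurable.mul h1 hZn
    have hi' : IndepFun (fun ω => S ω * Z n ω) (η n) P := indepFun_of_indep (hind n) hSZ hηm
    have hSZint : Integrable (fun ω => S ω * Z n ω) P := h2.integrable_mul hZ2n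
    -- Orthogonality of martingale differences: `S * Z n` is known before the centred `η n` is
    -- drawn, so the expectation of the product factorizes and vanishes.
    have hcross : ∫ ω, S ω * Z n ω * η n ω ∂P = 0 := by
      rw [hi'.integral_fun_mul_eq_mul_integral hSZint.aestronglyMeasurable
        (hη2 n).aestronglyMeasurable, hη0, mul_zero]
    have hcrossint : Integrable (fun ω => S ω * Z n ω * η n ω) P :=
      hi'.integrable_mul hSZint ((hη2 n).integrable (by norm_num))
    simp only [Finset.sum_range_succ]
    refine ⟨?_, h2.add h4, ?_⟩
    · exact Measurable.add (h1.mono (hmono n.le_succ) le_rfl)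
        (Measurable.mul (hZn.mono (hmono n.le_succ) le_rfl) (hη n))
    · have : ∀ ω, (S ω + Z n ω * η n ω) ^ 2 =
          S ω ^ 2 + 2 * (S ω * Z n ω * η n ω) + (Z n ω * η n ω) ^ 2 := fun ω => by ring
      change ∫ ω, (S ω + Z n ω * η n ω) ^ 2 ∂P = _
      simp only [this]
      rw [integral_add (f := fun ω => S ω ^ 2 + 2 * (S ω * Z n ω * η n ω))
        (h2.integrable_sq.add (hcrossint.const_mul 2)) h4.integrable_sq,
          integral_add h2.integrable_sq (hcrossint.const_mul 2), integral_const_mul, hcross, h5, h3]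
      simp

end MartingaleSums

end ARCHTest

namespace ARCHTest

open scoped Topology
open Matrix

/-! ### Stability and controllability of the companion matrix. -/

section Companion

variable {p : ℕ}

/-- The state-space matrix of the autoregression with coefficients `a`. -/
def companion {R : Type*} [CommRing R] (a : Fin p → R) : Matrix (Fin p) (Fin p) R :=
  Matrix.of fun i l => if (i : ℕ) = 0 then a l else if (l : ℕ) + 1 = i then 1 else 0

/-- The first coordinate vector (empty if `p = 0`). -/
def firstVec (p : ℕ) (R : Type*) [CommRing R] : Fin p → R := fun i => if (i : ℕ) = 0 then 1 else 0

theorem companion_mulVec_zero {R : Type*} [CommRing R] (a v : Fin p → R) (i : Fin p)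
    (hi : (i : ℕ) = 0) : (companion a *ᵥ v) i = ∑ l, a l * v l := by
  simp [companion, mulVec, dotProduct, hi]

theorem companion_mulVec_succ {R : Type*} [CommRing R] (a v : Fin p → R) (i l : Fin p)
    (hi : (l : ℕ) + 1 = i) : (companion a *ᵥ v) i = v l := by
  have h0 : (i : ℕ) ≠ 0 := by omega
  simp only [companion, mulVec, dotProduct, Matrix.of_apply, h0, if_false]
  rw [Finset.sum_eq_single l]
  · simp [hi]
  · intro k _ hk
    have : (k : ℕ) + 1 ≠ i := fun h => hk (Fin.ext (by omega))
    simp [this]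
  · simp

theorem vecMul_companion {R : Type*} [CommRing R] (a d : Fin p → R) (l : Fin p)
    (hd : d ⬝ᵥ firstVec p R = 0) :
    (d ᵥ* companion a) l = ∑ i : Fin p, if (l : ℕ) + 1 = i then d i else 0 := by
  have hd0 : ∀ i : Fin p, (i : ℕ) = 0 → d i = 0 := by
    intro i hi
    have : d ⬝ᵥ firstVec p R = d i := by
      simp only [dotProduct, firstVec]
      rw [Finset.sum_eq_single i]
      · simp [hi]
      · intro k _ hk
        have : (k : ℕ) ≠ 0 := fun h => hk (Fin.ext (by omega))
        simp [this]
      · simp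
    rw [← this, hd]
  simp only [companion, vecMul, dotProduct, Matrix.of_apply]
  refine Finset.sum_congr rfl fun i _ => ?_
  by_cases hi : (i : ℕ) = 0
  · simp [hd0 i hi]
  · simp [hi]

/-- Controllability. If the first coordinate of `d` vanishes, the coefficient row of the matrix
drops out and `d A` is `d` shifted by one place, so the vanishing of coordinate `j` of `d A` is that
of coordinate `j + 1` of `d`. Induction on `j` finishes; stability plays no role. -/
theorem eq_zero_of_vecMul_companion_pow {R : Type*} [CommRing R] (a : Fin p → R) (d : Fin p → R)
    (hd : ∀ k < p, (d ᵥ* companion a ^ k) ⬝ᵥ firstVec p R = 0) : d = 0 := by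
  have key : ∀ (j : ℕ) (d : Fin p → R),
      (∀ k ≤ j, (d ᵥ* companion a ^ k) ⬝ᵥ firstVec p R = 0) → ∀ i : Fin p, (i : ℕ) = j → d i = 0 :=
        by
    intro j
    induction j with
    | zero =>
      intro d hd i hi
      have h := hd 0 le_rfl
      rw [pow_zero, vecMul_one] at h
      simp only [dotProduct, firstVec] at h
      rw [Finset.sum_eq_single i] at h
      · simpa [hi] using h
      · intro k _ hk
        have : (k : ℕ) ≠ 0 := fun h => hk (Fin.ext (by omega))
        simp [this]
      · simp
    | succ j ih =>
      intro d hd i hi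
      have h0 := hd 0 (Nat.zero_le _)
      rw [pow_zero, vecMul_one] at h0
      have hj : j < p := by omega
      have h1 := ih (d ᵥ* companion a) (fun k hk => by
        rw [vecMul_vecMul, ← pow_succ']; exact hd (k + 1) (by omega)) ⟨j, hj⟩ rfl
      rw [vecMul_companion a d _ h0, Finset.sum_eq_single i] at h1
      · simpa [hi] using h1
      · intro k _ hk
        have : j + 1 ≠ (k : ℕ) := fun h => hk (Fin.ext (by omega))
        simp [this]
      · simp
  ext i
  exact key i d (fun k hk => hd k (lt_of_le_of_lt hk i.2)) i rfl

/-- The shift rows force `v_j = z⁻ʲ v_0`, and the top row then says that `v_0` times the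
autoregressive polynomial at `z⁻¹` is zero. Since `‖z⁻¹‖ ≤ 1`, stability makes the second factor
nonzero. -/
theorem companion_eigenvector_eq_zero {a : Fin p → ℝ} (ha : IsStable a) {z : ℂ} (hz : 1 ≤ ‖z‖)
    {v : Fin p → ℂ} (hv : companion (fun i => (a i : ℂ)) *ᵥ v = z • v) : v = 0 := by
  have hz0 : z ≠ 0 := fun h => by simp [h] at hz; linarith
  rcases Nat.eq_zero_or_pos p with rfl | hp
  · exact Subsingleton.elim _ _
  have hcoord : ∀ (j : ℕ) (hj : j < p), v ⟨j, hj⟩ = z⁻¹ ^ j * v ⟨0, hp⟩ := by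
    intro j
    induction j with
    | zero => intro hj; simp
    | succ j ih =>
      intro hj
      have h := congrFun hv ⟨j + 1, hj⟩
      rw [companion_mulVec_succ _ _ ⟨j + 1, hj⟩ ⟨j, by omega⟩ rfl, ih (by omega), Pi.smul_apply,
        smul_eq_mul] at h
      rw [pow_succ', mul_assoc, h, inv_mul_cancel_left₀ hz0]
  have h := congrFun hv ⟨0, hp⟩
  rw [companion_mulVec_zero _ _ _ rfl, Pi.smul_apply, smul_eq_mul] at h
  have hstab := ha z⁻¹ (by rw [norm_inv]; exact inv_le_one_of_one_le₀ hz)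
  have h2 : v ⟨0, hp⟩ * (1 - ∑ i : Fin p, (a i : ℂ) * z⁻¹ ^ ((i : ℕ) + 1)) = 0 := by
    have : ∑ i : Fin p, (a i : ℂ) * v i =
        z * (v ⟨0, hp⟩ * ∑ i : Fin p, (a i : ℂ) * z⁻¹ ^ ((i : ℕ) + 1)) := by
      rw [Finset.mul_sum, Finset.mul_sum]
      refine Finset.sum_congr rfl fun i _ => ?_
      rw [hcoord i i.2, pow_succ]
      field_simp
    rw [this] at h
    rw [mul_sub, mul_one, mul_left_cancel₀ hz0 h, sub_self]
  have h3 : v ⟨0, hp⟩ = 0 := (mul_eq_zero.1 h2).resolve_right hstab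
  ext j
  have := hcoord j j.2
  simpa [h3] using this

/-- Gelfand's formula: for `r` strictly between the spectral radius and `1`, eventually `‖T ^ k‖ ≤ r
^ k`; the finitely many other powers are absorbed in the constant. -/
theorem exists_norm_pow_le_of_spectralRadius_lt_one {A : Type*} [NormedRing A] [NormedAlgebra ℂ A]
    [CompleteSpace A] (T : A) (hT : spectralRadius ℂ T < 1) :
    ∃ C ρ : ℝ, 0 < C ∧ 0 < ρ ∧ ρ < 1 ∧ ∀ k : ℕ, ‖T ^ k‖ ≤ C * ρ ^ k := by
  obtain ⟨r, hr1, hr2⟩ := ENNReal.lt_iff_exists_nnreal_btwn.1 hT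
  have hr2' : r < 1 := by exact_mod_cast hr2
  have hr0 : 0 < r := by
    rcases eq_or_ne r 0 with h | h
    · simp [h] at hr1
    · exact pos_iff_ne_zero.2 h
  have h := (spectrum.pow_nnnorm_pow_one_div_tendsto_nhds_spectralRadius T).eventually_lt_const hr1
  obtain ⟨N, hN⟩ := eventually_atTop.1 h
  have hρ : (0 : ℝ) < r := hr0
  refine ⟨1 + ∑ k ∈ Finset.range (N + 1), ‖T ^ k‖ / (r : ℝ) ^ k, r, by positivity, hρ,
    by exact_mod_cast hr2', fun k => ?_⟩
  have hsum : 0 ≤ ∑ k ∈ Finset.range (N + 1), ‖T ^ k‖ / (r : ℝ) ^ k := by positivity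
  rcases lt_or_ge N k with hk | hk
  · have h1 := hN k hk.le
    have hk0 : (0 : ℝ) < k := by exact_mod_cast (Nat.zero_le N).trans_lt hk
    have h2 : (‖T ^ k‖₊ : ENNReal) ≤ (r : ENNReal) ^ k := by
      have := ENNReal.rpow_le_rpow h1.le hk0.le
      rwa [← ENNReal.rpow_mul, one_div_mul_cancel hk0.ne', ENNReal.rpow_one,
        ENNReal.rpow_natCast] at this
    have h3 : ‖T ^ k‖ ≤ (r : ℝ) ^ k := by exact_mod_cast h2
    calc ‖T ^ k‖ ≤ 1 * (r : ℝ) ^ k := by linarith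
      _ ≤ _ := by gcongr; linarith
  · have h1 : ‖T ^ k‖ / (r : ℝ) ^ k ≤ ∑ k ∈ Finset.range (N + 1), ‖T ^ k‖ / (r : ℝ) ^ k :=
      Finset.single_le_sum (f := fun k => ‖T ^ k‖ / (r : ℝ) ^ k) (fun i _ => by positivity)
        (Finset.mem_range.2 (by omega))
    have h2 : (0 : ℝ) < (r : ℝ) ^ k := by positivity
    rw [← div_le_iff₀ h2]
    linarith

/-- The matrix is complexified so that its spectrum can be used. In finite dimension the spectrum
consists of eigenvalues, which lie in the open unit disc by the previous lemmas, and embedding real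
vectors in complex ones preserves the sup norm. -/
theorem exists_norm_companion_pow_mulVec_le {a : Fin p → ℝ} (ha : IsStable a) :
    ∃ C ρ : ℝ, 0 < C ∧ 0 < ρ ∧ ρ < 1 ∧
      ∀ (k : ℕ) (v : Fin p → ℝ), ‖companion a ^ k *ᵥ v‖ ≤ C * ρ ^ k * ‖v‖ := by
  rcases Nat.eq_zero_or_pos p with rfl | hp
  · refine ⟨1, 1 / 2, by norm_num, by norm_num, by norm_num, fun k v => ?_⟩
    rw [Subsingleton.elim (companion a ^ k *ᵥ v) 0, norm_zero]
    positivity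
  have : Nonempty (Fin p) := ⟨⟨0, hp⟩⟩
  set B : Matrix (Fin p) (Fin p) ℂ := companion (fun i => (a i : ℂ)) with hB
  set T : (Fin p → ℂ) →L[ℂ] (Fin p → ℂ) := LinearMap.toContinuousLinearMap (Matrix.mulVecLin B)
    with hT
  have hTv : ∀ v, T v = B *ᵥ v := fun v => rfl
  have hspec : spectralRadius ℂ T < 1 := by
    have : spectralRadius ℂ T < ((1 : NNReal) : ENNReal) := by
      refine spectrum.spectralRadius_lt_of_forall_lt T fun z hz => ?_
      by_contra hcon
      have hz1 : 1 ≤ ‖z‖ := by exact_mod_cast not_lt.1 hcon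
      refine hz ?_
      have hinj : Function.Injective (algebraMap ℂ ((Fin p → ℂ) →L[ℂ] (Fin p → ℂ)) z - T) := by
        rw [injective_iff_map_eq_zero]
        intro v hv
        refine companion_eigenvector_eq_zero ha hz1 ?_
        have : z • v - T v = 0 := by
          simpa [Algebra.algebraMap_eq_smul_one] using hv
        rw [← hB, ← hTv, ← sub_eq_zero.1 this]
      rw [spectrum.mem_resolventSet_iff, ContinuousLinearMap.isUnit_iff_bijective]
      refine ⟨hinj, ?_⟩
      exact (LinearMap.injective_iff_surjective
        (f := ((algebraMap ℂ ((Fin p → ℂ) →L[ℂ] (Fin p → ℂ)) z - T :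
          (Fin p → ℂ) →L[ℂ] (Fin p → ℂ)) : (Fin p → ℂ) →ₗ[ℂ] (Fin p → ℂ)))).1 hinj
    simpa using this
  obtain ⟨C, ρ, hC, hρ0, hρ1, hle⟩ := exists_norm_pow_le_of_spectralRadius_lt_one T hspec
  refine ⟨C, ρ, hC, hρ0, hρ1, fun k v => ?_⟩
  have hmap : ∀ w : Fin p → ℝ,
      B *ᵥ (fun i => (w i : ℂ)) = fun i => ((companion a *ᵥ w) i : ℂ) := by
    intro w
    ext i
    simp only [hB, companion, mulVec, dotProduct, Matrix.of_apply]
    push_cast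
    refine Finset.sum_congr rfl fun l _ => ?_
    split_ifs <;> simp
  have hpow : ∀ k, (T ^ k) (fun i => (v i : ℂ)) = fun i => ((companion a ^ k *ᵥ v) i : ℂ) := by
    intro k
    induction k with
    | zero => simp
    | succ k ih =>
      rw [pow_succ', mul_apply_eq_comp, ih, hTv, hmap, mulVec_mulVec, ← pow_succ']
  have hnorm : ∀ w : Fin p → ℝ, ‖(fun i => (w i : ℂ))‖ = ‖w‖ := by
    intro w
    simp [Pi.norm_def]
  rw [← hnorm, ← hnorm, ← hpow]
  exact ((T ^ k).le_opNorm _).trans (by gcongr; exact hle k)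

/-- A quadratic form that dominates its image under the transposed companion matrix plus a
multiple of the squared first coordinate is bounded below, up to the error of the domination. -/
theorem exists_quadratic_lower_bound (a : Fin p → ℝ) : ∃ c₁ c₂ : ℝ, 0 < c₁ ∧ 0 < c₂ ∧
    ∀ (q : (Fin p → ℝ) → ℝ) (c e : ℝ), 0 ≤ c → 0 ≤ e → (∀ d, 0 ≤ q d) →
      (∀ d, q (d ᵥ* companion a) + c * (d ⬝ᵥ firstVec p ℝ) ^ 2 - e * ‖d‖ ^ 2 ≤ q d) →
      ∀ d, (c * c₁ - e * c₂) * ‖d‖ ^ 2 ≤ q d := by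
  set A := companion a
  let Lk : ℕ → (Fin p → ℝ) →ₗ[ℝ] (Fin p → ℝ) := fun k => Matrix.vecMulLinear (A ^ k)
  let L : (Fin p → ℝ) →ₗ[ℝ] (Fin p → ℝ) :=
    LinearMap.pi fun k : Fin p => (dotProductBilin ℝ ℝ).flip (firstVec p ℝ) ∘ₗ Lk k
  have hL : ∀ d k, L d k = (d ᵥ* A ^ (k : ℕ)) ⬝ᵥ firstVec p ℝ := fun d k => rfl
  have hker : LinearMap.ker L = ⊥ := by
    rw [LinearMap.ker_eq_bot']
    intro d hd
    refine eq_zero_of_vecMul_companion_pow a d fun k hk => ?_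
    exact congrFun hd ⟨k, hk⟩
  -- An injective linear map on a finite-dimensional space is bounded below. `L d` collects the
  -- first coordinates of `d A ^ k`, `k < p`.
  obtain ⟨K, hK0, hK⟩ := L.exists_antilipschitzWith hker
  have hK' : ∀ d, ‖d‖ ≤ K * ‖L d‖ := fun d => by
    simpa [dist_zero_right] using hK.le_mul_dist d 0
  have hbd : ∀ k : ℕ, ∃ B : ℝ, 0 ≤ B ∧ ∀ d, ‖d ᵥ* A ^ k‖ ≤ B * ‖d‖ := fun k =>
    ⟨‖LinearMap.toContinuousLinearMap (Lk k)‖, norm_nonneg _,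
      fun d => (LinearMap.toContinuousLinearMap (Lk k)).le_opNorm d⟩
  choose B hB0 hB using hbd
  have hKpos : (0 : ℝ) < K := by exact_mod_cast hK0
  refine ⟨(1 / (K : ℝ)) ^ 2, 1 + ∑ k ∈ Finset.range p, B k ^ 2, by positivity, by positivity,
    fun q c e hc he hq0 hq d => ?_⟩
  -- The hypothesis is applied along the orbit `d, d A, …`; after `p` steps the collected first
  -- coordinates control `‖d‖` from below by `c₁`, and the collected errors amount to at most `e *
  -- c₂ * ‖d‖ ^ 2`.
  have hiter : ∀ N : ℕ, ∑ k ∈ Finset.range N,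
      (c * ((d ᵥ* A ^ k) ⬝ᵥ firstVec p ℝ) ^ 2 - e * ‖d ᵥ* A ^ k‖ ^ 2) + q (d ᵥ* A ^ N) ≤ q d := by
    intro N
    induction N with
    | zero => simp
    | succ N ih =>
      rw [Finset.sum_range_succ]
      have := hq (d ᵥ* A ^ N)
      rw [vecMul_vecMul, ← pow_succ] at this
      linarith
  have h1 := hiter p
  have h2 := hq0 (d ᵥ* A ^ p)
  rw [Finset.sum_sub_distrib, ← Finset.mul_sum, ← Finset.mul_sum] at h1
  have h3 : ∑ k ∈ Finset.range p, ‖d ᵥ* A ^ k‖ ^ 2 ≤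
      (1 + ∑ k ∈ Finset.range p, B k ^ 2) * ‖d‖ ^ 2 := by
    calc ∑ k ∈ Finset.range p, ‖d ᵥ* A ^ k‖ ^ 2 ≤ ∑ k ∈ Finset.range p, B k ^ 2 * ‖d‖ ^ 2 := by
          refine Finset.sum_le_sum fun k _ => ?_
          rw [← mul_pow]
          exact pow_le_pow_left₀ (norm_nonneg _) (hB k d) 2
      _ ≤ _ := by rw [← Finset.sum_mul]; gcongr; linarith
  have h4 : (1 / (K : ℝ)) ^ 2 * ‖d‖ ^ 2 ≤
      ∑ k ∈ Finset.range p, ((d ᵥ* A ^ k) ⬝ᵥ firstVec p ℝ) ^ 2 := by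
    have h5 : ‖L d‖ ^ 2 ≤ ∑ k : Fin p, (L d k) ^ 2 := by
      have hs : ‖L d‖ ≤ √(∑ k : Fin p, (L d k) ^ 2) := by
        refine (pi_norm_le_iff_of_nonneg (Real.sqrt_nonneg _)).2 fun k => ?_
        refine Real.le_sqrt_of_sq_le ?_
        rw [Real.norm_eq_abs, sq_abs]
        exact Finset.single_le_sum (f := fun k => L d k ^ 2) (fun i _ => sq_nonneg _)
          (Finset.mem_univ k)
      calc _ ≤ √(∑ k : Fin p, (L d k) ^ 2) ^ 2 := pow_le_pow_left₀ (norm_nonneg _) hs 2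
        _ = _ := Real.sq_sqrt (Finset.sum_nonneg fun i _ => sq_nonneg _)
    rw [Finset.sum_range (fun k => ((d ᵥ* A ^ k) ⬝ᵥ firstVec p ℝ) ^ 2)]
    refine le_trans ?_ h5
    rw [← mul_pow]
    refine pow_le_pow_left₀ (by positivity) ?_ 2
    rw [one_div, inv_mul_le_iff₀ hKpos]
    exact hK' d
  have h6 := mul_le_mul_of_nonneg_left h3 he
  have h7 := mul_le_mul_of_nonneg_left h4 hc
  nlinarith

end Companion

end ARCHTest

namespace ARCHTest

open scoped Topology

/-! ### σ-algebras and moments of the innovations. -/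

section SigmaAlgebras

variable {Ω : Type*}

/-- The σ-algebra generated by `ε i`, `i ∈ S`. -/
@[reducible]
def sigmaOf (ε : ℤ → Ω → ℝ) (S : Set ℤ) : MeasurableSpace Ω :=
  ⨆ i ∈ S, MeasurableSpace.comap (ε i) inferInstance

theorem sigmaOf_mono (ε : ℤ → Ω → ℝ) {S T : Set ℤ} (h : S ⊆ T) : sigmaOf ε S ≤ sigmaOf ε T :=
  biSup_mono fun _ hi => h hi

theorem measurable_sigmaOf (ε : ℤ → Ω → ℝ) {S : Set ℤ} {i : ℤ} (hi : i ∈ S) :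
    Measurable[sigmaOf ε S] (ε i) :=
  (comap_measurable (ε i)).mono (le_iSup₂_of_le i hi le_rfl) le_rfl

variable [mΩ : MeasurableSpace Ω] {P : Measure Ω}

theorem sigmaOf_le {ε : ℤ → Ω → ℝ} (hε : ∀ i, Measurable (ε i)) (S : Set ℤ) : sigmaOf ε S ≤ mΩ :=
  iSup₂_le fun i _ => (hε i).comap_le

theorem indep_sigmaOf {ε : ℤ → Ω → ℝ} (hε : ∀ i, Measurable (ε i)) (h : iIndepFun ε P)
    {S T : Set ℤ} (hST : Disjoint S T) : Indep (sigmaOf ε S) (sigmaOf ε T) P :=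
  indep_iSup_of_disjoint (fun i => (hε i).comap_le) h.iIndep hST

theorem memLp_natCast_of_integrable_pow {f : Ω → ℝ} (hf : AEStronglyMeasurable f P) {k : ℕ}
    (hk : k ≠ 0) (h : Integrable (fun ω => |f ω| ^ k) P) : MemLp f k P := by
  rw [← integrable_norm_rpow_iff hf (by exact_mod_cast hk) (by simp)]
  simpa using h

theorem integrable_pow_of_memLp {f : Ω → ℝ} {k : ℕ} (hk : k ≠ 0) (h : MemLp f k P) :
    Integrable (fun ω => |f ω| ^ k) P := by
  have := (integrable_norm_rpow_iff h.1 (by exact_mod_cast hk) (by simp)).2 h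
  simpa using this

end SigmaAlgebras

section Innovations

variable {Ω : Type*} [mΩ : MeasurableSpace Ω] {P : Measure Ω}
  {ε : ℤ → Ω → ℝ}

/-- From `|x|⁸ ≤ 1 + |x|^s`. All later moment bounds rest on the eighth moment alone. -/
theorem IsInnovation.memLp_eight [IsProbabilityMeasure P] (hε : IsInnovation P ε) (t : ℤ) :
    MemLp (ε t) 8 P := by
  have h0 : MemLp (ε 0) 8 P := by
    obtain ⟨s, hs, hint⟩ := hε.moment
    have := memLp_natCast_of_integrable_pow (P := P) (k := 8) (hε.measurable 0).aestronglyMeasurable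
      (by norm_num) (((integrable_const 1).add hint).mono'
        (by have := hε.measurable 0; fun_prop) (Eventually.of_forall fun ω => ?_))
    · exact_mod_cast this
    · rw [Real.norm_of_nonneg (by positivity)]
      simp only [Pi.add_apply]
      rcases le_total (|ε 0 ω|) 1 with h | h
      · have h1 : |ε 0 ω| ^ 8 ≤ 1 := pow_le_one₀ (abs_nonneg _) h
        have h2 : 0 ≤ |ε 0 ω| ^ s := by positivity
        linarith
      · have h1 : |ε 0 ω| ^ 8 ≤ |ε 0 ω| ^ s := by
          rw [← Real.rpow_natCast]
          exact Real.rpow_le_rpow_of_exponent_le h (by push_cast; exact hs.le)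
        linarith
  exact (hε.identDistrib t).memLp_iff.2 h0

theorem IsInnovation.integral_comp (hε : IsInnovation P ε) (t : ℤ) {f : ℝ → ℝ}
    (hf : Measurable f) : ∫ ω, f (ε t ω) ∂P = ∫ ω, f (ε 0 ω) ∂P :=
  ((hε.identDistrib t).comp hf).integral_eq

theorem IsInnovation.integrable_pow_eight [IsProbabilityMeasure P] (hε : IsInnovation P ε) (t : ℤ) :
    Integrable (fun ω => |ε t ω| ^ 8) P :=
  integrable_pow_of_memLp (by norm_num) (by exact_mod_cast hε.memLp_eight t)

theorem IsInnovation.integrable_pow [IsProbabilityMeasure P] (hε : IsInnovation P ε) (t : ℤ)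
    {k : ℕ} (hk : k ≤ 8) :
    Integrable (fun ω => ε t ω ^ k) P := by
  refine ((integrable_const 1).add (hε.integrable_pow_eight t)).mono'
    (by have := hε.measurable t; fun_prop) (Eventually.of_forall fun ω => ?_)
  rw [norm_pow, Real.norm_eq_abs, Pi.add_apply]
  rcases le_total (|ε t ω|) 1 with h | h
  · have h1 : |ε t ω| ^ k ≤ 1 := pow_le_one₀ (abs_nonneg _) h
    have h2 : 0 ≤ |ε t ω| ^ 8 := by positivity
    linarith
  · linarith [pow_le_pow_right₀ h hk]

theorem IsInnovation.memLp_two [IsProbabilityMeasure P] (hε : IsInnovation P ε) (t : ℤ) :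
    MemLp (ε t) 2 P :=
  (hε.memLp_eight t).mono_exponent (by norm_num)

theorem IsInnovation.integral_eq_zero (hε : IsInnovation P ε) (t : ℤ) : ∫ ω, ε t ω ∂P = 0 :=
  (hε.identDistrib t).integral_eq.trans hε.mean_zero

theorem IsInnovation.integral_sq [IsProbabilityMeasure P] (hε : IsInnovation P ε) (t : ℤ) :
    ∫ ω, ε t ω ^ 2 ∂P = 1 := by
  rw [hε.integral_comp t (f := fun x => x ^ 2) (by fun_prop)]
  have := hε.unit_variance
  rw [variance_of_integral_eq_zero (hε.measurable 0).aemeasurable hε.mean_zero] at this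
  exact this

theorem IsInnovation.integral_sq_sub_one [IsProbabilityMeasure P] (hε : IsInnovation P ε) (t : ℤ) :
    ∫ ω, (ε t ω ^ 2 - 1) ∂P = 0 := by
  rw [integral_sub (hε.integrable_pow t (by norm_num)) (integrable_const 1), hε.integral_sq]
  simp

theorem IsInnovation.memLp_sq [IsProbabilityMeasure P] (hε : IsInnovation P ε) (t : ℤ) :
    MemLp (fun ω => ε t ω ^ 2) 4 P := by
  have := memLp_natCast_of_integrable_pow (P := P) (k := 4) (f := fun ω => ε t ω ^ 2)
    (by have := hε.measurable t; fun_prop) (by norm_num)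
    (by simpa only [abs_pow, ← pow_mul] using hε.integrable_pow_eight t)
  exact_mod_cast this

theorem IsInnovation.memLp_sq_sub_one [IsProbabilityMeasure P] (hε : IsInnovation P ε) (t : ℤ) :
    MemLp (fun ω => ε t ω ^ 2 - 1) 4 P :=
  (hε.memLp_sq t).sub (memLp_const 1)

theorem IsInnovation.integral_sq_sub_one_sq [IsProbabilityMeasure P] (hε : IsInnovation P ε)
    (t : ℤ) :
    ∫ ω, (ε t ω ^ 2 - 1) ^ 2 ∂P = variance (fun ω => ε 0 ω ^ 2) P := by
  rw [variance_eq_integral (by have := hε.measurable 0; fun_prop), hε.integral_sq,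
    hε.integral_comp t (f := fun x => (x ^ 2 - 1) ^ 2) (by fun_prop)]

end Innovations

/-! ### Central limit theorem for the quadratic martingale. -/

section OneStep

open Complex

variable {Ω : Type*} {F : MeasurableSpace Ω} [mΩ : MeasurableSpace Ω] {P : Measure Ω}
  [IsProbabilityMeasure P]

/-- Taylor's bound for `|x| ≤ 1`; for larger `|x|` each term is at most a multiple of `|x|³`, with
total `7/2`. As the estimate is global, third moments suffice and no Lindeberg truncation is needed.
-/
theorem norm_exp_I_mul_sub_taylor_le (x : ℝ) :
    ‖exp (I * x) - (1 + I * x - (x : ℂ) ^ 2 / 2)‖ ≤ 4 * |x| ^ 3 := by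
  rcases le_total |x| 1 with h | h
  · have hx : ‖I * (x : ℂ)‖ = |x| := by simp
    have := Complex.exp_bound (x := I * x) (by rw [hx]; exact h) (n := 3) (by norm_num)
    rw [hx] at this
    have h2 : ∑ m ∈ Finset.range 3, (I * (x : ℂ)) ^ m / m.factorial = 1 + I * x - (x : ℂ) ^ 2 / 2 :=
      by
      simp only [Finset.sum_range_succ, Finset.sum_range_zero]
      simp only [Nat.factorial, mul_pow, I_sq]
      push_cast
      ring
    rw [h2] at this
    refine this.trans ?_
    have h3 : 0 ≤ |x| ^ 3 := by positivity
    norm_num [Nat.factorial]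
    nlinarith
  · have h1 : ‖exp (I * x)‖ = 1 := norm_exp_I_mul_ofReal x
    have h2 : ‖1 + I * x - (x : ℂ) ^ 2 / 2‖ ≤ 1 + |x| + |x| ^ 2 / 2 := by
      refine (norm_sub_le _ _).trans (add_le_add ((norm_add_le _ _).trans ?_) ?_)
      · simp
      · simp
    refine (norm_sub_le _ _).trans ?_
    rw [h1]
    have h3 : |x| ≤ |x| ^ 3 := by
      nlinarith [sq_nonneg (|x| - 1), mul_nonneg (abs_nonneg x) (sub_nonneg.2 h)]
    have h4 : |x| ^ 2 ≤ |x| ^ 3 := pow_le_pow_right₀ h (by norm_num)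
    linarith

/-- Second-order expansion of the characteristic function of a sum to which a martingale
difference `θ W η` is added. -/
theorem norm_integral_mul_exp_sub_le (hF : F ≤ mΩ) {Z : Ω → ℂ}
    {W η : Ω → ℝ} (hZ : Measurable[F] Z) (hZ1 : ∀ ω, ‖Z ω‖ ≤ 1) (hW : Measurable[F] W)
    (hη : Measurable η) (hind : Indep F (MeasurableSpace.comap η inferInstance) P)
    (hW3 : MemLp W 3 P) (hη3 : MemLp η 3 P) (hη0 : ∫ ω, η ω ∂P = 0) (θ : ℝ) :
    ‖∫ ω, Z ω * exp (I * (θ * (W ω * η ω) : ℝ)) ∂P - ∫ ω, Z ω ∂P +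
        (θ ^ 2 / 2 * ∫ ω, η ω ^ 2 ∂P : ℝ) * ∫ ω, Z ω * (W ω : ℂ) ^ 2 ∂P‖ ≤
      4 * |θ| ^ 3 * ((∫ ω, |W ω| ^ 3 ∂P) * ∫ ω, |η ω| ^ 3 ∂P) := by
  have hZm := hZ.mono hF le_rfl
  have hWm := hW.mono hF le_rfl
  have hηc : Measurable[MeasurableSpace.comap η inferInstance] η := comap_measurable _
  have hZi : Integrable Z P := Integrable.of_bound hZm.aestronglyMeasurable 1
    (Eventually.of_forall hZ1)
  have hW1 : Integrable W P := hW3.integrable (by norm_num)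
  have hη1 : Integrable η P := hη3.integrable (by norm_num)
  have hW2 : Integrable (fun ω => W ω ^ 2) P := (hW3.mono_exponent (by norm_num)).integrable_sq
  have hη2 : Integrable (fun ω => η ω ^ 2) P := (hη3.mono_exponent (by norm_num)).integrable_sq
  have hZW : Integrable (fun ω => Z ω * (W ω : ℂ)) P :=
    hW1.ofReal.bdd_mul hZm.aestronglyMeasurable (Eventually.of_forall hZ1)
  have hZW2 : Integrable (fun ω => Z ω * (W ω : ℂ) ^ 2) P := by
    have := hW2.ofReal (𝕜 := ℂ)
    push_cast at this
    exact this.bdd_mul hZm.aestronglyMeasurable (Eventually.of_forall hZ1)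
  have hcW : Measurable[F] fun ω => (W ω : ℂ) := Complex.measurable_ofReal.comp hW
  have i1 : IndepFun (fun ω => Z ω * (W ω : ℂ)) (fun ω => (η ω : ℂ)) P :=
    indepFun_of_indep hind (Measurable.mul hZ hcW) (Complex.measurable_ofReal.comp hηc)
  have i2 : IndepFun (fun ω => Z ω * (W ω : ℂ) ^ 2) (fun ω => ((η ω ^ 2 : ℝ) : ℂ)) P :=
    indepFun_of_indep hind (Measurable.mul hZ (Measurable.pow_const hcW 2))
      (Complex.measurable_ofReal.comp (Measurable.pow_const hηc 2))
  have i3 : IndepFun (fun ω => |W ω| ^ 3) (fun ω => |η ω| ^ 3) P :=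
    indepFun_of_indep hind ((measurable_norm.comp hW).pow_const 3)
      ((measurable_norm.comp hηc).pow_const 3)
  -- The first-order term vanishes because `η` is centred and independent of `F`; in the
  -- second-order term below, `η ^ 2` splits off as its expectation.
  have e1 : ∫ ω, Z ω * (W ω : ℂ) * (η ω : ℂ) ∂P = 0 := by
    rw [i1.integral_fun_mul_eq_mul_integral hZW.aestronglyMeasurable
      hη1.ofReal.aestronglyMeasurable, integral_complex_ofReal, hη0]
    simp
  have e2 : ∫ ω, Z ω * (W ω : ℂ) ^ 2 * ((η ω ^ 2 : ℝ) : ℂ) ∂P =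
      (∫ ω, Z ω * (W ω : ℂ) ^ 2 ∂P) * ((∫ ω, η ω ^ 2 ∂P : ℝ) : ℂ) := by
    rw [i2.integral_fun_mul_eq_mul_integral hZW2.aestronglyMeasurable
      hη2.ofReal.aestronglyMeasurable, integral_complex_ofReal]
  have hW3i : Integrable (fun ω => |W ω| ^ 3) P :=
    integrable_pow_of_memLp (by norm_num) (by exact_mod_cast hW3)
  have hη3i : Integrable (fun ω => |η ω| ^ 3) P :=
    integrable_pow_of_memLp (by norm_num) (by exact_mod_cast hη3)
  have n1 : Integrable (fun ω => Z ω * (W ω : ℂ) * (η ω : ℂ)) P :=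
    i1.integrable_mul hZW hη1.ofReal
  have n2 : Integrable (fun ω => Z ω * (W ω : ℂ) ^ 2 * ((η ω ^ 2 : ℝ) : ℂ)) P :=
    i2.integrable_mul hZW2 hη2.ofReal
  have n3 : Integrable (fun ω => |W ω| ^ 3 * |η ω| ^ 3) P := i3.integrable_mul hW3i hη3i
  have n4 : Integrable (fun ω => Z ω * exp (I * (θ * (W ω * η ω) : ℝ))) P := by
    refine Integrable.of_bound (by fun_prop) 1 (Eventually.of_forall fun ω => ?_)
    rw [norm_mul, norm_exp_I_mul_ofReal, mul_one]
    exact hZ1 ω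
  have n5 : Integrable (fun ω => (I * θ) * (Z ω * (W ω : ℂ) * (η ω : ℂ))) P := n1.const_mul _
  have n6 : Integrable (fun ω => ((θ ^ 2 / 2 : ℝ) : ℂ) *
    (Z ω * (W ω : ℂ) ^ 2 * ((η ω ^ 2 : ℝ) : ℂ))) P := n2.const_mul _
  have heq : ∫ ω, Z ω * exp (I * (θ * (W ω * η ω) : ℝ)) ∂P - ∫ ω, Z ω ∂P +
        (θ ^ 2 / 2 * ∫ ω, η ω ^ 2 ∂P : ℝ) * ∫ ω, Z ω * (W ω : ℂ) ^ 2 ∂P =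
      ∫ ω, Z ω * (exp (I * (θ * (W ω * η ω) : ℝ)) - (1 + I * (θ * (W ω * η ω) : ℝ) -
        ((θ * (W ω * η ω) : ℝ) : ℂ) ^ 2 / 2)) ∂P := by
    have : ∀ ω, Z ω * (exp (I * (θ * (W ω * η ω) : ℝ)) - (1 + I * (θ * (W ω * η ω) : ℝ) -
        ((θ * (W ω * η ω) : ℝ) : ℂ) ^ 2 / 2)) =
        Z ω * exp (I * (θ * (W ω * η ω) : ℝ)) - Z ω - (I * θ) * (Z ω * (W ω : ℂ) * (η ω : ℂ)) +
        ((θ ^ 2 / 2 : ℝ) : ℂ) * (Z ω * (W ω : ℂ) ^ 2 * ((η ω ^ 2 : ℝ) : ℂ)) := by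
      intro ω
      push_cast
      ring
    simp only [this]
    rw [integral_add (f := fun ω => Z ω * exp (I * (θ * (W ω * η ω) : ℝ)) - Z ω -
      (I * θ) * (Z ω * (W ω : ℂ) * (η ω : ℂ))) ((n4.sub hZi).sub n5) n6,
      integral_sub (f := fun ω => Z ω * exp (I * (θ * (W ω * η ω) : ℝ)) - Z ω) (n4.sub hZi) n5,
      integral_sub n4 hZi, integral_const_mul, integral_const_mul, e1, e2]
    push_cast
    ring
  rw [heq, ← i3.integral_fun_mul_eq_mul_integral hW3i.aestronglyMeasurable
    hη3i.aestronglyMeasurable, ← integral_const_mul]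
  refine norm_integral_le_of_norm_le (n3.const_mul _) (Eventually.of_forall fun ω => ?_)
  rw [norm_mul]
  refine (mul_le_mul (hZ1 ω) (norm_exp_I_mul_sub_taylor_le _) (norm_nonneg _) zero_le_one).trans ?_
  rw [abs_mul, abs_mul]
  exact le_of_eq (by ring)

end OneStep

end ARCHTest

namespace ARCHTest

open scoped Topology

section CentralLimit

open Complex

variable {Ω : Type*} [mΩ : MeasurableSpace Ω] {P : Measure Ω} {m : ℕ} {ε : ℤ → Ω → ℝ}

/-- A linear combination of the `m` squared innovations preceding time `t`. -/
def quadLag (ε : ℤ → Ω → ℝ) (c : Fin m → ℝ) (t : ℤ) (ω : Ω) : ℝ :=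
  ∑ j : Fin m, c j * ε (t - ((j : ℕ) + 1 : ℤ)) ω ^ 2

/-- The sum of the martingale differences `quadLag ε c t * (ε t ^ 2 - 1)`, `1 ≤ t ≤ k`. -/
def quadSum (ε : ℤ → Ω → ℝ) (c : Fin m → ℝ) (k : ℕ) (ω : Ω) : ℝ :=
  ∑ i ∈ Finset.range k, quadLag ε c ((i : ℤ) + 1) ω * (ε ((i : ℤ) + 1) ω ^ 2 - 1)

omit mΩ in
theorem measurable_quadLag_sigmaOf (ε : ℤ → Ω → ℝ) (c : Fin m → ℝ) (t : ℤ) :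
    Measurable[sigmaOf ε (Set.Ico (t - m) t)] (quadLag ε c t) := by
  refine Finset.measurable_sum _ fun j _ => ?_
  refine Measurable.const_mul (Measurable.pow_const (measurable_sigmaOf ε ?_) 2) _
  have := j.2
  constructor <;> omega

omit mΩ in
theorem measurable_quadSum_sigmaOf (ε : ℤ → Ω → ℝ) (c : Fin m → ℝ) (k : ℕ) :
    Measurable[sigmaOf ε (Set.Iic (k : ℤ))] (quadSum ε c k) := by
  refine Finset.measurable_sum _ fun i hi => ?_
  have hi' := Finset.mem_range.1 hi
  refine Measurable.mul ?_ (Measurable.sub_const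
    (Measurable.pow_const (measurable_sigmaOf ε ?_) 2) _)
  · refine (measurable_quadLag_sigmaOf ε c _).mono (sigmaOf_mono ε fun l hl => ?_) le_rfl
    have := hl.2
    simp only [Set.mem_Iic]
    omega
  · simp only [Set.mem_Iic]
    omega

theorem IsInnovation.measurable_quadLag (hε : IsInnovation P ε) (c : Fin m → ℝ) (t : ℤ) :
    Measurable (quadLag ε c t) :=
  (measurable_quadLag_sigmaOf ε c t).mono (sigmaOf_le hε.measurable _) le_rfl

theorem IsInnovation.measurable_quadSum (hε : IsInnovation P ε) (c : Fin m → ℝ) (k : ℕ) :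
    Measurable (quadSum ε c k) :=
  (measurable_quadSum_sigmaOf ε c k).mono (sigmaOf_le hε.measurable _) le_rfl

theorem IsInnovation.identDistrib_quadLag (hε : IsInnovation P ε) (c : Fin m → ℝ) (t : ℤ) :
    IdentDistrib (quadLag ε c t) (quadLag ε c 0) P P := by
  have hind : ∀ s : ℤ, iIndepFun (fun j : Fin m => ε (s - ((j : ℕ) + 1 : ℤ))) P := fun s =>
    hε.indep.precomp (g := fun j : Fin m => s - ((j : ℕ) + 1 : ℤ)) fun i j hij => by
      simp only at hij
      exact Fin.ext (by omega)
  have h := IdentDistrib.pi (fun j : Fin m => (hε.identDistrib (t - ((j : ℕ) + 1 : ℤ))).trans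
    (hε.identDistrib (0 - ((j : ℕ) + 1 : ℤ))).symm) (hind t) (hind 0)
  exact h.comp (u := fun y : Fin m → ℝ => ∑ j, c j * y j ^ 2) (by fun_prop)

theorem IsInnovation.indep_quadLag (hε : IsInnovation P ε) (k : ℕ) :
    Indep (sigmaOf ε (Set.Iic (k : ℤ)))
      (MeasurableSpace.comap (fun ω => ε ((k : ℤ) + 1) ω ^ 2 - 1) inferInstance) P := by
  refine indep_of_indep_of_le_right (indep_sigmaOf hε.measurable hε.indep
    (T := {(k : ℤ) + 1}) (by simp)) (Measurable.comap_le ?_)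
  have h : Measurable[sigmaOf ε {(k : ℤ) + 1}] (ε ((k : ℤ) + 1)) :=
    measurable_sigmaOf ε (Set.mem_singleton _)
  exact Measurable.sub_const (Measurable.pow_const h 2) 1

variable [IsProbabilityMeasure P]

theorem IsInnovation.memLp_quadLag (hε : IsInnovation P ε) (c : Fin m → ℝ) (t : ℤ) :
    MemLp (quadLag ε c t) 4 P := by
  have h : ∀ j ∈ (Finset.univ : Finset (Fin m)),
      MemLp (fun ω => c j * ε (t - ((j : ℕ) + 1 : ℤ)) ω ^ 2) 4 P := fun j _ =>
    (hε.memLp_sq (t - ((j : ℕ) + 1 : ℤ))).const_mul (c j)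
  exact memLp_finsetSum _ h

theorem IsInnovation.integral_sq_quadLag_mul (hε : IsInnovation P ε) (c : Fin m → ℝ) (k : ℕ) :
    MemLp (fun ω => quadLag ε c ((k : ℤ) + 1) ω * (ε ((k : ℤ) + 1) ω ^ 2 - 1)) 2 P ∧
    ∫ ω, (quadLag ε c ((k : ℤ) + 1) ω * (ε ((k : ℤ) + 1) ω ^ 2 - 1)) ^ 2 ∂P =
      (∫ ω, quadLag ε c 0 ω ^ 2 ∂P) * variance (fun ω => ε 0 ω ^ 2) P := by
  have hη : Measurable (fun ω => ε ((k : ℤ) + 1) ω ^ 2 - 1) := by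
    have := hε.measurable ((k : ℤ) + 1); fun_prop
  have hi : IndepFun (quadLag ε c ((k : ℤ) + 1)) (fun ω => ε ((k : ℤ) + 1) ω ^ 2 - 1) P := by
    refine indepFun_of_indep (hε.indep_quadLag k) ?_ (comap_measurable _)
    refine (measurable_quadLag_sigmaOf ε c _).mono (sigmaOf_mono ε fun l hl => ?_) le_rfl
    have := hl.2
    simp only [Set.mem_Iic]
    omega
  have h := integrable_sq_mul_of_indep hi (hε.measurable_quadLag c _) hη
    ((hε.memLp_quadLag c _).mono_exponent (by norm_num))
    ((hε.memLp_sq_sub_one _).mono_exponent (by norm_num))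
  refine ⟨h.1, ?_⟩
  rw [h.2, hε.integral_sq_sub_one_sq]
  congr 1
  exact ((hε.identDistrib_quadLag c _).comp (u := fun x : ℝ => x ^ 2) (by fun_prop)).integral_eq

/-- The characteristic function of `quadSum ε c k`. -/
noncomputable def charQuadSum (P : Measure Ω) (ε : ℤ → Ω → ℝ) (c : Fin m → ℝ) (θ : ℝ) (k : ℕ) : ℂ :=
  ∫ ω, exp (I * (θ * quadSum ε c k ω : ℝ)) ∂P

/-- The factor `quadLag` at time `k + 1` involves only the innovations at times `k - m + 1, …, k`,
so it is independent of `quadSum` at `k - m`. Replacing `S` by this earlier sum `S'` costs at most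
`|θ| |S - S'|`, and `S - S'` has at most `m` terms, so its second moment is bounded uniformly in
`k`. -/
theorem IsInnovation.norm_integral_exp_mul_sq_sub_le (hε : IsInnovation P ε) (c : Fin m → ℝ) :
    ∃ C : ℝ, 0 ≤ C ∧ ∀ (θ : ℝ) (k : ℕ),
      ‖∫ ω, exp (I * (θ * quadSum ε c k ω : ℝ)) * (quadLag ε c ((k : ℤ) + 1) ω : ℂ) ^ 2 ∂P -
        (∫ ω, quadLag ε c 0 ω ^ 2 ∂P : ℝ) * charQuadSum P ε c θ k‖ ≤ C * |θ| := by
  set w : ℝ := ∫ ω, quadLag ε c 0 ω ^ 2 ∂P with hw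
  set v : ℝ := variance (fun ω => ε 0 ω ^ 2) P
  have hW4 : ∀ t, Integrable (fun ω => (quadLag ε c t ω ^ 2) ^ 2) P := fun t => by
    have := integrable_pow_of_memLp (k := 4) (by norm_num) (by exact_mod_cast hε.memLp_quadLag c t)
    refine this.congr (Eventually.of_forall fun ω => ?_)
    simp only
    rw [← pow_mul, Even.pow_abs (by decide)]
  have hW2m : ∀ t, MemLp (fun ω => quadLag ε c t ω ^ 2) 2 P := fun t =>
    (memLp_two_iff_integrable_sq
      ((hε.measurable_quadLag c t).pow_const 2).aestronglyMeasurable).2 (hW4 t)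
  have hV2 : ∀ t, MemLp (fun ω => quadLag ε c t ω ^ 2 - w) 2 P := fun t =>
    (hW2m t).sub (memLp_const w)
  have hV0 : ∀ t, ∫ ω, (quadLag ε c t ω ^ 2 - w) ∂P = 0 := fun t => by
    rw [integral_sub ((hW2m t).integrable (by norm_num)) (integrable_const _)]
    have : ∫ ω, quadLag ε c t ω ^ 2 ∂P = w :=
      ((hε.identDistrib_quadLag c t).comp (u := fun x : ℝ => x ^ 2) (by fun_prop)).integral_eq
    rw [this]
    simp
  set B : ℝ := ∫ ω, (quadLag ε c 0 ω ^ 2 - w) ^ 2 ∂P with hB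
  have hVB : ∀ t, ∫ ω, (quadLag ε c t ω ^ 2 - w) ^ 2 ∂P = B := fun t =>
    ((hε.identDistrib_quadLag c t).comp (u := fun x : ℝ => (x ^ 2 - w) ^ 2)
      (by fun_prop)).integral_eq
  have hB0 : 0 ≤ B := integral_nonneg fun ω => sq_nonneg _
  have hw0 : 0 ≤ w := integral_nonneg fun ω => sq_nonneg _
  have hv0 : 0 ≤ v := variance_nonneg _ _
  -- One factor `m` comes from Cauchy–Schwarz, the other counts the increments in `S - S'`, each of
  -- variance `w * v`; `B` is the variance of `quadLag ^ 2`.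
  refine ⟨m * (m * (w * v)) + B, by positivity, fun θ k => ?_⟩
  set S := quadSum ε c k
  set S' := quadSum ε c (k - m)
  set V : Ω → ℝ := fun ω => quadLag ε c ((k : ℤ) + 1) ω ^ 2 - w with hV
  have hSm : Measurable S := hε.measurable_quadSum c k
  have hSm' : Measurable S' := hε.measurable_quadSum c _
  have hVi : Integrable V P := (hV2 _).integrable (by norm_num)
  set D : ℕ → Ω → ℝ := fun i ω => quadLag ε c ((i : ℤ) + 1) ω * (ε ((i : ℤ) + 1) ω ^ 2 - 1)
  have hdiff : ∀ ω, S ω - S' ω = ∑ i ∈ Finset.Ico (k - m) k, D i ω := fun ω => by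
    rw [Finset.sum_Ico_eq_sub _ (Nat.sub_le k m)]
    rfl
  have hcard : ((Finset.Ico (k - m) k).card : ℝ) ≤ m := by
    rw [Nat.card_Ico]
    exact_mod_cast (by omega : k - (k - m) ≤ m)
  have hDsum : Integrable (fun ω => ∑ i ∈ Finset.Ico (k - m) k, D i ω ^ 2) P :=
    integrable_finsetSum _ fun i _ => (hε.integral_sq_quadLag_mul c i).1.integrable_sq
  have hdsq : ∀ ω, (S ω - S' ω) ^ 2 ≤ m * ∑ i ∈ Finset.Ico (k - m) k, D i ω ^ 2 := fun ω => by
    rw [hdiff]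
    refine sq_sum_le_card_mul_sum_sq.trans ?_
    gcongr
  have hdom : Integrable (fun ω => m * ∑ i ∈ Finset.Ico (k - m) k, D i ω ^ 2 + V ω ^ 2) P :=
    (hDsum.const_mul _).add (hV2 _).integrable_sq
  have hdomI : ∫ ω, (m * ∑ i ∈ Finset.Ico (k - m) k, D i ω ^ 2 + V ω ^ 2) ∂P ≤
      m * (m * (w * v)) + B := by
    rw [integral_add (hDsum.const_mul _) (hV2 _).integrable_sq, integral_const_mul,
      integral_finsetSum _ fun i _ => (hε.integral_sq_quadLag_mul c i).1.integrable_sq, hVB]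
    gcongr
    refine (Finset.sum_le_card_nsmul _ _ (w * v) fun i _ =>
      (hε.integral_sq_quadLag_mul c i).2.le).trans ?_
    rw [nsmul_eq_mul]
    gcongr
  have hexp : ∀ {T : Ω → ℝ}, Measurable T → Measurable fun ω => exp (I * (θ * T ω : ℝ)) :=
    fun hT => by fun_prop
  have hbd : ∀ {T : Ω → ℝ}, Measurable T → ∀ {U : Ω → ℝ}, Integrable U P →
      Integrable (fun ω => exp (I * (θ * T ω : ℝ)) * (U ω : ℂ)) P := by
    intro T hT U hU
    exact (hU.ofReal (𝕜 := ℂ)).bdd_mul (c := 1) (hexp hT).aestronglyMeasurable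
      (Eventually.of_forall fun ω => (norm_exp_I_mul_ofReal _).le)
  have hzero : ∫ ω, exp (I * (θ * S' ω : ℝ)) * (V ω : ℂ) ∂P = 0 := by
    have hi : IndepFun (fun ω => exp (I * (θ * S' ω : ℝ))) (fun ω => (V ω : ℂ)) P := by
      have hVm : Measurable[sigmaOf ε (Set.Ioi ((k : ℤ) - m))] fun ω => (V ω : ℂ) := by
        refine Complex.measurable_ofReal.comp (Measurable.sub_const (Measurable.pow_const
          ((measurable_quadLag_sigmaOf ε c _).mono (sigmaOf_mono ε fun l hl => ?_) le_rfl) 2) _)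
        have := hl.1
        simp only [Set.mem_Ioi]
        omega
      have hSm : Measurable[sigmaOf ε (Set.Iic ((k : ℤ) - m))] S' := by
        -- For `k < m` the truncated subtraction makes `S'` an empty sum, which is constant and
        -- hence measurable for any σ-algebra.
        rcases le_or_gt m k with h | h
        · have := measurable_quadSum_sigmaOf ε c (k - m)
          rwa [Nat.cast_sub h] at this
        · have : S' = fun _ => 0 := by
            ext ω
            simp [S', quadSum, Nat.sub_eq_zero_of_le h.le]
          rw [this]
          exact measurable_const
      refine indepFun_of_indep (indep_sigmaOf hε.measurable hε.indep
        (S := Set.Iic ((k : ℤ) - m)) (T := Set.Ioi ((k : ℤ) - m)) ?_) ?_ hVm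
      · exact Set.disjoint_left.2 fun x (hx : x ≤ (k : ℤ) - m)
        (hx' : (k : ℤ) - m < x) => not_lt.2 hx hx'
      · exact Complex.measurable_exp.comp (Measurable.const_mul
          (Complex.measurable_ofReal.comp (Measurable.const_mul hSm θ)) I)
    rw [hi.integral_fun_mul_eq_mul_integral (hexp hSm').aestronglyMeasurable
      hVi.ofReal.aestronglyMeasurable, integral_complex_ofReal, hV0]
    simp
  have heq : ∫ ω, exp (I * (θ * S ω : ℝ)) * (quadLag ε c ((k : ℤ) + 1) ω : ℂ) ^ 2 ∂P -
        (w : ℂ) * charQuadSum P ε c θ k =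
      ∫ ω, (exp (I * (θ * S ω : ℝ)) - exp (I * (θ * S' ω : ℝ))) * (V ω : ℂ) ∂P := by
    have h1 := hbd hSm hVi
    have h2 := hbd hSm' hVi
    have h3 : Integrable (fun ω => exp (I * (θ * S ω : ℝ)) *
      (quadLag ε c ((k : ℤ) + 1) ω : ℂ) ^ 2) P := by
      have := hbd hSm ((hW2m ((k : ℤ) + 1)).integrable (by norm_num))
      push_cast at this ⊢
      exact this
    have h4 : Integrable (fun ω => exp (I * (θ * S ω : ℝ))) P := by
      have := hbd hSm (integrable_const (1 : ℝ))
      simpa using this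
    simp only [sub_mul]
    rw [integral_sub h1 h2, hzero, sub_zero, charQuadSum, ← integral_const_mul,
      ← integral_sub h3 (h4.const_mul _)]
    congr 1
    ext ω
    simp only [hV]
    push_cast
    ring
  rw [heq]
  have hb := norm_integral_le_of_norm_le (μ := P) (hdom.const_mul |θ|)
    (f := fun ω => (exp (I * (θ * S ω : ℝ)) - exp (I * (θ * S' ω : ℝ))) * (V ω : ℂ))
    (Eventually.of_forall fun ω => ?_)
  · refine hb.trans ?_
    rw [integral_const_mul, mul_comm]
    gcongr
  · rw [norm_mul]
    have h1 : ‖exp (I * (θ * S ω : ℝ)) - exp (I * (θ * S' ω : ℝ))‖ ≤ |θ| * |S ω - S' ω| := by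
      have : exp (I * (θ * S ω : ℝ)) - exp (I * (θ * S' ω : ℝ)) =
          exp (I * (θ * S' ω : ℝ)) * (exp (I * (θ * (S ω - S' ω) : ℝ)) - 1) := by
        rw [mul_sub, ← Complex.exp_add, mul_one]
        congr 2
        push_cast
        ring
      rw [this, norm_mul, norm_exp_I_mul_ofReal, one_mul]
      refine Real.norm_exp_I_mul_ofReal_sub_one_le.trans ?_
      rw [Real.norm_eq_abs, abs_mul]
    have h2 : |S ω - S' ω| * |V ω| ≤ m * ∑ i ∈ Finset.Ico (k - m) k, D i ω ^ 2 + V ω ^ 2 := by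
      have := hdsq ω
      nlinarith [sq_nonneg (|S ω - S' ω| - |V ω|), sq_abs (S ω - S' ω), sq_abs (V ω),
        abs_nonneg (S ω - S' ω), abs_nonneg (V ω)]
    calc _ ≤ |θ| * |S ω - S' ω| * |V ω| := by
          refine mul_le_mul h1 ?_ (norm_nonneg _) (by positivity)
          simp
      _ = |θ| * (|S ω - S' ω| * |V ω|) := by ring
      _ ≤ _ := by gcongr

/-- The one-step expansion leaves the mean of `exp (iθS) W²` multiplied by `θ²v/2`, with error
`O(|θ|³)`. The previous lemma replaces `W²` by its mean at the price of one more factor `|θ|`,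
uniformly in `k`. -/
theorem IsInnovation.norm_charQuadSum_succ_sub_le (hε : IsInnovation P ε) (c : Fin m → ℝ) :
    ∃ C : ℝ, 0 ≤ C ∧ ∀ (θ : ℝ) (k : ℕ),
      ‖charQuadSum P ε c θ (k + 1) - (1 - θ ^ 2 / 2 * (variance (fun ω => ε 0 ω ^ 2) P *
        ∫ ω, quadLag ε c 0 ω ^ 2 ∂P) : ℝ) * charQuadSum P ε c θ k‖ ≤ C * |θ| ^ 3 := by
  obtain ⟨C, hC0, hC⟩ := hε.norm_integral_exp_mul_sq_sub_le c
  set w : ℝ := ∫ ω, quadLag ε c 0 ω ^ 2 ∂P with hw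
  set v : ℝ := variance (fun ω => ε 0 ω ^ 2) P
  have hv0 : 0 ≤ v := variance_nonneg _ _
  set m₃ : ℝ := (∫ ω, |quadLag ε c 0 ω| ^ 3 ∂P) * ∫ ω, |ε 0 ω ^ 2 - 1| ^ 3 ∂P
  have hm0 : 0 ≤ m₃ := mul_nonneg (integral_nonneg fun ω => by positivity)
    (integral_nonneg fun ω => by positivity)
  refine ⟨4 * m₃ + v / 2 * C, by positivity, fun θ k => ?_⟩
  have hη : Measurable (fun ω => ε ((k : ℤ) + 1) ω ^ 2 - 1) := by
    have := hε.measurable ((k : ℤ) + 1); fun_prop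
  have hWF : Measurable[sigmaOf ε (Set.Iic (k : ℤ))] (quadLag ε c ((k : ℤ) + 1)) := by
    refine (measurable_quadLag_sigmaOf ε c _).mono (sigmaOf_mono ε fun l hl => ?_) le_rfl
    have := hl.2
    simp only [Set.mem_Iic]
    omega
  have h1 := norm_integral_mul_exp_sub_le (P := P) (sigmaOf_le hε.measurable (Set.Iic (k : ℤ)))
    (Z := fun ω => exp (I * (θ * quadSum ε c k ω : ℝ)))
    (Complex.measurable_exp.comp (Measurable.const_mul
      (Complex.measurable_ofReal.comp (Measurable.const_mul
        (measurable_quadSum_sigmaOf ε c k) θ)) I))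
    (fun ω => (norm_exp_I_mul_ofReal _).le) hWF hη (hε.indep_quadLag k)
    ((hε.memLp_quadLag c _).mono_exponent (by norm_num))
    ((hε.memLp_sq_sub_one _).mono_exponent (by norm_num)) (hε.integral_sq_sub_one _) θ
  have e1 : ∫ ω, |quadLag ε c ((k : ℤ) + 1) ω| ^ 3 ∂P = ∫ ω, |quadLag ε c 0 ω| ^ 3 ∂P :=
    ((hε.identDistrib_quadLag c _).comp (u := fun x : ℝ => |x| ^ 3) (by fun_prop)).integral_eq
  have e2 : ∫ ω, |ε ((k : ℤ) + 1) ω ^ 2 - 1| ^ 3 ∂P = ∫ ω, |ε 0 ω ^ 2 - 1| ^ 3 ∂P :=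
    hε.integral_comp _ (f := fun x : ℝ => |x ^ 2 - 1| ^ 3) (by fun_prop)
  have e3 : ∫ ω, exp (I * (θ * quadSum ε c k ω : ℝ)) *
      exp (I * (θ * (quadLag ε c ((k : ℤ) + 1) ω * (ε ((k : ℤ) + 1) ω ^ 2 - 1)) : ℝ)) ∂P =
      charQuadSum P ε c θ (k + 1) := by
    rw [charQuadSum]
    congr 1
    ext ω
    have : quadSum ε c (k + 1) ω = quadSum ε c k ω +
        quadLag ε c ((k : ℤ) + 1) ω * (ε ((k : ℤ) + 1) ω ^ 2 - 1) := Finset.sum_range_succ _ _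
    rw [← Complex.exp_add, this]
    congr 1
    push_cast
    ring
  rw [e1, e2, e3, hε.integral_sq_sub_one_sq] at h1
  have h2 := hC θ k
  set J : ℂ := ∫ ω, exp (I * (θ * quadSum ε c k ω : ℝ)) * (quadLag ε c ((k : ℤ) + 1) ω : ℂ) ^ 2 ∂P
  have h3 : charQuadSum P ε c θ (k + 1) - (1 - θ ^ 2 / 2 * (v * w) : ℝ) * charQuadSum P ε c θ k =
      (charQuadSum P ε c θ (k + 1) - charQuadSum P ε c θ k + (θ ^ 2 / 2 * v : ℝ) * J) -
      (θ ^ 2 / 2 * v : ℝ) * (J - (w : ℂ) * charQuadSum P ε c θ k) := by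
    push_cast
    ring
  rw [h3]
  refine (norm_sub_le _ _).trans ?_
  rw [norm_mul (((θ ^ 2 / 2 * v : ℝ)) : ℂ), Complex.norm_real, Real.norm_of_nonneg (by positivity)]
  calc _ ≤ 4 * |θ| ^ 3 * m₃ + θ ^ 2 / 2 * v * (C * |θ|) := by
        refine add_le_add h1 ?_
        gcongr
    _ = _ := by rw [← sq_abs θ]; ring

/-- Central limit theorem for `quadSum ε c n`, in terms of characteristic functions. -/
theorem IsInnovation.tendsto_charQuadSum (hε : IsInnovation P ε) (c : Fin m → ℝ) :
    Tendsto (fun n : ℕ => charQuadSum P ε c (1 / √(n : ℝ)) n) atTop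
      (𝓝 (exp (-((variance (fun ω => ε 0 ω ^ 2) P * ∫ ω, quadLag ε c 0 ω ^ 2 ∂P : ℝ) : ℂ) / 2))) :=
        by
  obtain ⟨C, hC0, hC⟩ := hε.norm_charQuadSum_succ_sub_le c
  set v : ℝ := variance (fun ω => ε 0 ω ^ 2) P * ∫ ω, quadLag ε c 0 ω ^ 2 ∂P
  have hv0 : 0 ≤ v := mul_nonneg (variance_nonneg _ _) (integral_nonneg fun ω => sq_nonneg _)
  have hlim : Tendsto (fun n : ℕ => ((1 - (1 / √(n : ℝ)) ^ 2 / 2 * v : ℝ) : ℂ) ^ n) atTop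
      (𝓝 (exp (-(v : ℂ) / 2))) := by
    have h := Complex.tendsto_one_add_div_pow_exp (-(v : ℂ) / 2)
    refine h.congr' ?_
    filter_upwards [eventually_gt_atTop 0] with n hn
    congr 1
    rw [div_pow, Real.sq_sqrt (Nat.cast_nonneg n)]
    push_cast
    ring
  have hsmall : Tendsto (fun n : ℕ => C * (1 / √(n : ℝ))) atTop (𝓝 0) := by
    have : Tendsto (fun n : ℕ => √(n : ℝ)) atTop atTop :=
      Real.tendsto_sqrt_atTop.comp tendsto_natCast_atTop_atTop
    simpa using (tendsto_inv_atTop_zero.comp this).const_mul C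
  have hdiff : Tendsto (fun n : ℕ => charQuadSum P ε c (1 / √(n : ℝ)) n -
      ((1 - (1 / √(n : ℝ)) ^ 2 / 2 * v : ℝ) : ℂ) ^ n) atTop (𝓝 0) := by
    refine squeeze_zero_norm' ?_ hsmall
    -- Once `n ≥ v`, the factor `r` has modulus at most one, so the one-step errors are not
    -- amplified.
    obtain ⟨N, hN⟩ := exists_nat_gt v
    filter_upwards [eventually_ge_atTop (N + 1)] with n hn
    have hn0 : (0 : ℝ) < n := by exact_mod_cast (by omega : 0 < n)
    have hvn : v ≤ n := hN.le.trans (by exact_mod_cast (by omega : N ≤ n))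
    set θ : ℝ := 1 / √(n : ℝ) with hθ
    have hθ0 : 0 < θ := by positivity
    have hθ2 : θ ^ 2 = 1 / n := by rw [hθ, div_pow, Real.sq_sqrt hn0.le, one_pow]
    set r : ℝ := 1 - θ ^ 2 / 2 * v with hr
    have hr1 : |r| ≤ 1 := by
      have h1 : θ ^ 2 * v ≤ 1 := by
        rw [hθ2, one_div, inv_mul_le_iff₀ hn0, mul_one]; exact hvn
      have h2 : 0 ≤ θ ^ 2 * v := by positivity
      rw [abs_le]
      constructor <;> rw [hr] <;> linarith
    -- The errors add up linearly in `k`; at `k = n` and `θ = n^{-1/2}` the total is `C n^{-1/2}`.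
    have key : ∀ k : ℕ, ‖charQuadSum P ε c θ k - (r : ℂ) ^ k‖ ≤ k * (C * |θ| ^ 3) := by
      intro k
      induction k with
      | zero => simp [charQuadSum, quadSum]
      | succ k ih =>
        have h1 : charQuadSum P ε c θ (k + 1) - (r : ℂ) ^ (k + 1) =
            (charQuadSum P ε c θ (k + 1) - (r : ℂ) * charQuadSum P ε c θ k) +
            (r : ℂ) * (charQuadSum P ε c θ k - (r : ℂ) ^ k) := by ring
        rw [h1]
        refine (norm_add_le _ _).trans ?_
        rw [norm_mul, Complex.norm_real, Real.norm_eq_abs]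
        have h2 : |r| * ‖charQuadSum P ε c θ k - (r : ℂ) ^ k‖ ≤ 1 * (k * (C * |θ| ^ 3)) := by
          gcongr
        have h3 := hC θ k
        push_cast
        linarith
    refine (key n).trans (le_of_eq ?_)
    rw [abs_of_pos hθ0, pow_succ, hθ2]
    field_simp
  simpa using hdiff.add hlim

end CentralLimit

end ARCHTest

namespace ARCHTest

open scoped Topology

/-! ### Limit law of the leading term of the score. -/

section LeadingScore

variable {Ω : Type*} [mΩ : MeasurableSpace Ω] {P : Measure Ω} [IsProbabilityMeasure P]
  {ε : ℤ → Ω → ℝ}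

/-- The score at the true parameter, with the ratios of the scales replaced by `1`. -/
noncomputable def leadingScore (ε : ℤ → Ω → ℝ) (m n : ℕ) (ω : Ω) : EuclideanSpace ℝ (Fin m) :=
  WithLp.toLp 2 fun j => 1 / √(n : ℝ) * ∑ i ∈ Finset.range n,
    1 / 2 * ε ((i : ℤ) + 1 - ((j : ℕ) + 1 : ℤ)) ω ^ 2 * (ε ((i : ℤ) + 1) ω ^ 2 - 1)

omit [IsProbabilityMeasure P] in
theorem IsInnovation.measurable_leadingScore (hε : IsInnovation P ε) (m n : ℕ) :
    Measurable (leadingScore ε m n) := by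
  have := hε.measurable
  unfold leadingScore
  fun_prop

open Matrix in
-- Lagged squares have mixed moments `E ε⁴` on the diagonal and, by independence and unit variance,
-- `1` off it. The halves in `c j / 2` are the factors `1/2` of the score and produce the `1/4` of
-- the covariance. Positive semidefiniteness follows from this identity.
theorem IsInnovation.dotProduct_asymptoticCov (hε : IsInnovation P ε) {m : ℕ} (c : Fin m → ℝ) :
    c ⬝ᵥ asymptoticCov P (ε 0) m *ᵥ c = variance (fun ω => ε 0 ω ^ 2) P *
      ∫ ω, quadLag ε (fun j => c j / 2) 0 ω ^ 2 ∂P := by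
  set e : Fin m → Ω → ℝ := fun j ω => ε (0 - ((j : ℕ) + 1 : ℤ)) ω ^ 2 with he
  have hint : ∀ i j, Integrable (fun ω => e i ω * e j ω) P := fun i j =>
    ((hε.memLp_sq _).mono_exponent (by norm_num)).integrable_mul
      (p := 2) (q := 2) ((hε.memLp_sq _).mono_exponent (by norm_num))
  have hE : ∀ i j, ∫ ω, e i ω * e j ω ∂P = if i = j then ∫ ω, ε 0 ω ^ 4 ∂P else 1 := by
    intro i j
    split_ifs with h
    · subst h
      rw [← hε.integral_comp (0 - ((i : ℕ) + 1 : ℤ)) (f := fun x => x ^ 4) (by fun_prop)]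
      congr 1
      ext ω
      simp only [he]
      ring
    · have hne : (0 - ((i : ℕ) + 1 : ℤ)) ≠ 0 - ((j : ℕ) + 1 : ℤ) := fun h' => h (Fin.ext (by omega))
      have hi : IndepFun (e i) (e j) P := (hε.indep.indepFun hne).comp
        (φ := fun x : ℝ => x ^ 2) (ψ := fun x : ℝ => x ^ 2) (by fun_prop) (by fun_prop)
      rw [hi.integral_fun_mul_eq_mul_integral (hε.memLp_sq _).1 (hε.memLp_sq _).1]
      simp only [he]
      rw [hε.integral_sq, hε.integral_sq, one_mul]
  have hsq : ∀ ω, quadLag ε (fun j => c j / 2) 0 ω ^ 2 =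
      ∑ i, ∑ j, (c i / 2 * (c j / 2)) * (e i ω * e j ω) := by
    intro ω
    rw [quadLag, sq, Finset.sum_mul_sum]
    refine Finset.sum_congr rfl fun i _ => Finset.sum_congr rfl fun j _ => ?_
    simp only [he]
    ring
  simp only [hsq]
  rw [integral_finsetSum _ fun i _ => integrable_finsetSum _ fun j _ => (hint i j).const_mul _]
  simp only [dotProduct, mulVec, asymptoticCov, Matrix.smul_apply, Matrix.of_apply, Finset.mul_sum]
  refine Finset.sum_congr rfl fun i _ => ?_
  rw [integral_finsetSum _ fun j _ => (hint i j).const_mul _, Finset.mul_sum]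
  refine Finset.sum_congr rfl fun j _ => ?_
  rw [integral_const_mul, hE, smul_eq_mul]
  ring

open Matrix in
theorem IsInnovation.posSemidef_asymptoticCov (hε : IsInnovation P ε) (m : ℕ) :
    (asymptoticCov P (ε 0) m).PosSemidef := by
  refine PosSemidef.of_dotProduct_mulVec_nonneg ?_ fun c => ?_
  · ext i j
    simp only [asymptoticCov, conjTranspose_apply, Matrix.smul_apply, Matrix.of_apply, star_trivial,
      eq_comm]
  · rw [star_trivial, hε.dotProduct_asymptoticCov]
    exact mul_nonneg (variance_nonneg _ _) (integral_nonneg fun ω => sq_nonneg _)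

open Matrix in
-- Lévy's continuity theorem: the inner product of the leading score with `t` is `n^{-1/2}` times
-- `quadSum` with coefficients `t j / 2`, so its characteristic function is already known to
-- converge.
theorem IsInnovation.tendstoInDistribution_leadingScore (hε : IsInnovation P ε) (m : ℕ) :
    TendstoInDistribution (leadingScore ε m) atTop
      (id : EuclideanSpace ℝ (Fin m) → EuclideanSpace ℝ (Fin m)) (fun _ => P)
      (multivariateGaussian 0 (asymptoticCov P (ε 0) m)) where
  forall_aemeasurable n := (hε.measurable_leadingScore m n).aemeasurable
  tendsto := by
    refine ProbabilityMeasure.tendsto_iff_tendsto_charFun.2 fun t => ?_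
    simp only [ProbabilityMeasure.coe_mk, Measure.map_id]
    rw [charFun_multivariateGaussian (hε.posSemidef_asymptoticCov m),
      hε.dotProduct_asymptoticCov]
    have h := hε.tendsto_charQuadSum (fun j : Fin m => t j / 2)
    have e1 : ∀ v : ℝ, Complex.exp (((inner ℝ t (0 : EuclideanSpace ℝ (Fin m)) : ℝ) : ℂ) *
      Complex.I -
        (v : ℂ) / 2) = Complex.exp (-(v : ℂ) / 2) := by
      intro v
      rw [inner_zero_right]
      congr 1
      push_cast
      ring
    rw [e1]
    refine h.congr fun n => ?_
    rw [charFun_apply, integral_map (hε.measurable_leadingScore m n).aemeasurable (by fun_prop),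
      charQuadSum]
    congr 1
    ext ω
    rw [mul_comm]
    congr 3
    rw [quadSum, PiLp.inner_apply]
    simp only [leadingScore, quadLag, Finset.mul_sum, Finset.sum_mul]
    rw [Finset.sum_comm]
    refine Finset.sum_congr rfl fun j _ => ?_
    simp only [RCLike.inner_apply, conj_trivial, Finset.mul_sum]
    refine Finset.sum_congr rfl fun i _ => ?_
    ring

end LeadingScore

end ARCHTest

namespace ARCHTest

/-! ### Ratios of neighbouring scales. -/

section ScaleRegularity

theorem IsScaleFunction.exists_bounds {g : ℝ → ℝ} (hg : IsScaleFunction g) :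
    ∃ c C : ℝ, 0 < c ∧ 0 < C ∧ ∀ r ∈ Set.Ioc (0 : ℝ) 1, c ≤ g r ∧ g r ≤ C := by
  obtain ⟨c, hc, h1⟩ := hg.bounded_below
  obtain ⟨C, h2⟩ := hg.bounded_above
  refine ⟨c, C, hc, ?_, fun r hr => ⟨h1 r hr, (le_abs_self _).trans (h2 r hr)⟩⟩
  have h : (1 : ℝ) ∈ Set.Ioc (0 : ℝ) 1 := by norm_num
  exact hc.trans_le ((h1 1 h).trans ((le_abs_self _).trans (h2 1 h)))

theorem div_mem_Ioc_of_mem_Icc {n : ℕ} {t : ℤ} (h1 : 1 ≤ t) (h2 : t ≤ n) :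
    (t : ℝ) / n ∈ Set.Ioc (0 : ℝ) 1 := by
  have h1' : (1 : ℝ) ≤ t := by exact_mod_cast h1
  have h2' : (t : ℝ) ≤ n := by exact_mod_cast h2
  have hn : (0 : ℝ) < n := by linarith
  exact ⟨by positivity, (div_le_one hn).2 h2'⟩

open Classical in
-- An interval is left only once. If `i₀` is the smallest such index and `i ≥ i₀ + l` another one,
-- then `(i₀ + 1) / n` lies between the lagged points of `i₀` and `i`, both in `I`, hence in `I`: a
-- contradiction. All such indices therefore lie in a window of length `l`.
theorem card_filter_lag_le {I : Set ℝ} (hI : I.OrdConnected) (n l : ℕ) :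
    ((Finset.range n).filter fun i : ℕ => ((i : ℝ) + 1 - l) / n ∈ I ∧ ((i : ℝ) + 1) / n ∉ I).card
      ≤ l := by
  set B := (Finset.range n).filter
    fun i : ℕ => ((i : ℝ) + 1 - l) / n ∈ I ∧ ((i : ℝ) + 1) / n ∉ I with hB
  rcases B.eq_empty_or_nonempty with h | h
  · simp [h]
  set i₀ := B.min' h
  have hi₀ := (Finset.mem_filter.1 (B.min'_mem h)).2
  have hsub : B ⊆ Finset.Ico i₀ (i₀ + l) := by
    intro i hi
    have h1 := B.min'_le i hi
    rw [Finset.mem_Ico]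
    refine ⟨h1, ?_⟩
    by_contra hcon
    refine hi₀.2 (hI.out hi₀.1 (Finset.mem_filter.1 hi).2.1 ⟨?_, ?_⟩)
    · have : (0 : ℝ) ≤ l := Nat.cast_nonneg l
      gcongr
      linarith
    · have : ((i₀ + l : ℕ) : ℝ) ≤ i := by exact_mod_cast not_lt.1 hcon
      push_cast at this
      gcongr
      linarith
  simpa using Finset.card_le_card hsub

/-- The ratio `h_{t-l}² / h_t²` at `t = i + 1`, or `0` if `t ≤ l`. -/
noncomputable def scaleRatio (g : ℝ → ℝ) (n l i : ℕ) : ℝ :=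
  if l ≤ i then scale g n ((i : ℤ) + 1 - l) ^ 2 / scale g n ((i : ℤ) + 1) ^ 2 else 0

/-- Within a Lipschitz piece each summand is `O(1/n)`; at most `l` indices per piece straddle its
end; the first `l` indices, where the ratio is `0` by convention, contribute `1` each. These are the
three terms of the bound. -/
theorem IsScaleFunction.exists_sum_scaleRatio_le {g : ℝ → ℝ} (hg : IsScaleFunction g) (l : ℕ) :
    ∃ V : ℝ, ∀ n : ℕ, ∑ i ∈ Finset.range n, (scaleRatio g n l i - 1) ^ 2 ≤ V := by
  classical
  obtain ⟨c, C, hc, hC, hcC⟩ := hg.exists_bounds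
  obtain ⟨q, I, hI, -, hU, hL⟩ := hg.piecewise_lipschitz
  choose K hK using hL
  set M : ℝ := 2 * C / c ^ 2 * (C ^ 2 / c ^ 2 + 1) with hM
  have hM0 : 0 ≤ M := by positivity
  set K' : ℝ := ∑ k, (K k : ℝ) with hK'
  have hK'0 : 0 ≤ K' := Finset.sum_nonneg fun k _ => (K k).2
  refine ⟨M * (K' * l) + M * (2 * C) * (q * l) + l, fun n => ?_⟩
  set p : Fin q → ℕ → Prop := fun k i => ((i : ℝ) + 1 - l) / n ∈ I k ∧ ((i : ℝ) + 1) / n ∉ I k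
  have key : ∀ i ∈ Finset.range n, (scaleRatio g n l i - 1) ^ 2 ≤
      M * (K' * l / n) + M * (2 * C) * (∑ k, if p k i then (1 : ℝ) else 0) +
        if i < l then (1 : ℝ) else 0 := by
    intro i hi
    have hin := Finset.mem_range.1 hi
    have hn : (0 : ℝ) < n := by exact_mod_cast (Nat.zero_le i).trans_lt hin
    have hs0 : (0 : ℝ) ≤ ∑ k, if p k i then (1 : ℝ) else 0 :=
      Finset.sum_nonneg fun k _ => by split_ifs <;> norm_num
    by_cases hli : l ≤ i
    swap
    · rw [scaleRatio, if_neg hli, if_pos (not_le.1 hli)]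
      have : 0 ≤ M * (K' * l / n) := by positivity
      have : 0 ≤ M * (2 * C) * (∑ k, if p k i then (1 : ℝ) else 0) := by positivity
      norm_num
      linarith
    rw [scaleRatio, if_pos hli, if_neg (not_lt.2 hli), add_zero, scale, scale]
    have hm1 := div_mem_Ioc_of_mem_Icc (n := n) (t := (i : ℤ) + 1 - l) (by omega) (by omega)
    have hm2 := div_mem_Ioc_of_mem_Icc (n := n) (t := (i : ℤ) + 1) (by omega) (by omega)
    push_cast at hm1 hm2 ⊢
    set r₁ : ℝ := ((i : ℝ) + 1 - l) / n with hr₁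
    set r₂ : ℝ := ((i : ℝ) + 1) / n with hr₂
    obtain ⟨hc1, hC1⟩ := hcC _ hm1
    obtain ⟨hc2, hC2⟩ := hcC _ hm2
    -- The deviation of the ratio is bounded, so only one of its two factors need be small; a bound
    -- linear in the increment of `g` is enough.
    have hsq : (g r₁ ^ 2 / g r₂ ^ 2 - 1) ^ 2 ≤ M * |g r₁ - g r₂| := by
      have h2 : 0 < g r₂ := hc.trans_le hc2
      have h1 : 0 < g r₁ := hc.trans_le hc1
      have e1 : g r₁ ^ 2 / g r₂ ^ 2 - 1 = (g r₁ - g r₂) * (g r₁ + g r₂) / g r₂ ^ 2 := by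
        field_simp
        ring
      have b1 : |g r₁ ^ 2 / g r₂ ^ 2 - 1| ≤ 2 * C / c ^ 2 * |g r₁ - g r₂| := by
        rw [e1, abs_div, abs_mul, abs_of_pos (by positivity : 0 < g r₁ + g r₂),
          abs_of_pos (by positivity : 0 < g r₂ ^ 2)]
        calc |g r₁ - g r₂| * (g r₁ + g r₂) / g r₂ ^ 2 ≤ |g r₁ - g r₂| * (C + C) / c ^ 2 := by gcongr
          _ = _ := by ring
      have b2 : |g r₁ ^ 2 / g r₂ ^ 2 - 1| ≤ C ^ 2 / c ^ 2 + 1 := by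
        have h3 : g r₁ ^ 2 / g r₂ ^ 2 ≤ C ^ 2 / c ^ 2 := by gcongr
        have h4 : 0 ≤ g r₁ ^ 2 / g r₂ ^ 2 := by positivity
        rw [abs_le]
        constructor <;> linarith
      rw [← sq_abs, sq]
      calc _ ≤ 2 * C / c ^ 2 * |g r₁ - g r₂| * (C ^ 2 / c ^ 2 + 1) :=
            mul_le_mul b1 b2 (abs_nonneg _) (by positivity)
        _ = _ := by rw [hM]; ring
    refine hsq.trans ?_
    obtain ⟨k, hk⟩ : ∃ k, r₁ ∈ I k := by
      rw [← hU] at hm1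
      exact Set.mem_iUnion.1 hm1
    by_cases hk2 : r₂ ∈ I k
    · have hd := (hK k).dist_le_mul _ hk _ hk2
      rw [Real.dist_eq, Real.dist_eq] at hd
      have hr : |r₁ - r₂| = l / n := by
        rw [hr₁, hr₂, ← sub_div, abs_div, abs_of_pos hn]
        congr 1
        rw [show (i : ℝ) + 1 - l - (i + 1) = -(l : ℝ) by ring, abs_neg, Nat.abs_cast]
      rw [hr] at hd
      have hKk : (K k : ℝ) ≤ K' :=
        Finset.single_le_sum (f := fun k => (K k : ℝ)) (fun k _ => (K k).2) (Finset.mem_univ k)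
      have h5 : |g r₁ - g r₂| ≤ K' * l / n := by
        refine hd.trans ?_
        rw [mul_div_assoc]
        gcongr
      have h6 : 0 ≤ M * (2 * C) * (∑ k, if p k i then (1 : ℝ) else 0) := by positivity
      have := mul_le_mul_of_nonneg_left h5 hM0
      linarith
    · have h5 : (1 : ℝ) ≤ ∑ k, if p k i then (1 : ℝ) else 0 := by
        have h6 : (if p k i then (1 : ℝ) else 0) = 1 := if_pos ⟨hk, hk2⟩
        refine h6.symm.le.trans ?_
        exact Finset.single_le_sum (f := fun k => if p k i then (1 : ℝ) else 0)
          (fun k _ => by split_ifs <;> norm_num) (Finset.mem_univ k)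
      have h7 : |g r₁ - g r₂| ≤ 2 * C := by
        rw [abs_le]
        constructor <;> linarith
      have h8 : M * |g r₁ - g r₂| ≤ M * (2 * C) * 1 := by
        rw [mul_one]; gcongr
      have h9 : M * (2 * C) * 1 ≤ M * (2 * C) * ∑ k, if p k i then (1 : ℝ) else 0 := by gcongr
      have : 0 ≤ M * (K' * l / n) := by positivity
      linarith
  refine (Finset.sum_le_sum key).trans ?_
  rw [Finset.sum_add_distrib, Finset.sum_add_distrib, Finset.sum_const, ← Finset.mul_sum,
    Finset.sum_comm, Finset.card_range, nsmul_eq_mul]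
  have a1 : (n : ℝ) * (M * (K' * l / n)) ≤ M * (K' * l) := by
    rcases Nat.eq_zero_or_pos n with h | h
    · subst h
      simp only [CharP.cast_eq_zero, zero_mul]
      positivity
    · have : (0 : ℝ) < n := by exact_mod_cast h
      exact le_of_eq (by field_simp)
  have a2 : ∑ k, ∑ i ∈ Finset.range n, (if p k i then (1 : ℝ) else 0) ≤ q * l := by
    calc _ ≤ ∑ _k : Fin q, (l : ℝ) := by
          refine Finset.sum_le_sum fun k _ => ?_
          rw [Finset.sum_boole]
          refine Nat.cast_le.2 ?_
          convert! card_filter_lag_le (hI k) n l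
      _ = _ := by simp
  have a3 : ∑ i ∈ Finset.range n, (if i < l then (1 : ℝ) else 0) ≤ l := by
    rw [Finset.sum_boole]
    have : (Finset.range n).filter (fun i => i < l) ⊆ Finset.range l := fun i hi =>
      Finset.mem_range.2 (Finset.mem_filter.1 hi).2
    have := Finset.card_le_card this
    rw [Finset.card_range] at this
    exact_mod_cast this
  have a4 := mul_le_mul_of_nonneg_left a2 (by positivity : 0 ≤ M * (2 * C))
  linarith

end ScaleRegularity

end ARCHTest

namespace ARCHTest

open scoped Topology

/-! ### Filtrations, eighth moments and the state process. -/

section Filtration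

variable {Ω : Type*} {m₁ m₂ m₃ : MeasurableSpace Ω} [mΩ : MeasurableSpace Ω] {P : Measure Ω}
  [IsProbabilityMeasure P]

/-- Intersections of sets from `m₁` and `m₂` form a π-system generating the join. The lemma serves
to adjoin the initial state to the past innovations. -/
theorem indep_sup_left (h₁ : m₁ ≤ mΩ) (h₂ : m₂ ≤ mΩ) (h₃ : m₃ ≤ mΩ) (h : Indep m₁ (m₂ ⊔ m₃) P)
    (h' : Indep m₂ m₃ P) : Indep (m₁ ⊔ m₂) m₃ P := by
  set π : Set (Set Ω) := Set.image2 (· ∩ ·) {s | MeasurableSet[m₁] s} {s | MeasurableSet[m₂] s}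
  have hgen : m₁ ⊔ m₂ = MeasurableSpace.generateFrom π := by
    refine le_antisymm (sup_le (fun s hs => ?_) fun s hs => ?_)
      (MeasurableSpace.generateFrom_le ?_)
    · exact MeasurableSpace.measurableSet_generateFrom
        ⟨s, hs, Set.univ, MeasurableSet.univ, Set.inter_univ s⟩
    · exact MeasurableSpace.measurableSet_generateFrom
        ⟨Set.univ, MeasurableSet.univ, s, hs, Set.univ_inter s⟩
    · rintro _ ⟨s, hs, t, ht, rfl⟩
      have hs' : MeasurableSet[m₁ ⊔ m₂] s := (le_sup_left : m₁ ≤ m₁ ⊔ m₂) s hs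
      have ht' : MeasurableSet[m₁ ⊔ m₂] t := (le_sup_right : m₂ ≤ m₁ ⊔ m₂) t ht
      exact hs'.inter ht'
  have hpi : IsPiSystem π := by
    rintro _ ⟨s, hs, t, ht, rfl⟩ _ ⟨s', hs', t', ht', rfl⟩ -
    exact ⟨s ∩ s', MeasurableSet.inter hs hs', t ∩ t', MeasurableSet.inter ht ht',
      by simp only [Set.inter_inter_inter_comm]⟩
  refine IndepSets.indep (p1 := π) (p2 := {s | MeasurableSet[m₃] s}) (sup_le h₁ h₂) h₃ hpi
    (@MeasurableSpace.isPiSystem_measurableSet _ m₃) hgen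
    (@MeasurableSpace.generateFrom_measurableSet _ m₃).symm ?_
  rw [IndepSets_iff]
  rintro _ r ⟨s, hs, t, ht, rfl⟩ hr
  have ht' : MeasurableSet[m₂ ⊔ m₃] t := (le_sup_left : m₂ ≤ m₂ ⊔ m₃) t ht
  have hr' : MeasurableSet[m₂ ⊔ m₃] r := (le_sup_right : m₃ ≤ m₂ ⊔ m₃) r hr
  rw [Indep_iff] at h h'
  rw [Set.inter_assoc, h s (t ∩ r) hs (ht'.inter hr'), h' t r ht hr, h s t hs ht', mul_assoc]

end Filtration

section EighthMoments

variable {Ω : Type*} [mΩ : MeasurableSpace Ω] {P : Measure Ω} {ι κ : Type*}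

/-- A family of nonnegative random variables with uniformly bounded eighth moments. -/
def BddEighthMoment (P : Measure Ω) (Y : ι → Ω → ℝ) : Prop :=
  ∃ K : ℝ, ∀ i, Measurable (Y i) ∧ (∀ ω, 0 ≤ Y i ω) ∧ Integrable (fun ω => Y i ω ^ 8) P ∧
    ∫ ω, Y i ω ^ 8 ∂P ≤ K

theorem BddEighthMoment.comp {Y : ι → Ω → ℝ} (h : BddEighthMoment P Y) (f : κ → ι) :
    BddEighthMoment P fun i => Y (f i) := by
  obtain ⟨K, hK⟩ := h
  exact ⟨K, fun i => hK (f i)⟩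

theorem BddEighthMoment.add {Y Y' : ι → Ω → ℝ} (h : BddEighthMoment P Y)
    (h' : BddEighthMoment P Y') : BddEighthMoment P fun i ω => Y i ω + Y' i ω := by
  obtain ⟨K, hK⟩ := h
  obtain ⟨K', hK'⟩ := h'
  refine ⟨2 ^ 7 * (K + K'), fun i => ?_⟩
  obtain ⟨h1, h2, h3, h4⟩ := hK i
  obtain ⟨h1', h2', h3', h4'⟩ := hK' i
  have hle : ∀ ω, (Y i ω + Y' i ω) ^ 8 ≤ 2 ^ 7 * (Y i ω ^ 8 + Y' i ω ^ 8) := fun ω =>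
    add_pow_le (h2 ω) (h2' ω) 8
  have hint : Integrable (fun ω => 2 ^ 7 * (Y i ω ^ 8 + Y' i ω ^ 8)) P := (h3.add h3').const_mul _
  have hi : Integrable (fun ω => (Y i ω + Y' i ω) ^ 8) P :=
    hint.mono' (by fun_prop) (Eventually.of_forall fun ω => by
      rw [Real.norm_of_nonneg (by have := h2 ω; have := h2' ω; positivity)]
      exact hle ω)
  refine ⟨h1.add h1', fun ω => add_nonneg (h2 ω) (h2' ω), hi, (integral_mono hi hint hle).trans ?_⟩
  rw [integral_const_mul, integral_add h3 h3']
  gcongr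

theorem BddEighthMoment.const [IsProbabilityMeasure P] {c : ℝ} (hc : 0 ≤ c) :
    BddEighthMoment P fun (_ : ι) (_ : Ω) => c :=
  ⟨c ^ 8, fun _ => ⟨measurable_const, fun _ => hc, integrable_const _, by simp⟩⟩

/-- The exponentially damped sum `∑ ρ^{k-1-i} |ε_{i+1}|` over `i < k`. -/
def damped (ρ : ℝ) (ε : ℤ → Ω → ℝ) : ℕ → Ω → ℝ
  | 0 => fun _ => 0
  | k + 1 => fun ω => ρ * damped ρ ε k ω + |ε ((k : ℤ) + 1) ω|

variable {ε : ℤ → Ω → ℝ} [IsProbabilityMeasure P]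

theorem IsInnovation.bddEighthMoment_abs (hε : IsInnovation P ε) :
    BddEighthMoment P fun (t : ℤ) ω => |ε t ω| :=
  ⟨∫ ω, |ε 0 ω| ^ 8 ∂P, fun t => ⟨(hε.measurable t).abs, fun _ => abs_nonneg _,
    hε.integrable_pow_eight t,
    (hε.integral_comp t (f := fun x => |x| ^ 8) (by fun_prop)).le⟩⟩

/-- The next damped sum is the convex combination, with weights `ρ` and `1 - ρ`, of the current one
and `|ε| / (1 - ρ)`. By convexity of `x⁸` the bound `K`, the eighth moment of `|ε| / (1 - ρ)`,
reproduces itself. -/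
theorem IsInnovation.bddEighthMoment_damped (hε : IsInnovation P ε) {ρ : ℝ} (hρ0 : 0 < ρ)
    (hρ1 : ρ < 1) : BddEighthMoment P (damped ρ ε) := by
  have h1ρ : 0 < 1 - ρ := by linarith
  set K : ℝ := ∫ ω, (|ε 0 ω| / (1 - ρ)) ^ 8 ∂P with hK
  have hK0 : 0 ≤ K := integral_nonneg fun ω => by positivity
  refine ⟨K, fun k => ?_⟩
  induction k with
  | zero => exact ⟨measurable_const, fun _ => le_rfl, by simp [damped], by simpa [damped] using hK0⟩
  | succ k ih =>
    obtain ⟨h1, h2, h3, h4⟩ := ih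
    have hm := hε.measurable ((k : ℤ) + 1)
    have hEi : Integrable (fun ω => (|ε ((k : ℤ) + 1) ω| / (1 - ρ)) ^ 8) P := by
      simp only [div_pow]
      exact (hε.integrable_pow_eight _).div_const _
    have hE : ∫ ω, (|ε ((k : ℤ) + 1) ω| / (1 - ρ)) ^ 8 ∂P = K :=
      hε.integral_comp _ (f := fun x => (|x| / (1 - ρ)) ^ 8) (by fun_prop)
    have hle : ∀ ω, damped ρ ε (k + 1) ω ^ 8 ≤
        ρ * damped ρ ε k ω ^ 8 + (1 - ρ) * (|ε ((k : ℤ) + 1) ω| / (1 - ρ)) ^ 8 := by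
      intro ω
      have h := (convexOn_pow 8).2 (x := damped ρ ε k ω) (y := |ε ((k : ℤ) + 1) ω| / (1 - ρ))
        (h2 ω) (show 0 ≤ |ε ((k : ℤ) + 1) ω| / (1 - ρ) by positivity) hρ0.le h1ρ.le (by ring)
      simp only [smul_eq_mul] at h
      refine le_trans (le_of_eq ?_) h
      rw [mul_div_cancel₀ _ h1ρ.ne']
      rfl
    have hnn : ∀ ω, 0 ≤ damped ρ ε (k + 1) ω := fun ω =>
      add_nonneg (mul_nonneg hρ0.le (h2 ω)) (abs_nonneg _)
    have hmeas : Measurable (damped ρ ε (k + 1)) := (h1.const_mul ρ).add hm.abs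
    have hint : Integrable (fun ω => ρ * damped ρ ε k ω ^ 8 +
        (1 - ρ) * (|ε ((k : ℤ) + 1) ω| / (1 - ρ)) ^ 8) P := (h3.const_mul _).add (hEi.const_mul _)
    have hi : Integrable (fun ω => damped ρ ε (k + 1) ω ^ 8) P :=
      hint.mono' (by fun_prop) (Eventually.of_forall fun ω => by
        rw [Real.norm_of_nonneg (pow_nonneg (hnn ω) 8)]
        exact hle ω)
    refine ⟨hmeas, hnn, hi, (integral_mono hi hint hle).trans ?_⟩
    rw [integral_add (h3.const_mul _) (hEi.const_mul _), integral_const_mul, integral_const_mul, hE]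
    nlinarith

/-- A random variable dominating the state and the innovation at times `k` and `k - l`. -/
def envelope (ρ : ℝ) (ε : ℤ → Ω → ℝ) (l k : ℕ) (ω : Ω) : ℝ :=
  1 + damped ρ ε k ω + damped ρ ε (k - l) ω + |ε ((k : ℤ) + 1) ω| + |ε (((k - l : ℕ) : ℤ) + 1) ω|

theorem IsInnovation.bddEighthMoment_envelope (hε : IsInnovation P ε) {ρ : ℝ} (hρ0 : 0 < ρ)
    (hρ1 : ρ < 1) (l : ℕ) : BddEighthMoment P (envelope ρ ε l) :=
  have h := hε.bddEighthMoment_damped hρ0 hρ1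
  ((((BddEighthMoment.const zero_le_one).add h).add (h.comp fun k => k - l)).add
    (hε.bddEighthMoment_abs.comp fun k : ℕ => (k : ℤ) + 1)).add
    (hε.bddEighthMoment_abs.comp fun k : ℕ => ((k - l : ℕ) : ℤ) + 1)

end EighthMoments

section StateProcess

variable {Ω : Type*} [mΩ : MeasurableSpace Ω] {P : Measure Ω} {p : ℕ} {g : ℝ → ℝ}
  {ε : ℤ → Ω → ℝ} {a : Fin p → ℝ} {X : ℕ → ℕ → Ω → Fin p → ℝ}

open Matrix

/-- The autoregression in state-space form, with initial state bounded in probability. -/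
structure IsStateProcess (P : Measure Ω) (g : ℝ → ℝ) (ε : ℤ → Ω → ℝ) (a : Fin p → ℝ)
    (X : ℕ → ℕ → Ω → Fin p → ℝ) : Prop where
  stable : IsStable a
  succ_eq : ∀ n k, k < n → ∀ ω, X n (k + 1) ω = companion a *ᵥ X n k ω +
    (scale g n ((k : ℤ) + 1) * ε ((k : ℤ) + 1) ω) • firstVec p ℝ
  init_measurable : ∀ n, Measurable (X n 0)
  init_indep : ∀ n, IndepFun (X n 0) (fun ω (k : ℕ) => ε ((k : ℤ) + 1) ω) P
  init_bdd : BddInProb P fun n ω => ‖X n 0 ω‖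

/-- The information generated by the initial state and the innovations up to time `k`. -/
@[reducible]
def pastSigma (ε : ℤ → Ω → ℝ) (X₀ : Ω → Fin p → ℝ) (k : ℕ) : MeasurableSpace Ω :=
  MeasurableSpace.comap X₀ inferInstance ⊔ sigmaOf ε (Set.Icc 1 (k : ℤ))

omit mΩ in
theorem pastSigma_mono (ε : ℤ → Ω → ℝ) (X₀ : Ω → Fin p → ℝ) : Monotone (pastSigma ε X₀) :=
  fun k k' h => sup_le_sup_left (sigmaOf_mono ε (Set.Icc_subset_Icc_right (by exact_mod_cast h))) _

theorem pastSigma_le (hε : ∀ t, Measurable (ε t)) {X₀ : Ω → Fin p → ℝ} (hX : Measurable X₀)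
    (k : ℕ) : pastSigma ε X₀ k ≤ mΩ :=
  sup_le hX.comap_le (sigmaOf_le hε _)

omit mΩ in
theorem measurable_pastSigma (ε : ℤ → Ω → ℝ) (X₀ : Ω → Fin p → ℝ) {i k : ℕ} (hi : i < k) :
    Measurable[pastSigma ε X₀ k] (ε ((i : ℤ) + 1)) :=
  (measurable_sigmaOf ε (S := Set.Icc 1 (k : ℤ))
    (by constructor <;> omega)).mono le_sup_right le_rfl

omit mΩ in
theorem measurable_pastSigma_init (ε : ℤ → Ω → ℝ) (X₀ : Ω → Fin p → ℝ) (k : ℕ) :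
    Measurable[pastSigma ε X₀ k] X₀ :=
  (comap_measurable X₀).mono le_sup_left le_rfl

/-- The initial state may depend on presample innovations and is independent only of those from time
`1` on. This is why the past contains the innovations of `Icc 1 k` and nothing earlier. -/
theorem IsStateProcess.indep_pastSigma [IsProbabilityMeasure P] (hε : IsInnovation P ε)
    (hX : IsStateProcess P g ε a X) (n k : ℕ) :
    Indep (pastSigma ε (X n 0) k) (sigmaOf ε {(k : ℤ) + 1}) P := by
  refine indep_sup_left (hX.init_measurable n).comap_le (sigmaOf_le hε.measurable _)
    (sigmaOf_le hε.measurable _) ?_ (indep_sigmaOf hε.measurable hε.indep (by simp))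
  refine indep_of_indep_of_le_right ((IndepFun_iff_Indep _ _ _).1 (hX.init_indep n)) ?_
  have h : ∀ t : ℤ, 1 ≤ t → MeasurableSpace.comap (ε t) inferInstance ≤
      MeasurableSpace.comap (fun ω (k : ℕ) => ε ((k : ℤ) + 1) ω) inferInstance := by
    intro t ht
    obtain ⟨i, rfl⟩ : ∃ i : ℕ, t = (i : ℤ) + 1 := ⟨(t - 1).toNat, by omega⟩
    refine Measurable.comap_le ?_
    exact (measurable_pi_apply i).comp (comap_measurable fun ω (k : ℕ) => ε ((k : ℤ) + 1) ω)
  refine sup_le (iSup₂_le fun t ht => h t ht.1) (iSup₂_le fun t ht => h t ?_)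
  rw [Set.mem_singleton_iff.1 ht]
  omega

omit mΩ in
theorem measurable_pi_mulVec {m' : MeasurableSpace Ω} (A : Matrix (Fin p) (Fin p) ℝ)
    {Y : Ω → Fin p → ℝ} (hY : Measurable Y) : Measurable fun ω => A *ᵥ Y ω := by
  refine measurable_pi_iff.2 fun i => ?_
  simp only [mulVec, dotProduct]
  fun_prop

theorem IsStateProcess.measurable_state (hX : IsStateProcess P g ε a X) {n k : ℕ} (hk : k ≤ n) :
    Measurable[pastSigma ε (X n 0) k] (X n k) := by
  induction k with
  | zero => exact measurable_pastSigma_init ε _ 0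
  | succ k ih =>
    have h1 := (ih (by omega)).mono (pastSigma_mono ε (X n 0) k.le_succ) le_rfl
    have h2 := measurable_pastSigma ε (X n 0) k.lt_succ_self
    have : X n (k + 1) = fun ω => companion a *ᵥ X n k ω +
      (scale g n ((k : ℤ) + 1) * ε ((k : ℤ) + 1) ω) • firstVec p ℝ :=
      funext fun ω => hX.succ_eq n k hk ω
    rw [this]
    refine Measurable.add (measurable_pi_mulVec _ h1) ?_
    exact Measurable.smul_const (Measurable.const_mul h2 _) _

theorem IsScaleFunction.exists_scale_bounds (hg : IsScaleFunction g) : ∃ c C : ℝ, 0 < c ∧ 0 < C ∧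
    ∀ n k : ℕ, k < n → c ≤ scale g n ((k : ℤ) + 1) ∧ scale g n ((k : ℤ) + 1) ≤ C := by
  obtain ⟨c, C, hc, hC, h⟩ := hg.exists_bounds
  exact ⟨c, C, hc, hC, fun n k hk => h _ (div_mem_Ioc_of_mem_Icc (by omega) (by omega))⟩

/-- Geometric decay of the powers of the companion matrix damps both the initial state and the old
innovations. -/
theorem IsStateProcess.exists_norm_le (hg : IsScaleFunction g) (hX : IsStateProcess P g ε a X) :
    ∃ C ρ : ℝ, 0 < C ∧ 0 < ρ ∧ ρ < 1 ∧
      ∀ n k, k ≤ n → ∀ ω, ‖X n k ω‖ ≤ C * (‖X n 0 ω‖ + damped ρ ε k ω) := by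
  obtain ⟨C, ρ, hC, hρ0, hρ1, hA⟩ := exists_norm_companion_pow_mulVec_le hX.stable
  obtain ⟨c, C', hc, hC', hs⟩ := hg.exists_scale_bounds
  have he : ‖firstVec p ℝ‖ ≤ 1 := by
    refine (pi_norm_le_iff_of_nonneg zero_le_one).2 fun i => ?_
    unfold firstVec
    split_ifs <;> simp
  -- All powers `j` are treated at once: the induction moves one factor of the matrix onto the
  -- power, so that the constant `C` is never multiplied by itself.
  have key : ∀ n k, k ≤ n → ∀ ω j, ‖companion a ^ j *ᵥ X n k ω‖ ≤
      C * ρ ^ (j + k) * ‖X n 0 ω‖ + C * C' * ρ ^ j * damped ρ ε k ω := by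
    intro n k
    induction k with
    | zero =>
      intro _ ω j
      simpa [damped] using hA j (X n 0 ω)
    | succ k ih =>
      intro hk ω j
      have h1 := ih (by omega) ω (j + 1)
      rw [hX.succ_eq n k hk, mulVec_add, mulVec_mulVec, ← pow_succ, mulVec_smul]
      refine (norm_add_le _ _).trans ?_
      obtain ⟨h2, h3⟩ := hs n k hk
      have h4 : ‖(scale g n ((k : ℤ) + 1) * ε ((k : ℤ) + 1) ω) • (companion a ^ j *ᵥ firstVec p ℝ)‖
          ≤ C' * |ε ((k : ℤ) + 1) ω| * (C * ρ ^ j * 1) := by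
        rw [norm_smul, Real.norm_eq_abs, abs_mul, abs_of_pos (hc.trans_le h2)]
        refine mul_le_mul (by gcongr) ((hA j _).trans (by gcongr)) (norm_nonneg _) (by positivity)
      have h5 : damped ρ ε (k + 1) ω = ρ * damped ρ ε k ω + |ε ((k : ℤ) + 1) ω| := rfl
      rw [h5, show j + (k + 1) = j + 1 + k by ring]
      rw [pow_succ ρ j] at h1
      linarith
  have hd0 : ∀ k ω, 0 ≤ damped ρ ε k ω := by
    intro k ω
    induction k with
    | zero => exact le_rfl
    | succ k ih => exact add_nonneg (mul_nonneg hρ0.le ih) (abs_nonneg _)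
  refine ⟨C * (1 + C'), ρ, by positivity, hρ0, hρ1, fun n k hk ω => ?_⟩
  have h := key n k hk ω 0
  rw [pow_zero, one_mulVec, pow_zero, zero_add, mul_one] at h
  have h1 : C * ρ ^ k * ‖X n 0 ω‖ ≤ C * 1 * ‖X n 0 ω‖ := by
    gcongr
    exact pow_le_one₀ hρ0.le hρ1.le
  have h2 : 0 ≤ C * C' * ‖X n 0 ω‖ := by positivity
  have h3 : 0 ≤ C * damped ρ ε k ω := mul_nonneg hC.le (hd0 k ω)
  linarith

end StateProcess

end ARCHTest

namespace ARCHTest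

open scoped Topology
open Matrix

/-! ### Domination by the envelope, averages and martingale sums. -/

section Domination

variable {Ω : Type*} {p : ℕ} {ε : ℤ → Ω → ℝ} {X : ℕ → ℕ → Ω → Fin p → ℝ} {ρ : ℝ} {l r s : ℕ}

/-- The array `Z` grows at most like the `r`-th power of the envelope, uniformly over bounded
initial states. -/
def Dominated (ε : ℤ → Ω → ℝ) (X : ℕ → ℕ → Ω → Fin p → ℝ) (ρ : ℝ) (l r : ℕ)
    (Z : ℕ → ℕ → Ω → ℝ) : Prop :=
  ∀ B : ℝ, ∃ c : ℝ, 0 ≤ c ∧ ∀ n k, k < n → ∀ ω, ‖X n 0 ω‖ ≤ B →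
    |Z n k ω| ≤ c * envelope ρ ε l k ω ^ r

theorem damped_nonneg (hρ : 0 < ρ) (k : ℕ) (ω : Ω) : 0 ≤ damped ρ ε k ω := by
  induction k with
  | zero => exact le_rfl
  | succ k ih => exact add_nonneg (mul_nonneg hρ.le ih) (abs_nonneg _)

theorem one_le_envelope (hρ : 0 < ρ) (l k : ℕ) (ω : Ω) : 1 ≤ envelope ρ ε l k ω := by
  have h1 := damped_nonneg (ε := ε) hρ k ω
  have h2 := damped_nonneg (ε := ε) hρ (k - l) ω
  have h3 := abs_nonneg (ε ((k : ℤ) + 1) ω)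
  have h4 := abs_nonneg (ε (((k - l : ℕ) : ℤ) + 1) ω)
  unfold envelope
  linarith

theorem Dominated.mul {Z Z' : ℕ → ℕ → Ω → ℝ} (h : Dominated ε X ρ l r Z)
    (h' : Dominated ε X ρ l s Z') :
    Dominated ε X ρ l (r + s) fun n k ω => Z n k ω * Z' n k ω := by
  intro B
  obtain ⟨c, hc, hZ⟩ := h B
  obtain ⟨c', hc', hZ'⟩ := h' B
  refine ⟨c * c', by positivity, fun n k hk ω hω => ?_⟩
  rw [abs_mul]
  calc _ ≤ (c * envelope ρ ε l k ω ^ r) * (c' * envelope ρ ε l k ω ^ s) :=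
        mul_le_mul (hZ n k hk ω hω) (hZ' n k hk ω hω) (abs_nonneg _)
          ((abs_nonneg _).trans (hZ n k hk ω hω))
    _ = _ := by ring

theorem Dominated.add {Z Z' : ℕ → ℕ → Ω → ℝ} (h : Dominated ε X ρ l r Z)
    (h' : Dominated ε X ρ l r Z') :
    Dominated ε X ρ l r fun n k ω => Z n k ω + Z' n k ω := by
  intro B
  obtain ⟨c, hc, hZ⟩ := h B
  obtain ⟨c', hc', hZ'⟩ := h' B
  refine ⟨c + c', by positivity, fun n k hk ω hω => (abs_add_le _ _).trans ?_⟩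
  rw [add_mul]
  exact add_le_add (hZ n k hk ω hω) (hZ' n k hk ω hω)

theorem Dominated.mono (hρ : 0 < ρ) {Z : ℕ → ℕ → Ω → ℝ} (h : Dominated ε X ρ l r Z)
    (hrs : r ≤ s) : Dominated ε X ρ l s Z := by
  intro B
  obtain ⟨c, hc, hZ⟩ := h B
  refine ⟨c, hc, fun n k hk ω hω => (hZ n k hk ω hω).trans ?_⟩
  gcongr
  exact one_le_envelope hρ l k ω

theorem Dominated.weight {w : ℕ → ℕ → ℝ} {c : ℝ} (h : ∀ n k, k < n → |w n k| ≤ c) :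
    Dominated ε X ρ l 0 fun n k _ => w n k :=
  fun _ => ⟨|c|, abs_nonneg _, fun n k hk _ _ => by
    simpa using (h n k hk).trans (le_abs_self c)⟩

theorem dominated_innovation (hρ : 0 < ρ) :
    Dominated ε X ρ l 1 fun _ k ω => ε ((k : ℤ) + 1) ω := fun _ =>
  ⟨1, zero_le_one, fun _ k _ ω _ => by
    have h1 := damped_nonneg (ε := ε) hρ k ω
    have h2 := damped_nonneg (ε := ε) hρ (k - l) ω
    have h4 := abs_nonneg (ε (((k - l : ℕ) : ℤ) + 1) ω)
    rw [pow_one, one_mul, envelope]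
    linarith⟩

theorem dominated_innovation_lag (hρ : 0 < ρ) :
    Dominated ε X ρ l 1 fun _ k ω => ε (((k - l : ℕ) : ℤ) + 1) ω := fun _ =>
  ⟨1, zero_le_one, fun _ k _ ω _ => by
    have h1 := damped_nonneg (ε := ε) hρ k ω
    have h2 := damped_nonneg (ε := ε) hρ (k - l) ω
    have h4 := abs_nonneg (ε ((k : ℤ) + 1) ω)
    rw [pow_one, one_mul, envelope]
    linarith⟩

variable {C : ℝ}

theorem dominated_norm_state (hρ : 0 < ρ) (hC : 0 < C)
    (hX : ∀ n k, k ≤ n → ∀ ω, ‖X n k ω‖ ≤ C * (‖X n 0 ω‖ + damped ρ ε k ω)) :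
    Dominated ε X ρ l 1 fun n k ω => ‖X n k ω‖ := fun B =>
  ⟨C * (|B| + 1), by positivity, fun n k hk ω hω => by
    have h1 := damped_nonneg (ε := ε) hρ k ω
    have h2 := damped_nonneg (ε := ε) hρ (k - l) ω
    have h3 := abs_nonneg (ε ((k : ℤ) + 1) ω)
    have h4 := abs_nonneg (ε (((k - l : ℕ) : ℤ) + 1) ω)
    rw [abs_norm, pow_one, mul_assoc]
    refine (hX n k hk.le ω).trans ?_
    have h5 : ‖X n 0 ω‖ ≤ |B| * 1 := by rw [mul_one]; exact hω.trans (le_abs_self B)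
    have h6 : |B| * 1 ≤ |B| * envelope ρ ε l k ω := by
      gcongr; exact one_le_envelope hρ l k ω
    have h7 : damped ρ ε k ω ≤ envelope ρ ε l k ω := by unfold envelope; linarith
    gcongr
    linarith⟩

theorem dominated_norm_state_lag (hρ : 0 < ρ) (hC : 0 < C)
    (hX : ∀ n k, k ≤ n → ∀ ω, ‖X n k ω‖ ≤ C * (‖X n 0 ω‖ + damped ρ ε k ω)) :
    Dominated ε X ρ l 1 fun n k ω => ‖X n (k - l) ω‖ := fun B =>
  ⟨C * (|B| + 1), by positivity, fun n k hk ω hω => by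
    have h1 := damped_nonneg (ε := ε) hρ k ω
    have h2 := damped_nonneg (ε := ε) hρ (k - l) ω
    have h3 := abs_nonneg (ε ((k : ℤ) + 1) ω)
    have h4 := abs_nonneg (ε (((k - l : ℕ) : ℤ) + 1) ω)
    rw [abs_norm, pow_one, mul_assoc]
    refine (hX n (k - l) (by omega) ω).trans ?_
    have h5 : ‖X n 0 ω‖ ≤ |B| * 1 := by rw [mul_one]; exact hω.trans (le_abs_self B)
    have h6 : |B| * 1 ≤ |B| * envelope ρ ε l k ω := by
      gcongr; exact one_le_envelope hρ l k ω
    have h7 : damped ρ ε (k - l) ω ≤ envelope ρ ε l k ω := by unfold envelope; linarith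
    gcongr
    linarith⟩

theorem Dominated.of_abs_le {Z Z' : ℕ → ℕ → Ω → ℝ} (h : Dominated ε X ρ l r Z')
    (hle : ∀ n k, k < n → ∀ ω, |Z n k ω| ≤ |Z' n k ω|) : Dominated ε X ρ l r Z := by
  intro B
  obtain ⟨c, hc, hZ⟩ := h B
  exact ⟨c, hc, fun n k hk ω hω => (hle n k hk ω).trans (hZ n k hk ω hω)⟩

theorem Dominated.ite {Z : ℕ → ℕ → Ω → ℝ} (q : ℕ → Prop) [DecidablePred q]
    (h : Dominated ε X ρ l r Z) : Dominated ε X ρ l r fun n k ω => if q k then Z n k ω else 0 := by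
  refine h.of_abs_le fun n k _ ω => ?_
  split_ifs
  · exact le_rfl
  · rw [abs_zero]
    exact abs_nonneg _

end Domination

section Averages

variable {Ω : Type*} [mΩ : MeasurableSpace Ω] {P : Measure Ω} [IsProbabilityMeasure P] {p : ℕ}
  {g : ℝ → ℝ} {ε : ℤ → Ω → ℝ} {a : Fin p → ℝ} {X : ℕ → ℕ → Ω → Fin p → ℝ} {ρ : ℝ} {l : ℕ}

/-- After truncation of the initial state, the average is dominated by an average of eighth powers
of the envelope, whose expectation is bounded. -/
theorem bddInProb_average (hε : IsInnovation P ε) (hX : IsStateProcess P g ε a X) (hρ0 : 0 < ρ)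
    (hρ1 : ρ < 1) {T : ℕ → ℕ → Ω → ℝ} (hT : Dominated ε X ρ l 8 T) :
    BddInProb P fun n ω => 1 / (n : ℝ) * ∑ k ∈ Finset.range n, T n k ω := by
  refine BddInProb.of_truncation hX.init_bdd fun B => ?_
  obtain ⟨c, hc, hle⟩ := hT B
  obtain ⟨K, hK⟩ := hε.bddEighthMoment_envelope hρ0 hρ1 l
  have hK0 : 0 ≤ K := (integral_nonneg fun ω => by
    have := (hK 0).2.1 ω; positivity).trans (hK 0).2.2.2
  have hU : BddInProb P fun (n : ℕ) ω =>
      1 / (n : ℝ) * ∑ k ∈ Finset.range n, c * envelope ρ ε l k ω ^ 8 := by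
    have hint : ∀ n : ℕ, Integrable (fun ω => 1 / (n : ℝ) *
        ∑ k ∈ Finset.range n, c * envelope ρ ε l k ω ^ 8) P := fun n =>
      (integrable_finsetSum _ fun k _ => (hK k).2.2.1.const_mul c).const_mul _
    refine BddInProb.of_integral_le (K := c * K) hint fun n => ?_
    have habs : ∀ ω, |1 / (n : ℝ) * ∑ k ∈ Finset.range n, c * envelope ρ ε l k ω ^ 8| =
        1 / (n : ℝ) * ∑ k ∈ Finset.range n, c * envelope ρ ε l k ω ^ 8 := fun ω =>
      abs_of_nonneg (mul_nonneg (by positivity) (Finset.sum_nonneg fun k _ =>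
        mul_nonneg hc (pow_nonneg ((hK k).2.1 ω) 8)))
    simp only [habs]
    rw [integral_const_mul, integral_finsetSum _ fun k _ => (hK k).2.2.1.const_mul c]
    have : ∑ k ∈ Finset.range n, ∫ ω, c * envelope ρ ε l k ω ^ 8 ∂P ≤ n * (c * K) := by
      refine (Finset.sum_le_card_nsmul _ _ (c * K) fun k _ => ?_).trans (by simp)
      rw [integral_const_mul]
      exact mul_le_mul_of_nonneg_left (hK k).2.2.2 hc
    rcases Nat.eq_zero_or_pos n with h | h
    · subst h
      simp only [Finset.range_zero, Finset.sum_empty, mul_zero]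
      positivity
    · have hn : (0 : ℝ) < n := by exact_mod_cast h
      rw [one_div, inv_mul_le_iff₀ hn]
      exact this
  refine hU.mono fun n ω => ?_
  by_cases hω : ‖X n 0 ω‖ ≤ B
  · have h1 : ω ∈ {ω | |‖X n 0 ω‖| ≤ B} := by simpa using hω
    rw [Set.indicator_of_mem h1, Pi.one_apply, one_mul, abs_mul, abs_mul]
    refine mul_le_mul_of_nonneg_left ?_ (abs_nonneg _)
    refine (Finset.abs_sum_le_sum_abs _ _).trans (le_trans ?_ (le_abs_self _))
    exact Finset.sum_le_sum fun k hk => hle n k (Finset.mem_range.1 hk) ω hω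
  · have h1 : ω ∉ {ω | |‖X n 0 ω‖| ≤ B} := by simpa using hω
    rw [Set.indicator_of_notMem h1, zero_mul, abs_zero]
    exact abs_nonneg _

/-- After truncation, the squared weights are dominated by eighth powers of the envelope, so the
variance of the sum is `O(n)` by orthogonality. The truncation event is known at time `0`, so the
truncated weights remain predictable. -/
theorem bddInProb_martingale (hε : IsInnovation P ε) (hX : IsStateProcess P g ε a X)
    (hρ0 : 0 < ρ) (hρ1 : ρ < 1) {φ : ℝ → ℝ} (hφ : Measurable φ)
    (hφ2 : ∀ t, MemLp (fun ω => φ (ε t ω)) 2 P) (hφ0 : ∀ t, ∫ ω, φ (ε t ω) ∂P = 0)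
    {Z : ℕ → ℕ → Ω → ℝ} (hZ : Dominated ε X ρ l 4 Z)
    (hZm : ∀ n k, k < n → Measurable[pastSigma ε (X n 0) k] (Z n k)) :
    BddInProb P fun n ω =>
      1 / √(n : ℝ) * ∑ k ∈ Finset.range n, Z n k ω * φ (ε ((k : ℤ) + 1) ω) := by
  refine BddInProb.of_truncation hX.init_bdd fun B => ?_
  obtain ⟨c, hc, hle⟩ := hZ B
  obtain ⟨K, hK⟩ := hε.bddEighthMoment_envelope hρ0 hρ1 l
  have hK0 : 0 ≤ K := (integral_nonneg fun ω => by
    have := (hK 0).2.1 ω; positivity).trans (hK 0).2.2.2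
  set I : ℕ → Ω → ℝ := fun n => {ω | |‖X n 0 ω‖| ≤ B}.indicator 1 with hI
  set Z' : ℕ → ℕ → Ω → ℝ := fun n k ω => I n ω * Z n k ω with hZ'
  have hIm : ∀ n k, Measurable[pastSigma ε (X n 0) k] (I n) := by
    intro n k
    have h := measurable_pastSigma_init ε (X n 0) k
    refine Measurable.indicator measurable_const ?_
    have hset : MeasurableSet {v : Fin p → ℝ | |‖v‖| ≤ B} :=
      measurableSet_le (by fun_prop) measurable_const
    exact h hset
  have hle' : ∀ n k, k < n → ∀ ω, Z' n k ω ^ 2 ≤ c ^ 2 * envelope ρ ε l k ω ^ 8 := by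
    intro n k hk ω
    by_cases hω : ‖X n 0 ω‖ ≤ B
    · have h1 : ω ∈ {ω | |‖X n 0 ω‖| ≤ B} := by simpa using hω
      simp only [hZ', hI]
      rw [Set.indicator_of_mem h1, Pi.one_apply, one_mul, ← sq_abs]
      calc _ ≤ (c * envelope ρ ε l k ω ^ 4) ^ 2 := by
            gcongr
            exact hle n k hk ω hω
        _ = _ := by ring
    · have h1 : ω ∉ {ω | |‖X n 0 ω‖| ≤ B} := by simpa using hω
      simp only [hZ', hI]
      rw [Set.indicator_of_notMem h1, zero_mul, zero_pow two_ne_zero]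
      exact mul_nonneg (sq_nonneg c) (pow_nonneg ((hK k).2.1 ω) 8)
  have hZm' : ∀ n k, k < n → Measurable[pastSigma ε (X n 0) k] (Z' n k) := fun n k hk =>
    Measurable.mul (hIm n k) (hZm n k hk)
  have hsqint : ∀ n k, k < n → Integrable (fun ω => Z' n k ω ^ 2) P := fun n k hk =>
    ((hK k).2.2.1.const_mul (c ^ 2)).mono'
      ((((hZm' n k hk).mono (pastSigma_le hε.measurable (hX.init_measurable n) k)
        le_rfl)).pow_const 2).aestronglyMeasurable
      (Eventually.of_forall fun ω => by
        rw [Real.norm_of_nonneg (sq_nonneg _)]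
        exact hle' n k hk ω)
  have hZ2 : ∀ n k, k < n → MemLp (Z' n k) 2 P := fun n k hk =>
    (memLp_two_iff_integrable_sq ((hZm' n k hk).mono
      (pastSigma_le hε.measurable (hX.init_measurable n) k) le_rfl).aestronglyMeasurable).2
      (hsqint n k hk)
  have hηm : ∀ k : ℕ, Measurable[sigmaOf ε {(k : ℤ) + 1}] fun ω => φ (ε ((k : ℤ) + 1) ω) :=
    fun k => hφ.comp (measurable_sigmaOf ε (Set.mem_singleton _))
  have hmart : ∀ n, _ := fun n => memLp_martingale_sum (P := P) (F := pastSigma ε (X n 0))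
    (fun k => pastSigma_le hε.measurable (hX.init_measurable n) k) (pastSigma_mono ε (X n 0))
    (η := fun k ω => φ (ε ((k : ℤ) + 1) ω)) (Z := Z' n) (n := n)
    (fun k => hφ.comp (measurable_pastSigma ε (X n 0) k.lt_succ_self))
    (fun k => indep_of_indep_of_le_right (hX.indep_pastSigma hε n k) (hηm k).comap_le)
    (fun k => hφ0 _) (fun k => hφ2 _) (hZm' n) (hZ2 n)
  set V : ℝ := ∫ ω, φ (ε 0 ω) ^ 2 ∂P with hV
  have hV0 : 0 ≤ V := integral_nonneg fun ω => sq_nonneg _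
  have hVt : ∀ t, ∫ ω, φ (ε t ω) ^ 2 ∂P = V := fun t =>
    hε.integral_comp t (f := fun x => φ x ^ 2) (by fun_prop)
  have hfin : BddInProb P fun n ω => 1 / √(n : ℝ) *
      ∑ k ∈ Finset.range n, Z' n k ω * φ (ε ((k : ℤ) + 1) ω) := by
    refine BddInProb.of_integral_sq_le (K := c ^ 2 * K * V) (fun n => ?_) fun n => ?_
    · simp only [mul_pow]
      exact (hmart n).2.1.integrable_sq.const_mul _
    · simp only [mul_pow]
      rw [integral_const_mul, (hmart n).2.2]
      have h1 : ∑ k ∈ Finset.range n, (∫ ω, Z' n k ω ^ 2 ∂P) *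
          ∫ ω, φ (ε ((k : ℤ) + 1) ω) ^ 2 ∂P ≤ n * (c ^ 2 * K * V) := by
        refine (Finset.sum_le_card_nsmul _ _ (c ^ 2 * K * V) fun k hk => ?_).trans (by simp)
        rw [hVt]
        have hk' := Finset.mem_range.1 hk
        refine mul_le_mul_of_nonneg_right ?_ hV0
        refine (integral_mono (hsqint n k hk') ((hK k).2.2.1.const_mul (c ^ 2))
          (hle' n k hk')).trans ?_
        rw [integral_const_mul]
        exact mul_le_mul_of_nonneg_left (hK k).2.2.2 (sq_nonneg c)
      rcases Nat.eq_zero_or_pos n with h | h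
      · subst h
        simp only [Finset.range_zero, Finset.sum_empty, mul_zero]
        positivity
      · have hn : (0 : ℝ) < n := by exact_mod_cast h
        rw [div_pow, Real.sq_sqrt hn.le, one_pow, one_div, inv_mul_le_iff₀ hn]
        exact h1
  refine hfin.mono fun n ω => le_of_eq ?_
  congr 1
  simp only [hZ', hI]
  rw [mul_left_comm, Finset.mul_sum]
  congr 1
  exact Finset.sum_congr rfl fun k _ => (mul_assoc _ _ _).symm

end Averages

end ARCHTest

namespace ARCHTest

open scoped Topology
open Matrix

/-! ### Rate of the generalized least-squares estimator. -/

section LeastSquares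

theorem abs_dotProduct_le {p : ℕ} (d v : Fin p → ℝ) : |d ⬝ᵥ v| ≤ ‖d‖ * ∑ i, |v i| := by
  rw [dotProduct, Finset.mul_sum]
  refine (Finset.abs_sum_le_sum_abs _ _).trans (Finset.sum_le_sum fun i _ => ?_)
  rw [abs_mul]
  exact mul_le_mul_of_nonneg_right (norm_le_pi_norm d i) (abs_nonneg _)

theorem vecMul_sum_vecMulVec_dotProduct {p : ℕ} {ι : Type*} (s : Finset ι) (w : ι → ℝ)
    (X : ι → Fin p → ℝ) (d : Fin p → ℝ) :
    (d ᵥ* ∑ k ∈ s, w k • vecMulVec (X k) (X k)) ⬝ᵥ d = ∑ k ∈ s, w k * (d ⬝ᵥ X k) ^ 2 := by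
  classical
  induction s using Finset.induction_on with
  | empty => simp
  | insert k s hk ih =>
    rw [Finset.sum_insert hk, Finset.sum_insert hk, vecMul_add, add_dotProduct, ih, vecMul_smul,
      vecMul_vecMulVec, smul_dotProduct, smul_dotProduct, dotProduct_comm (X k) d]
    simp only [smul_eq_mul]
    ring

variable {p : ℕ} {n : ℕ} {X : ℕ → Fin p → ℝ} {a d : Fin p → ℝ} {s e : ℕ → ℝ} {c B : ℝ}

/-- The quadratic form of the empirical second moments of the state dominates its image under
the transposed companion matrix. -/
theorem quadratic_recursion (hX : ∀ k < n, X (k + 1) = companion a *ᵥ X k +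
    (s k * e k) • firstVec p ℝ)
    (hc : 0 ≤ c) (hs : ∀ k < n, c ≤ s k) (hB1 : |d ⬝ᵥ firstVec p ℝ| ≤ B * ‖d‖)
    (hB2 : ‖d ᵥ* companion a‖ ≤ B * ‖d‖) :
    ∑ k ∈ Finset.range n, ((d ᵥ* companion a) ⬝ᵥ X k) ^ 2 + n * c ^ 2 * (d ⬝ᵥ firstVec p ℝ) ^ 2 -
      (2 * B ^ 2 * ∑ i, |∑ k ∈ Finset.range n, s k * X k i * e k| +
        B ^ 2 * |∑ k ∈ Finset.range n, s k ^ 2 * (e k ^ 2 - 1)| + (∑ i, |X n i|) ^ 2) * ‖d‖ ^ 2 ≤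
      ∑ k ∈ Finset.range n, (d ⬝ᵥ X k) ^ 2 := by
  set f := d ⬝ᵥ firstVec p ℝ
  set d' := d ᵥ* companion a
  set Ξ : Fin p → ℝ := fun i => ∑ k ∈ Finset.range n, s k * X k i * e k with hΞ
  set Λ : ℝ := ∑ k ∈ Finset.range n, s k ^ 2 * (e k ^ 2 - 1) with hΛ
  -- A time shift changes the sum only by boundary terms: the one at `0` has a favourable sign and
  -- is dropped, the one at `n` joins the error.
  have htel : ∑ k ∈ Finset.range n, (d ⬝ᵥ X (k + 1)) ^ 2 =
      ∑ k ∈ Finset.range n, (d ⬝ᵥ X k) ^ 2 + (d ⬝ᵥ X n) ^ 2 - (d ⬝ᵥ X 0) ^ 2 := by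
    have h1 := Finset.sum_range_succ (fun k => (d ⬝ᵥ X k) ^ 2) n
    have h2 := Finset.sum_range_succ' (fun k => (d ⬝ᵥ X k) ^ 2) n
    linarith
  -- The state equation is inserted and the square expanded; `e²` is split into `1` and the centred
  -- `e² - 1`, so that all random corrections are martingale sums.
  have hstep : ∑ k ∈ Finset.range n, (d ⬝ᵥ X (k + 1)) ^ 2 =
      ∑ k ∈ Finset.range n, (d' ⬝ᵥ X k) ^ 2 + 2 * f * (d' ⬝ᵥ Ξ) +
        f ^ 2 * (Λ + ∑ k ∈ Finset.range n, s k ^ 2) := by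
    have h1 : d' ⬝ᵥ Ξ = ∑ k ∈ Finset.range n, s k * e k * (d' ⬝ᵥ X k) := by
      simp only [dotProduct, hΞ, Finset.mul_sum]
      rw [Finset.sum_comm]
      refine Finset.sum_congr rfl fun k _ => Finset.sum_congr rfl fun i _ => by ring
    rw [h1, hΛ, ← Finset.sum_add_distrib, Finset.mul_sum, Finset.mul_sum, ← Finset.sum_add_distrib,
      ← Finset.sum_add_distrib]
    refine Finset.sum_congr rfl fun k hk => ?_
    rw [hX k (Finset.mem_range.1 hk), dotProduct_add, dotProduct_mulVec, dotProduct_smul,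
      smul_eq_mul]
    change ((d' ⬝ᵥ X k) + s k * e k * f) ^ 2 = _
    ring
  have hsum : n * c ^ 2 ≤ ∑ k ∈ Finset.range n, s k ^ 2 := by
    calc (n : ℝ) * c ^ 2 = ∑ _k ∈ Finset.range n, c ^ 2 := by simp
      _ ≤ _ := Finset.sum_le_sum fun k hk => pow_le_pow_left₀ hc (hs k (Finset.mem_range.1 hk)) 2
  have hd : 0 ≤ ‖d‖ := norm_nonneg d
  have hBd : 0 ≤ B * ‖d‖ := (abs_nonneg _).trans hB1
  have hf2 : f ^ 2 ≤ (B * ‖d‖) ^ 2 := by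
    rw [← sq_abs]
    exact pow_le_pow_left₀ (abs_nonneg _) hB1 2
  have hcross : -(2 * B ^ 2 * (∑ i, |Ξ i|) * ‖d‖ ^ 2) ≤ 2 * f * (d' ⬝ᵥ Ξ) := by
    have hS : 0 ≤ ∑ i, |Ξ i| := Finset.sum_nonneg fun i _ => abs_nonneg _
    have h1 : |f * (d' ⬝ᵥ Ξ)| ≤ (B * ‖d‖) * ((B * ‖d‖) * ∑ i, |Ξ i|) := by
      rw [abs_mul]
      exact mul_le_mul hB1 ((abs_dotProduct_le _ _).trans (by gcongr)) (abs_nonneg _) hBd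
    have h2 := neg_abs_le (f * (d' ⬝ᵥ Ξ))
    nlinarith
  have hΛb : -(B ^ 2 * |Λ| * ‖d‖ ^ 2) ≤ f ^ 2 * Λ := by
    have h1 := neg_abs_le Λ
    have h2 := mul_le_mul_of_nonneg_right hf2 (abs_nonneg Λ)
    have h3 := mul_le_mul_of_nonneg_left h1 (sq_nonneg f)
    nlinarith
  have hlast : (d ⬝ᵥ X n) ^ 2 ≤ (∑ i, |X n i|) ^ 2 * ‖d‖ ^ 2 := by
    rw [← sq_abs, ← mul_pow, mul_comm]
    exact pow_le_pow_left₀ (abs_nonneg _) (abs_dotProduct_le _ _) 2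
  have h4 := mul_le_mul_of_nonneg_left hsum (sq_nonneg f)
  have h5 := sq_nonneg (d ⬝ᵥ X 0)
  simp only [hΞ] at hcross
  nlinarith

end LeastSquares

section EstimationError

variable {Ω : Type*} [mΩ : MeasurableSpace Ω] {P : Measure Ω} [IsProbabilityMeasure P] {p : ℕ}
  {g : ℝ → ℝ} {ε : ℤ → Ω → ℝ} {a : Fin p → ℝ} {X : ℕ → ℕ → Ω → Fin p → ℝ}

omit [IsProbabilityMeasure P] in
theorem IsStateProcess.measurable_coord (hX : IsStateProcess P g ε a X) {n k k' : ℕ} (hk : k ≤ n)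
    (hk' : k ≤ k') (i : Fin p) : Measurable[pastSigma ε (X n 0) k'] fun ω => X n k ω i :=
  (measurable_pi_apply i).comp
    ((hX.measurable_state hk).mono (pastSigma_mono ε (X n 0) hk') le_rfl)

omit mΩ in
theorem Dominated.coord {ρ : ℝ} {l : ℕ} {f : ℕ → ℕ}
    (h : Dominated ε X ρ l 1 fun n k ω => ‖X n (f k) ω‖) (i : Fin p) :
    Dominated ε X ρ l 1 fun n k ω => X n (f k) ω i :=
  h.of_abs_le fun n k _ ω => by
    rw [abs_norm]
    exact norm_le_pi_norm (X n (f k) ω) i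

/-- The generalized least-squares error is of order `n^{-1/2}` in probability. -/
theorem IsStateProcess.bddInProb_error (hg : IsScaleFunction g) (hε : IsInnovation P ε)
    (hX : IsStateProcess P g ε a X) {θ : ℕ → Ω → Fin p → ℝ}
    (hθ : ∀ n ω, (∑ k ∈ Finset.range n, (scale g n ((k : ℤ) + 1) ^ 2)⁻¹ •
        vecMulVec (X n k ω) (X n k ω)).det ≠ 0 →
      (θ n ω - a) ᵥ* (∑ k ∈ Finset.range n, (scale g n ((k : ℤ) + 1) ^ 2)⁻¹ •
        vecMulVec (X n k ω) (X n k ω)) = fun i => ∑ k ∈ Finset.range n,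
          (scale g n ((k : ℤ) + 1))⁻¹ * X n k ω i * ε ((k : ℤ) + 1) ω) :
    BddInProb P fun n ω => √(n : ℝ) * ‖θ n ω - a‖ := by
  obtain ⟨c, C, hc, hC, hs⟩ := hg.exists_scale_bounds
  obtain ⟨C₀, ρ, hC₀, hρ0, hρ1, hdom⟩ := hX.exists_norm_le hg
  obtain ⟨c₁, c₂, hc₁, hc₂, hquad⟩ := exists_quadratic_lower_bound a
  have hs0 : ∀ n k, k < n → 0 < scale g n ((k : ℤ) + 1) := fun n k hk => hc.trans_le (hs n k hk).1
  have hsb : ∀ n k, k < n → |scale g n ((k : ℤ) + 1)| ≤ C := fun n k hk => by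
    rw [abs_of_pos (hs0 n k hk)]; exact (hs n k hk).2
  have hsinv : ∀ n k, k < n → |(scale g n ((k : ℤ) + 1))⁻¹| ≤ c⁻¹ := fun n k hk => by
    rw [abs_inv, abs_of_pos (hs0 n k hk)]
    exact inv_anti₀ hc (hs n k hk).1
  have hdomX : Dominated ε X ρ 0 1 fun n k ω => ‖X n k ω‖ := dominated_norm_state hρ0 hC₀ hdom
  obtain ⟨B, hB0, hB1, hB2⟩ : ∃ B : ℝ, 0 ≤ B ∧
      (∀ d : Fin p → ℝ, |d ⬝ᵥ firstVec p ℝ| ≤ B * ‖d‖) ∧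
      ∀ d : Fin p → ℝ, ‖d ᵥ* companion a‖ ≤ B * ‖d‖ := by
    set T := LinearMap.toContinuousLinearMap (Matrix.vecMulLinear (companion a))
    refine ⟨max (∑ i, |firstVec p ℝ i|) ‖T‖, le_max_of_le_right (norm_nonneg _), fun d => ?_,
      fun d => ?_⟩
    · rw [mul_comm]
      refine (abs_dotProduct_le _ _).trans ?_
      gcongr
      exact le_max_left _ _
    · refine (T.le_opNorm d).trans ?_
      gcongr
      exact le_max_right _ _
  set Ξ : Fin p → ℕ → Ω → ℝ := fun i n ω => 1 / √(n : ℝ) * ∑ k ∈ Finset.range n,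
    scale g n ((k : ℤ) + 1) * X n k ω i * ε ((k : ℤ) + 1) ω with hΞ
  set ξ : Fin p → ℕ → Ω → ℝ := fun i n ω => 1 / √(n : ℝ) * ∑ k ∈ Finset.range n,
    (scale g n ((k : ℤ) + 1))⁻¹ * X n k ω i * ε ((k : ℤ) + 1) ω with hξ
  set Λ : ℕ → Ω → ℝ := fun n ω => 1 / √(n : ℝ) * ∑ k ∈ Finset.range n,
    scale g n ((k : ℤ) + 1) ^ 2 * (ε ((k : ℤ) + 1) ω ^ 2 - 1) with hΛ
  have hΞb : ∀ i, BddInProb P (Ξ i) := fun i =>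
    bddInProb_martingale hε hX hρ0 hρ1 (φ := fun x => x) measurable_id hε.memLp_two
      hε.integral_eq_zero
      (((Dominated.weight (l := 0) hsb).mul (hdomX.coord (f := fun k => k) i)).mono hρ0
        (by norm_num))
      fun n k hk => Measurable.const_mul (hX.measurable_coord hk.le le_rfl i) _
  have hξb : ∀ i, BddInProb P (ξ i) := fun i =>
    bddInProb_martingale hε hX hρ0 hρ1 (φ := fun x => x) measurable_id hε.memLp_two
      hε.integral_eq_zero
      (((Dominated.weight (l := 0) hsinv).mul (hdomX.coord (f := fun k => k) i)).mono hρ0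
        (by norm_num))
      fun n k hk => Measurable.const_mul (hX.measurable_coord hk.le le_rfl i) _
  have hΛb : BddInProb P Λ :=
    bddInProb_martingale (l := 0) hε hX hρ0 hρ1 (φ := fun x => x ^ 2 - 1) (by fun_prop)
      (fun t => (hε.memLp_sq_sub_one t).mono_exponent (by norm_num)) hε.integral_sq_sub_one
      ((Dominated.weight (w := fun n k => scale g n ((k : ℤ) + 1) ^ 2) (c := C ^ 2)
        fun n k hk => by
          rw [abs_pow]; exact pow_le_pow_left₀ (abs_nonneg _) (hsb n k hk) 2).mono hρ0
            (by norm_num))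
      fun n k hk => measurable_const
  have hdamp : BddInProb P fun n ω => damped ρ ε n ω := by
    obtain ⟨K, hK⟩ := hε.bddEighthMoment_damped hρ0 hρ1
    have h8 : BddInProb P fun n ω => damped ρ ε n ω ^ 8 :=
      BddInProb.of_integral_le (K := K) (fun n => (hK n).2.2.1) fun n => by
        have : ∀ ω, |damped ρ ε n ω ^ 8| = damped ρ ε n ω ^ 8 := fun ω =>
          abs_of_nonneg (pow_nonneg ((hK n).2.1 ω) 8)
        simpa only [this] using (hK n).2.2.2
    refine (h8.add (BddInProb.const 1)).mono fun n ω => ?_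
    have h0 := (hK n).2.1 ω
    rw [abs_of_nonneg h0, abs_of_nonneg (by positivity)]
    rcases le_total (damped ρ ε n ω) 1 with h | h
    · have : 0 ≤ damped ρ ε n ω ^ 8 := by positivity
      linarith
    · have := le_self_pow₀ h (by norm_num : (8 : ℕ) ≠ 0)
      linarith
  have hlast : BddInProb P fun n ω => (∑ i, |X n n ω i|) ^ 2 := by
    have h1 : BddInProb P fun n ω => C₀ * (‖X n 0 ω‖ + damped ρ ε n ω) :=
      (BddInProb.const C₀).mul (hX.init_bdd.add hdamp)
    have h2 : ∀ i, BddInProb P fun n ω => |X n n ω i| := fun i => h1.mono fun n ω => by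
      rw [abs_abs]
      exact ((norm_le_pi_norm _ i).trans (hdom n n le_rfl ω)).trans (le_abs_self _)
    have h3 := BddInProb.sum Finset.univ fun i _ => h2 i
    simpa only [sq] using h3.mul h3
  set E : ℕ → Ω → ℝ := fun n ω =>
    2 * B ^ 2 * ∑ i, |Ξ i n ω| + B ^ 2 * |Λ n ω| + (∑ i, |X n n ω i|) ^ 2 with hE
  have hEb : BddInProb P E :=
    (((BddInProb.const (2 * B ^ 2)).mul (BddInProb.sum Finset.univ fun i _ => (hΞb i).abs)).add
      ((BddInProb.const (B ^ 2)).mul hΛb.abs)).add hlast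
  have hsqrt : Tendsto (fun n : ℕ => 1 / √(n : ℝ)) atTop (𝓝 0) := by
    have : Tendsto (fun n : ℕ => √(n : ℝ)) atTop atTop :=
      Real.tendsto_sqrt_atTop.comp tendsto_natCast_atTop_atTop
    simpa using! tendsto_inv_atTop_zero.comp this
  -- With this `η`, on the event `n^{-1/2} E < η` the error term consumes at most half of `c² c₁` in
  -- the lower bound of the quadratic form; `K` below also accounts for the weights `h_t⁻² ≥ C⁻²`.
  set η : ℝ := c ^ 2 * c₁ / (2 * c₂) with hη
  have hη0 : 0 < η := by positivity
  set K : ℝ := 2 * C ^ 2 / (c ^ 2 * c₁) with hK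
  have hK0 : 0 < K := by positivity
  have hsumξ : BddInProb P fun n ω => K * ∑ i, |ξ i n ω| :=
    (BddInProb.const K).mul (BddInProb.sum Finset.univ fun i _ => (hξb i).abs)
  refine hsumξ.of_le_on (fun n => {ω | η ≤ |1 / √(n : ℝ) * E n ω|})
    (fun δ hδ => hEb.eventually_small hsqrt hη0 hδ) fun n ω hω => ?_
  rcases Nat.eq_zero_or_pos n with hn | hn
  · subst hn
    simp only [CharP.cast_eq_zero, Real.sqrt_zero, zero_mul, abs_zero]
    exact abs_nonneg _
  have hn0 : (0 : ℝ) < n := by exact_mod_cast hn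
  have hsn : (0 : ℝ) < √(n : ℝ) := Real.sqrt_pos.2 hn0
  have hss : √(n : ℝ) * √(n : ℝ) = n := Real.mul_self_sqrt hn0.le
  have hsmall : 1 / √(n : ℝ) * E n ω < η := lt_of_le_of_lt (le_abs_self _) (not_le.1 hω)
  have hE0 : 0 ≤ E n ω := by positivity
  have hq : ∀ d : Fin p → ℝ, n * (c ^ 2 * c₁ / 2) * ‖d‖ ^ 2 ≤
      ∑ k ∈ Finset.range n, (d ⬝ᵥ X n k ω) ^ 2 := by
    have h := hquad (fun d => 1 / (n : ℝ) * ∑ k ∈ Finset.range n, (d ⬝ᵥ X n k ω) ^ 2) (c ^ 2)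
      (1 / √(n : ℝ) * E n ω) (sq_nonneg c) (by positivity) (fun d => by positivity) fun d => ?_
    · intro d
      have h1 := h d
      have h2 : c ^ 2 * c₁ / 2 ≤ c ^ 2 * c₁ - 1 / √(n : ℝ) * E n ω * c₂ := by
        have : 1 / √(n : ℝ) * E n ω * c₂ ≤ η * c₂ := by gcongr
        have h3 : η * c₂ = c ^ 2 * c₁ / 2 := by rw [hη]; field_simp
        linarith
      have h3 := mul_le_mul_of_nonneg_right h2 (sq_nonneg ‖d‖)
      have h4 := h3.trans h1
      rw [one_div, inv_mul_eq_div, le_div_iff₀ hn0] at h4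
      linarith
    · have h1 := quadratic_recursion (n := n) (X := fun k => X n k ω) (a := a) (d := d)
        (s := fun k => scale g n ((k : ℤ) + 1)) (e := fun k => ε ((k : ℤ) + 1) ω)
        (fun k hk => hX.succ_eq n k hk ω) hc.le (fun k hk => (hs n k hk).1) (hB1 d) (hB2 d)
      have hEn : 2 * B ^ 2 * ∑ i, |∑ k ∈ Finset.range n,
            scale g n ((k : ℤ) + 1) * X n k ω i * ε ((k : ℤ) + 1) ω| +
          B ^ 2 * |∑ k ∈ Finset.range n,
            scale g n ((k : ℤ) + 1) ^ 2 * (ε ((k : ℤ) + 1) ω ^ 2 - 1)| +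
          (∑ i, |X n n ω i|) ^ 2 ≤ √(n : ℝ) * E n ω := by
        have e1 : ∀ z : ℝ, |z| = √(n : ℝ) * |1 / √(n : ℝ) * z| := fun z => by
          rw [abs_mul, abs_of_pos (by positivity : 0 < 1 / √(n : ℝ))]
          field_simp
        have e2 : (1 : ℝ) ≤ √(n : ℝ) := Real.one_le_sqrt.2 (by exact_mod_cast hn)
        have e3 : (∑ i, |X n n ω i|) ^ 2 ≤ √(n : ℝ) * (∑ i, |X n n ω i|) ^ 2 :=
          le_mul_of_one_le_left (sq_nonneg _) e2
        have e4 : ∑ i, |∑ k ∈ Finset.range n,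
            scale g n ((k : ℤ) + 1) * X n k ω i * ε ((k : ℤ) + 1) ω| =
            √(n : ℝ) * ∑ i, |Ξ i n ω| := by
          rw [Finset.mul_sum]
          exact Finset.sum_congr rfl fun i _ => e1 _
        rw [e4, e1 (∑ k ∈ Finset.range n,
            scale g n ((k : ℤ) + 1) ^ 2 * (ε ((k : ℤ) + 1) ω ^ 2 - 1))]
        change 2 * B ^ 2 * (√(n : ℝ) * ∑ i, |Ξ i n ω|) + B ^ 2 * (√(n : ℝ) * |Λ n ω|) + _ ≤
          √(n : ℝ) * (2 * B ^ 2 * ∑ i, |Ξ i n ω| + B ^ 2 * |Λ n ω| + (∑ i, |X n n ω i|) ^ 2)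
        linarith
      have h2 := mul_le_mul_of_nonneg_right hEn (sq_nonneg ‖d‖)
      have h3 : ∑ k ∈ Finset.range n, ((d ᵥ* companion a) ⬝ᵥ X n k ω) ^ 2 +
          n * c ^ 2 * (d ⬝ᵥ firstVec p ℝ) ^ 2 - √(n : ℝ) * E n ω * ‖d‖ ^ 2 ≤
          ∑ k ∈ Finset.range n, (d ⬝ᵥ X n k ω) ^ 2 := by linarith
      have h4 := mul_le_mul_of_nonneg_left h3 (by positivity : 0 ≤ 1 / (n : ℝ))
      refine le_trans (le_of_eq ?_) h4
      have h5 : 1 / (n : ℝ) * √(n : ℝ) = 1 / √(n : ℝ) := by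
        rw [div_mul_eq_mul_div, one_mul, div_eq_div_iff hn0.ne' hsn.ne', one_mul, hss]
      have h6 : 1 / (n : ℝ) * n = 1 := one_div_mul_cancel hn0.ne'
      have h7 : ∀ u v y z : ℝ, 1 / (n : ℝ) * u + c ^ 2 * v - 1 / √(n : ℝ) * y * z =
          1 / (n : ℝ) * (u + n * c ^ 2 * v - √(n : ℝ) * y * z) := fun u v y z => by
        linear_combination -(c ^ 2 * v) * h6 + y * z * h5
      exact h7 _ _ _ _
  set M := ∑ k ∈ Finset.range n, (scale g n ((k : ℤ) + 1) ^ 2)⁻¹ •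
    vecMulVec (X n k ω) (X n k ω) with hM
  have hform : ∀ d : Fin p → ℝ, n * ‖d‖ ^ 2 ≤ K * ((d ᵥ* M) ⬝ᵥ d) := by
    intro d
    rw [hM, vecMul_sum_vecMulVec_dotProduct]
    have h1 : (C ^ 2)⁻¹ * ∑ k ∈ Finset.range n, (d ⬝ᵥ X n k ω) ^ 2 ≤
        ∑ k ∈ Finset.range n, (scale g n ((k : ℤ) + 1) ^ 2)⁻¹ * (d ⬝ᵥ X n k ω) ^ 2 := by
      rw [Finset.mul_sum]
      refine Finset.sum_le_sum fun k hk => ?_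
      have hk' := Finset.mem_range.1 hk
      have := hs0 n k hk'
      gcongr
      exact (hs n k hk').2
    have h2 := mul_le_mul_of_nonneg_left (hq d) (by positivity : 0 ≤ (C ^ 2)⁻¹)
    have h3 := mul_le_mul_of_nonneg_left (h2.trans h1) hK0.le
    refine le_trans (le_of_eq ?_) h3
    rw [hK]
    field_simp
  -- The form is positive definite on this event, so the singular convention of the estimator is not
  -- met and the normal equations apply.
  have hdet : M.det ≠ 0 := by
    intro h0
    obtain ⟨v, hv0, hv⟩ := Matrix.exists_vecMul_eq_zero_iff.2 h0
    have h1 := hform v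
    rw [hv, zero_dotProduct, mul_zero] at h1
    have h2 : 0 < n * ‖v‖ ^ 2 := by
      have := norm_pos_iff.2 hv0
      positivity
    linarith
  have hd := hθ n ω hdet
  set d := θ n ω - a
  have h1 := hform d
  rw [hd] at h1
  have h2 : (fun i => ∑ k ∈ Finset.range n, (scale g n ((k : ℤ) + 1))⁻¹ * X n k ω i *
      ε ((k : ℤ) + 1) ω) ⬝ᵥ d ≤ ‖d‖ * (√(n : ℝ) * ∑ i, |ξ i n ω|) := by
    rw [dotProduct_comm]
    refine (le_abs_self _).trans ((abs_dotProduct_le _ _).trans (le_of_eq ?_))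
    congr 1
    rw [Finset.mul_sum]
    refine Finset.sum_congr rfl fun i _ => ?_
    simp only [hξ]
    rw [abs_mul, abs_of_pos (by positivity : 0 < 1 / √(n : ℝ))]
    field_simp
  have h3 := h1.trans (mul_le_mul_of_nonneg_left h2 hK0.le)
  have hS : 0 ≤ K * ∑ i, |ξ i n ω| :=
    mul_nonneg hK0.le (Finset.sum_nonneg fun i _ => abs_nonneg _)
  rw [abs_of_nonneg (by positivity), abs_of_nonneg hS]
  rcases (norm_nonneg d).eq_or_lt with h0 | h0
  · rw [← h0, mul_zero]
    exact hS
  -- The normal equations paired with `d` read `n ‖d‖² ≤ K ‖d‖ √n ∑ |ξ|`; a factor `√n ‖d‖` is then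
  -- cancelled.
  · have h4 : (√(n : ℝ) * ‖d‖) * (√(n : ℝ) * ‖d‖) ≤ (√(n : ℝ) * ‖d‖) * (K * ∑ i, |ξ i n ω|) := by
      calc _ = (√(n : ℝ) * √(n : ℝ)) * ‖d‖ ^ 2 := by ring
        _ ≤ K * (‖d‖ * (√(n : ℝ) * ∑ i, |ξ i n ω|)) := by rw [hss]; exact h3
        _ = _ := by ring
    exact le_of_mul_le_mul_left h4 (by positivity)

end EstimationError

end ARCHTest

namespace ARCHTest

open scoped Topology
open Matrix

/-! ### The score and its expansion around the true parameter. -/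

section ScoreFormula

theorem sum_Icc_one_eq_sum_range {M : Type*} [AddCommMonoid M] (n : ℕ) (f : ℤ → M) :
    ∑ t ∈ Finset.Icc (1 : ℤ) n, f t = ∑ k ∈ Finset.range n, f ((k : ℤ) + 1) := by
  refine Finset.sum_nbij' (fun t => (t - 1).toNat) (fun k => (k : ℤ) + 1) ?_ ?_ ?_ ?_ ?_
  · intro t ht
    have := Finset.mem_Icc.1 ht
    rw [Finset.mem_range]
    omega
  · intro k hk
    have := Finset.mem_range.1 hk
    rw [Finset.mem_Icc]
    omega
  · intro t ht
    have := Finset.mem_Icc.1 ht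
    omega
  · intro k _
    omega
  · intro t ht
    have := Finset.mem_Icc.1 ht
    congr 1
    omega

theorem archVariance_single {p m : ℕ} (h x : ℤ → ℝ) (θ : Fin p → ℝ) (j : Fin m) (s : ℝ) (t : ℤ) :
    archVariance h x θ (Pi.single j s : Fin m → ℝ) t =
      h t ^ 2 + s * residual x θ (t - ((j : ℕ) + 1 : ℤ)) ^ 2 := by
  rw [archVariance, Finset.sum_eq_single j]
  · simp
  · intro i _ hi
    simp [hi]
  · simp

/-- Along the `j`-th axis the conditional variance is the affine function `h² + s q`, so each
summand is differentiated explicitly at `s = 0`, where `h ≠ 0` keeps quotient and logarithm regular.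
-/
theorem score_apply {p m n : ℕ} {h : ℤ → ℝ} (x : ℤ → ℝ) (θ : Fin p → ℝ) (j : Fin m)
    (hh : ∀ k < n, h ((k : ℤ) + 1) ≠ 0) :
    score m n h x θ j = 1 / √(n : ℝ) * ∑ k ∈ Finset.range n,
      1 / 2 * (h ((k : ℤ) + 1) ^ 2)⁻¹ * residual x θ ((k : ℤ) + 1 - ((j : ℕ) + 1 : ℤ)) ^ 2 *
        (residual x θ ((k : ℤ) + 1) ^ 2 / h ((k : ℤ) + 1) ^ 2 - 1) := by
  change 1 / √(n : ℝ) * deriv (fun s : ℝ => quasiLogLik n h x θ (Pi.single j s : Fin m → ℝ)) 0 = _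
  congr 1
  have hd : HasDerivAt (fun s : ℝ => quasiLogLik n h x θ (Pi.single j s : Fin m → ℝ))
      (-(1 / 2) * ∑ k ∈ Finset.range n,
        (-(residual x θ ((k : ℤ) + 1) ^ 2 * residual x θ ((k : ℤ) + 1 - ((j : ℕ) + 1 : ℤ)) ^ 2) /
          (h ((k : ℤ) + 1) ^ 2) ^ 2 +
        residual x θ ((k : ℤ) + 1 - ((j : ℕ) + 1 : ℤ)) ^ 2 / h ((k : ℤ) + 1) ^ 2)) 0 := by
    simp only [quasiLogLik, archVariance_single, sum_Icc_one_eq_sum_range]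
    refine HasDerivAt.const_mul _ (HasDerivAt.fun_sum fun k hk => ?_)
    have h0 : h ((k : ℤ) + 1) ^ 2 ≠ 0 := pow_ne_zero 2 (hh k (Finset.mem_range.1 hk))
    set q := residual x θ ((k : ℤ) + 1 - ((j : ℕ) + 1 : ℤ)) ^ 2
    set r := residual x θ ((k : ℤ) + 1) ^ 2
    have hlin : HasDerivAt (fun s : ℝ => h ((k : ℤ) + 1) ^ 2 + s * q) q 0 := by
      simpa using ((hasDerivAt_id (0 : ℝ)).mul_const q).const_add (h ((k : ℤ) + 1) ^ 2)
    have h1 : h ((k : ℤ) + 1) ^ 2 + 0 * q ≠ 0 := by simpa using h0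
    have hdiv := (hasDerivAt_const (0 : ℝ) r).fun_div hlin h1
    have hlog := hlin.log h1
    have := hdiv.add hlog
    simp only [zero_mul, add_zero, zero_sub] at this
    exact this
  rw [hd.deriv, Finset.mul_sum]
  refine Finset.sum_congr rfl fun k hk => ?_
  have h0 := hh k (Finset.mem_range.1 hk)
  field_simp
  ring

end ScoreFormula

section Expansion

/-- The two terms of first order in `b'` and `b` are added back on the left, since they are to be
treated as martingale sums. With `b = s β`, what remains is a polynomial without terms of degree
below two in `(b', β)`, bounded by squares through `2xy ≤ x² + y²`; this yields only powers `δ²` and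
`δ⁴`. -/
theorem abs_score_term_sub_le {s u' b' e b δ Y Y' : ℝ} (hs : 0 < s) (hb : |b| ≤ δ * Y)
    (hb' : |b'| ≤ δ * Y') :
    |1 / 2 * (s ^ 2)⁻¹ * (u' - b') ^ 2 * ((s * e - b) ^ 2 / s ^ 2 - 1) -
        1 / 2 * (s ^ 2)⁻¹ * u' ^ 2 * (e ^ 2 - 1) +
        (s ^ 2)⁻¹ * u' * b' * (e ^ 2 - 1) + (s ^ 3)⁻¹ * u' ^ 2 * b * e| ≤
      δ ^ 2 * (1 / 2 * (s ^ 2)⁻¹ * (Y' ^ 2 * (4 * e ^ 2 + 1) + 4 * (s ^ 2)⁻¹ * u' ^ 2 * Y ^ 2)) +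
        δ ^ 4 * (3 / 2 * (s ^ 2)⁻¹ * (s ^ 2)⁻¹ * Y' ^ 2 * Y ^ 2) := by
  obtain ⟨β, rfl⟩ : ∃ β, b = s * β := ⟨b / s, by field_simp⟩
  have hβ : β ^ 2 ≤ (s ^ 2)⁻¹ * (δ ^ 2 * Y ^ 2) := by
    have h1 : (s * β) ^ 2 ≤ (δ * Y) ^ 2 := by
      rw [← sq_abs (s * β)]; exact pow_le_pow_left₀ (abs_nonneg _) hb 2
    rw [mul_pow, mul_pow] at h1
    rw [← div_eq_inv_mul, le_div_iff₀ (by positivity), mul_comm]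
    exact h1
  have hb2 : b' ^ 2 ≤ δ ^ 2 * Y' ^ 2 := by
    rw [← sq_abs, ← mul_pow]; exact pow_le_pow_left₀ (abs_nonneg _) hb' 2
  have heq : 1 / 2 * (s ^ 2)⁻¹ * (u' - b') ^ 2 * ((s * e - s * β) ^ 2 / s ^ 2 - 1) -
        1 / 2 * (s ^ 2)⁻¹ * u' ^ 2 * (e ^ 2 - 1) +
        (s ^ 2)⁻¹ * u' * b' * (e ^ 2 - 1) + (s ^ 3)⁻¹ * u' ^ 2 * (s * β) * e =
      1 / 2 * (s ^ 2)⁻¹ * (b' ^ 2 * (e ^ 2 - 1) + u' ^ 2 * β ^ 2 + 4 * u' * b' * e * β -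
        2 * u' * b' * β ^ 2 - 2 * b' ^ 2 * e * β + b' ^ 2 * β ^ 2) := by
    field_simp
    ring
  have hR : |b' ^ 2 * (e ^ 2 - 1) + u' ^ 2 * β ^ 2 + 4 * u' * b' * e * β -
        2 * u' * b' * β ^ 2 - 2 * b' ^ 2 * e * β + b' ^ 2 * β ^ 2| ≤
      b' ^ 2 * (4 * e ^ 2 + 1) + 4 * u' ^ 2 * β ^ 2 + 3 * b' ^ 2 * β ^ 2 := by
    rw [abs_le]
    constructor
    · have : 0 ≤ 2 * (b' * e + u' * β) ^ 2 + (b' * e - b' * β) ^ 2 + (u' * β - b' * β) ^ 2 +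
          2 * (b' * e) ^ 2 + 2 * (u' * β) ^ 2 + 2 * (b' * β) ^ 2 := by positivity
      linarith
    · have : 0 ≤ 2 * (b' * e - u' * β) ^ 2 + (b' * e + b' * β) ^ 2 + (u' * β + b' * β) ^ 2 +
          2 * b' ^ 2 := by positivity
      linarith
  rw [heq, abs_mul, abs_of_pos (by positivity : 0 < 1 / 2 * (s ^ 2)⁻¹)]
  have h1 : b' ^ 2 * (4 * e ^ 2 + 1) ≤ δ ^ 2 * Y' ^ 2 * (4 * e ^ 2 + 1) := by gcongr
  have h2 : 4 * u' ^ 2 * β ^ 2 ≤ 4 * u' ^ 2 * ((s ^ 2)⁻¹ * (δ ^ 2 * Y ^ 2)) := by gcongr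
  have h3 : 3 * b' ^ 2 * β ^ 2 ≤ 3 * (δ ^ 2 * Y' ^ 2) * ((s ^ 2)⁻¹ * (δ ^ 2 * Y ^ 2)) := by gcongr
  calc _ ≤ 1 / 2 * (s ^ 2)⁻¹ * (δ ^ 2 * Y' ^ 2 * (4 * e ^ 2 + 1) +
        4 * u' ^ 2 * ((s ^ 2)⁻¹ * (δ ^ 2 * Y ^ 2)) +
        3 * (δ ^ 2 * Y' ^ 2) * ((s ^ 2)⁻¹ * (δ ^ 2 * Y ^ 2))) := by
        refine mul_le_mul_of_nonneg_left (hR.trans ?_) (by positivity)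
        linarith
    _ = _ := by ring

end Expansion

section Perturbation

variable {Ω : Type*} [mΩ : MeasurableSpace Ω] {P : Measure Ω} [IsProbabilityMeasure P] {p : ℕ}
  {g : ℝ → ℝ} {ε : ℤ → Ω → ℝ} {a : Fin p → ℝ} {X : ℕ → ℕ → Ω → Fin p → ℝ}

omit mΩ in
theorem Dominated.pow {ρ : ℝ} {l r : ℕ} {Z : ℕ → ℕ → Ω → ℝ} (h : Dominated ε X ρ l r Z) (q : ℕ) :
    Dominated ε X ρ l (r * q) fun n k ω => Z n k ω ^ q := by
  intro B
  obtain ⟨c, hc, hZ⟩ := h B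
  refine ⟨c ^ q, by positivity, fun n k hk ω hω => ?_⟩
  rw [abs_pow, pow_mul, ← mul_pow]
  exact pow_le_pow_left₀ (abs_nonneg _) (hZ n k hk ω hω) q

/-- The summand of the `l`-th component of the score at the parameter `a + d`. -/
noncomputable def scoreTerm (g : ℝ → ℝ) (ε : ℤ → Ω → ℝ) (X : ℕ → ℕ → Ω → Fin p → ℝ) (l n k : ℕ)
    (d : Fin p → ℝ) (ω : Ω) : ℝ :=
  if l ≤ k then
    1 / 2 * (scale g n ((k : ℤ) + 1) ^ 2)⁻¹ *
      (scale g n (((k - l : ℕ) : ℤ) + 1) * ε (((k - l : ℕ) : ℤ) + 1) ω - d ⬝ᵥ X n (k - l) ω) ^ 2 *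
      ((scale g n ((k : ℤ) + 1) * ε ((k : ℤ) + 1) ω - d ⬝ᵥ X n k ω) ^ 2 /
        scale g n ((k : ℤ) + 1) ^ 2 - 1)
  else 0

/-- Perturbing the parameter by `O_P(n^{-1/2})` changes the sum of the score terms by `O_P(1)`. -/
theorem IsStateProcess.exists_bddInProb_scoreTerm_sub (hg : IsScaleFunction g)
    (hε : IsInnovation P ε) (hX : IsStateProcess P g ε a X) {l : ℕ} (hl : 0 < l)
    {d : ℕ → Ω → Fin p → ℝ} (hd : BddInProb P fun n ω => √(n : ℝ) * ‖d n ω‖) :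
    BddInProb P fun n ω => ∑ k ∈ Finset.range n,
      (scoreTerm g ε X l n k (d n ω) ω - scoreTerm g ε X l n k 0 ω) := by
  obtain ⟨c, C, hc, hC, hs⟩ := hg.exists_scale_bounds
  obtain ⟨C₀, ρ, hC₀, hρ0, hρ1, hdom⟩ := hX.exists_norm_le hg
  have hs0 : ∀ n k, k < n → 0 < scale g n ((k : ℤ) + 1) := fun n k hk => hc.trans_le (hs n k hk).1
  have hsinv : ∀ (q n k : ℕ), k < n → |(scale g n ((k : ℤ) + 1) ^ q)⁻¹| ≤ (c ^ q)⁻¹ :=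
    fun q n k hk => by
      rw [abs_inv, abs_pow, abs_of_pos (hs0 n k hk)]
      exact inv_anti₀ (by positivity) (pow_le_pow_left₀ hc.le (hs n k hk).1 q)
  have hslag : ∀ n k, k < n → |scale g n (((k - l : ℕ) : ℤ) + 1)| ≤ C := fun n k hk => by
    have hk' : k - l < n := by omega
    rw [abs_of_pos (hs0 n _ hk')]
    exact (hs n _ hk').2
  have hXd : Dominated ε X ρ l 1 fun n k ω => ‖X n k ω‖ := dominated_norm_state hρ0 hC₀ hdom
  have hXd' : Dominated ε X ρ l 1 fun n k ω => ‖X n (k - l) ω‖ :=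
    dominated_norm_state_lag hρ0 hC₀ hdom
  set u : ℕ → ℕ → Ω → ℝ := fun n k ω =>
    scale g n (((k - l : ℕ) : ℤ) + 1) * ε (((k - l : ℕ) : ℤ) + 1) ω with hu
  have hud : Dominated ε X ρ l 1 u := by
    have := (Dominated.weight (ε := ε) (X := X) (ρ := ρ) (l := l) hslag).mul
      (dominated_innovation_lag hρ0)
    exact this
  -- `0 < l` is needed here: the lagged innovation must strictly precede time `k + 1`.
  have hum : ∀ n k, l ≤ k → Measurable[pastSigma ε (X n 0) k] (u n k) := fun n k hk =>
    Measurable.const_mul (measurable_pastSigma ε (X n 0) (by omega)) _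
  -- The estimation error `d` depends on the whole sample and is not predictable. The linear terms
  -- are therefore split into coordinates, so that `d` is pulled out of sums whose weights `Z₁`,
  -- `Z₂` are predictable.
  set Z₁ : Fin p → ℕ → ℕ → Ω → ℝ := fun i n k ω => if l ≤ k then
    (scale g n ((k : ℤ) + 1) ^ 2)⁻¹ * u n k ω * X n (k - l) ω i else 0 with hZ₁
  set Z₂ : Fin p → ℕ → ℕ → Ω → ℝ := fun i n k ω => if l ≤ k then
    (scale g n ((k : ℤ) + 1) ^ 3)⁻¹ * u n k ω ^ 2 * X n k ω i else 0 with hZ₂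
  have hN₁ : ∀ i, BddInProb P fun n ω => 1 / √(n : ℝ) *
      ∑ k ∈ Finset.range n, Z₁ i n k ω * (ε ((k : ℤ) + 1) ω ^ 2 - 1) := fun i => by
    refine bddInProb_martingale (l := l) hε hX hρ0 hρ1 (φ := fun x => x ^ 2 - 1) (by fun_prop)
      (fun t => (hε.memLp_sq_sub_one t).mono_exponent (by norm_num)) hε.integral_sq_sub_one
      (((((Dominated.weight (hsinv 2)).mul hud).mul
        (hXd'.coord (f := fun k => k - l) i)).mono hρ0 (by norm_num)).ite (fun k => l ≤ k))
      fun n k hk => ?_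
    by_cases hlk : l ≤ k
    · simp only [hZ₁, if_pos hlk]
      exact Measurable.mul (Measurable.const_mul (hum n k hlk) _)
        (hX.measurable_coord (by omega) (by omega) i)
    · simp only [hZ₁, if_neg hlk]
      exact measurable_const
  have hN₂ : ∀ i, BddInProb P fun n ω => 1 / √(n : ℝ) *
      ∑ k ∈ Finset.range n, Z₂ i n k ω * ε ((k : ℤ) + 1) ω := fun i => by
    refine bddInProb_martingale (l := l) hε hX hρ0 hρ1 (φ := fun x => x) measurable_id
      hε.memLp_two hε.integral_eq_zero
      (((((Dominated.weight (hsinv 3)).mul (hud.pow 2)).mul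
        (hXd.coord (f := fun k => k) i)).mono hρ0 (by norm_num)).ite (fun k => l ≤ k))
      fun n k hk => ?_
    by_cases hlk : l ≤ k
    · simp only [hZ₂, if_pos hlk]
      exact Measurable.mul (Measurable.const_mul (Measurable.pow_const (hum n k hlk) 2) _)
        (hX.measurable_coord (by omega) (by omega) i)
    · simp only [hZ₂, if_neg hlk]
      exact measurable_const
  set Y : ℕ → ℕ → Ω → ℝ := fun n k ω => (p : ℝ) * ‖X n k ω‖ with hY
  set Y' : ℕ → ℕ → Ω → ℝ := fun n k ω => (p : ℝ) * ‖X n (k - l) ω‖ with hY'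
  have hYd : Dominated ε X ρ l 1 Y := by
    have := (Dominated.weight (ε := ε) (X := X) (ρ := ρ) (l := l) (w := fun _ _ => (p : ℝ)) (c := p)
      fun _ _ _ => by rw [Nat.abs_cast]).mul hXd
    exact this
  have hYd' : Dominated ε X ρ l 1 Y' := by
    have := (Dominated.weight (ε := ε) (X := X) (ρ := ρ) (l := l) (w := fun _ _ => (p : ℝ)) (c := p)
      fun _ _ _ => by rw [Nat.abs_cast]).mul hXd'
    exact this
  set T₁ : ℕ → ℕ → Ω → ℝ := fun n k ω => if l ≤ k then
    1 / 2 * (scale g n ((k : ℤ) + 1) ^ 2)⁻¹ * (Y' n k ω ^ 2 * (4 * ε ((k : ℤ) + 1) ω ^ 2 + 1) +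
      4 * (scale g n ((k : ℤ) + 1) ^ 2)⁻¹ * u n k ω ^ 2 * Y n k ω ^ 2) else 0 with hT₁
  set T₂ : ℕ → ℕ → Ω → ℝ := fun n k ω => if l ≤ k then
    3 / 2 * (scale g n ((k : ℤ) + 1) ^ 2)⁻¹ * (scale g n ((k : ℤ) + 1) ^ 2)⁻¹ *
      Y' n k ω ^ 2 * Y n k ω ^ 2 else 0 with hT₂
  have hcst : ∀ r : ℝ, Dominated ε X ρ l 0 fun _ _ _ => r := fun r =>
    Dominated.weight (w := fun _ _ => r) (c := |r|) fun _ _ _ => le_rfl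
  have hw : Dominated ε X ρ l 0 fun n k _ => (scale g n ((k : ℤ) + 1) ^ 2)⁻¹ :=
    Dominated.weight (hsinv 2)
  have hA₁ : BddInProb P fun n ω => 1 / (n : ℝ) * ∑ k ∈ Finset.range n, T₁ n k ω := by
    refine bddInProb_average (l := l) hε hX hρ0 hρ1 ((Dominated.mono hρ0 (r := 4) ?_
      (by norm_num)).ite (fun k => l ≤ k))
    have h1 : Dominated ε X ρ l 4 fun n k ω => Y' n k ω ^ 2 * (4 * ε ((k : ℤ) + 1) ω ^ 2 + 1) :=
      (hYd'.pow 2).mul (s := 2) ((((hcst 4).mul ((dominated_innovation hρ0).pow 2))).add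
        ((hcst 1).mono hρ0 (by norm_num)))
    have h2 : Dominated ε X ρ l 4 fun n k ω =>
        4 * (scale g n ((k : ℤ) + 1) ^ 2)⁻¹ * u n k ω ^ 2 * Y n k ω ^ 2 :=
      (((hcst 4).mul hw).mul (hud.pow 2)).mul (hYd.pow 2)
    have h3 := ((hcst (1 / 2)).mul hw).mul (h1.add h2)
    exact h3
  have hA₂ : BddInProb P fun n ω => 1 / (n : ℝ) * ∑ k ∈ Finset.range n, T₂ n k ω := by
    refine bddInProb_average (l := l) hε hX hρ0 hρ1 ((Dominated.mono hρ0 (r := 4) ?_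
      (by norm_num)).ite (fun k => l ≤ k))
    have h3 := ((((hcst (3 / 2)).mul hw).mul hw).mul (hYd'.pow 2)).mul (hYd.pow 2)
    exact h3
  set D : ℕ → Ω → ℝ := fun n ω => √(n : ℝ) * ‖d n ω‖ with hD
  set N₁ : Fin p → ℕ → Ω → ℝ := fun i n ω => 1 / √(n : ℝ) *
      ∑ k ∈ Finset.range n, Z₁ i n k ω * (ε ((k : ℤ) + 1) ω ^ 2 - 1) with hN₁def
  set N₂ : Fin p → ℕ → Ω → ℝ := fun i n ω => 1 / √(n : ℝ) *
      ∑ k ∈ Finset.range n, Z₂ i n k ω * ε ((k : ℤ) + 1) ω with hN₂def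
  have hfin : BddInProb P fun n ω => D n ω * ∑ i, |N₁ i n ω| + D n ω * ∑ i, |N₂ i n ω| +
      -- Each factor `‖d‖` is paired with `√n`, so `‖d‖²` times a sum over `n` terms becomes `D²`
      -- times an average.
      D n ω * D n ω * (1 / (n : ℝ) * ∑ k ∈ Finset.range n, T₁ n k ω) +
      D n ω * D n ω * (D n ω * D n ω) * (1 / (n : ℝ) * ∑ k ∈ Finset.range n, T₂ n k ω) :=
    (((hd.mul (BddInProb.sum Finset.univ fun i _ => (hN₁ i).abs)).add
      (hd.mul (BddInProb.sum Finset.univ fun i _ => (hN₂ i).abs))).add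
      ((hd.mul hd).mul hA₁)).add (((hd.mul hd).mul (hd.mul hd)).mul hA₂)
  refine hfin.mono fun n ω => ?_
  rcases Nat.eq_zero_or_pos n with hn | hn
  · subst hn
    simp only [Finset.range_zero, Finset.sum_empty, abs_zero]
    exact abs_nonneg _
  refine le_trans ?_ (le_abs_self _)
  have hn0 : (0 : ℝ) < n := by exact_mod_cast hn
  have hsn : (0 : ℝ) < √(n : ℝ) := Real.sqrt_pos.2 hn0
  have hss : √(n : ℝ) ^ 2 = n := Real.sq_sqrt hn0.le
  set δ := ‖d n ω‖ with hδ
  have hdot : ∀ v : Fin p → ℝ, |d n ω ⬝ᵥ v| ≤ δ * (p * ‖v‖) := fun v => by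
    refine (abs_dotProduct_le _ _).trans ?_
    gcongr
    calc ∑ i, |v i| ≤ ∑ _i : Fin p, ‖v‖ := Finset.sum_le_sum fun i _ => norm_le_pi_norm v i
      _ = _ := by simp
  have hT₁0 : ∀ k, 0 ≤ T₁ n k ω := fun k => by
    simp only [hT₁]
    split_ifs
    · positivity
    · exact le_rfl
  have hT₂0 : ∀ k, 0 ≤ T₂ n k ω := fun k => by
    simp only [hT₂]
    split_ifs
    · positivity
    · exact le_rfl
  have hterm : ∀ k ∈ Finset.range n,
      |(scoreTerm g ε X l n k (d n ω) ω - scoreTerm g ε X l n k 0 ω) +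
        (∑ i, d n ω i * (Z₁ i n k ω * (ε ((k : ℤ) + 1) ω ^ 2 - 1)) +
          ∑ i, d n ω i * (Z₂ i n k ω * ε ((k : ℤ) + 1) ω))| ≤
      δ ^ 2 * T₁ n k ω + δ ^ 4 * T₂ n k ω := by
    intro k hk
    have hk' := Finset.mem_range.1 hk
    by_cases hlk : l ≤ k
    · simp only [scoreTerm, hZ₁, hZ₂, hT₁, hT₂, if_pos hlk, zero_dotProduct, sub_zero]
      have h := abs_score_term_sub_le (hs0 n k hk') (u' := u n k ω) (e := ε ((k : ℤ) + 1) ω)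
        (hdot (X n k ω)) (hdot (X n (k - l) ω))
      have e1 : ∑ i, d n ω i * ((scale g n ((k : ℤ) + 1) ^ 2)⁻¹ * u n k ω * X n (k - l) ω i *
          (ε ((k : ℤ) + 1) ω ^ 2 - 1)) = (scale g n ((k : ℤ) + 1) ^ 2)⁻¹ * u n k ω *
          (d n ω ⬝ᵥ X n (k - l) ω) * (ε ((k : ℤ) + 1) ω ^ 2 - 1) := by
        simp only [dotProduct, Finset.mul_sum, Finset.sum_mul]
        exact Finset.sum_congr rfl fun i _ => by ring
      have e2 : ∑ i, d n ω i * ((scale g n ((k : ℤ) + 1) ^ 3)⁻¹ * u n k ω ^ 2 * X n k ω i *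
          ε ((k : ℤ) + 1) ω) = (scale g n ((k : ℤ) + 1) ^ 3)⁻¹ * u n k ω ^ 2 *
          (d n ω ⬝ᵥ X n k ω) * ε ((k : ℤ) + 1) ω := by
        simp only [dotProduct, Finset.mul_sum, Finset.sum_mul]
        exact Finset.sum_congr rfl fun i _ => by ring
      have e3 : (scale g n ((k : ℤ) + 1) * ε ((k : ℤ) + 1) ω) ^ 2 / scale g n ((k : ℤ) + 1) ^ 2 =
          ε ((k : ℤ) + 1) ω ^ 2 := by
        have := (hs0 n k hk').ne'
        field_simp
      rw [e1, e2, e3, ← add_assoc]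
      exact h
    · simp only [scoreTerm, hZ₁, hZ₂, hT₁, hT₂, if_neg hlk]
      simp
  have hsum := (Finset.abs_sum_le_sum_abs _ _).trans (Finset.sum_le_sum hterm)
  rw [Finset.sum_add_distrib, Finset.sum_add_distrib, Finset.sum_add_distrib, ← Finset.mul_sum,
    ← Finset.mul_sum] at hsum
  have hlin : ∀ W : Fin p → ℕ → ℝ, |∑ k ∈ Finset.range n, ∑ i, d n ω i * W i k| ≤
      D n ω * ∑ i, |1 / √(n : ℝ) * ∑ k ∈ Finset.range n, W i k| := fun W => by
    have h1 : ∑ k ∈ Finset.range n, ∑ i, d n ω i * W i k =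
        d n ω ⬝ᵥ fun i => ∑ k ∈ Finset.range n, W i k := by
      rw [Finset.sum_comm]
      simp only [dotProduct, Finset.mul_sum]
    rw [h1]
    refine (abs_dotProduct_le _ _).trans (le_of_eq ?_)
    simp only [hD, abs_mul, abs_of_pos (by positivity : 0 < 1 / √(n : ℝ)), ← Finset.mul_sum]
    field_simp
  have hL₁ := hlin fun i k => Z₁ i n k ω * (ε ((k : ℤ) + 1) ω ^ 2 - 1)
  have hL₂ := hlin fun i k => Z₂ i n k ω * ε ((k : ℤ) + 1) ω
  have hD2 : δ ^ 2 * ∑ k ∈ Finset.range n, T₁ n k ω =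
      D n ω * D n ω * (1 / (n : ℝ) * ∑ k ∈ Finset.range n, T₁ n k ω) := by
    have h1 : D n ω * D n ω = n * δ ^ 2 := by rw [hD, ← hss]; ring
    rw [h1]
    field_simp
  -- The quartic term is of order `1/n`; that spare factor is discarded using `1 ≤ n`.
  have hD4 : δ ^ 4 * ∑ k ∈ Finset.range n, T₂ n k ω ≤
      D n ω * D n ω * (D n ω * D n ω) * (1 / (n : ℝ) * ∑ k ∈ Finset.range n, T₂ n k ω) := by
    have h1 : D n ω * D n ω = n * δ ^ 2 := by rw [hD, ← hss]; ring
    have h2 : D n ω * D n ω * (D n ω * D n ω) * (1 / (n : ℝ) * ∑ k ∈ Finset.range n, T₂ n k ω) =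
        n * (δ ^ 4 * ∑ k ∈ Finset.range n, T₂ n k ω) := by
      rw [h1]
      field_simp
    rw [h2]
    refine le_mul_of_one_le_left ?_ (by exact_mod_cast hn)
    exact mul_nonneg (by positivity) (Finset.sum_nonneg fun k _ => hT₂0 k)
  have htri : ∀ A B₁ B₂ : ℝ, |A| ≤ |A + (B₁ + B₂)| + |B₁| + |B₂| := fun A B₁ B₂ => by
    have h1 : A = (A + (B₁ + B₂)) - (B₁ + B₂) := by ring
    have h2 := abs_sub (A + (B₁ + B₂)) (B₁ + B₂)
    have h3 := abs_add_le B₁ B₂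
    rw [← h1] at h2
    linarith
  refine (htri _ (∑ k ∈ Finset.range n, ∑ i, d n ω i * (Z₁ i n k ω * (ε ((k : ℤ) + 1) ω ^ 2 - 1)))
    (∑ k ∈ Finset.range n, ∑ i, d n ω i * (Z₂ i n k ω * ε ((k : ℤ) + 1) ω))).trans ?_
  simp only [hN₁def, hN₂def]
  linarith [hsum, hL₁, hL₂, hD2, hD4]

end Perturbation

end ARCHTest

namespace ARCHTest

open scoped Topology
open Matrix

/-! ### From the sample to the limit law. -/

section LeadingTerm

variable {Ω : Type*} [mΩ : MeasurableSpace Ω] {P : Measure Ω} [IsProbabilityMeasure P]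
  {g : ℝ → ℝ} {ε : ℤ → Ω → ℝ}

/-- Replacing the ratios of the scales by `1` changes the sum of the score terms at the true
parameter by `O_P(1)`. -/
theorem IsInnovation.bddInProb_scaleRatio_sub_one (hg : IsScaleFunction g)
    (hε : IsInnovation P ε) {l : ℕ} (hl : 0 < l) :
    BddInProb P fun n ω => ∑ k ∈ Finset.range n,
      1 / 2 * (scaleRatio g n l k - 1) * ε ((k : ℤ) + 1 - l) ω ^ 2 *
        (ε ((k : ℤ) + 1) ω ^ 2 - 1) := by
  obtain ⟨V, hV⟩ := hg.exists_sum_scaleRatio_le l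
  set v := variance (fun ω => ε 0 ω ^ 2) P
  set q := ∫ ω, ε 0 ω ^ 4 ∂P
  have hq : 0 ≤ q := integral_nonneg fun ω => by positivity
  have hv : 0 ≤ v := variance_nonneg _ _
  have hsum := fun n => memLp_martingale_sum (P := P) (n := n)
    -- For `k < l` the weight is `-1/2` and a presample innovation enters, so the filtration has to
    -- contain all innovations up to time `k`, including the nonpositive times.
    (F := fun k : ℕ => sigmaOf ε (Set.Iic (k : ℤ))) (fun k => sigmaOf_le hε.measurable _)
    (fun k k' h => sigmaOf_mono ε (Set.Iic_subset_Iic.2 (by exact_mod_cast h)))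
    (η := fun k ω => ε ((k : ℤ) + 1) ω ^ 2 - 1)
    (Z := fun k ω => 1 / 2 * (scaleRatio g n l k - 1) * ε ((k : ℤ) + 1 - l) ω ^ 2)
    (fun k => ((measurable_sigmaOf ε (by simp)).pow_const 2).sub_const 1)
    hε.indep_quadLag (fun k => hε.integral_sq_sub_one _)
    (fun k => (hε.memLp_sq_sub_one _).mono_exponent (by norm_num))
    (fun k _ => ((measurable_sigmaOf ε (by rw [Set.mem_Iic]; omega)).pow_const 2).const_mul _)
    (fun k _ => ((hε.memLp_sq _).mono_exponent (by norm_num)).const_mul _)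
  -- `1/4` is the square of the score factor, `q` and `v` are the moments of the two random factors,
  -- and `V` bounds the sum of squared ratio deviations uniformly in `n`. Hence the sum is bounded
  -- without normalization.
  refine BddInProb.of_integral_sq_le (K := 1 / 4 * q * v * V)
    (fun n => (hsum n).2.1.integrable_sq) fun n => ?_
  rw [(hsum n).2.2]
  calc ∑ k ∈ Finset.range n,
        (∫ ω, (1 / 2 * (scaleRatio g n l k - 1) * ε ((k : ℤ) + 1 - l) ω ^ 2) ^ 2 ∂P) *
          ∫ ω, (ε ((k : ℤ) + 1) ω ^ 2 - 1) ^ 2 ∂P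
      = ∑ k ∈ Finset.range n, 1 / 4 * q * v * (scaleRatio g n l k - 1) ^ 2 := by
        refine Finset.sum_congr rfl fun k _ => ?_
        have h1 : ∀ ω, (1 / 2 * (scaleRatio g n l k - 1) * ε ((k : ℤ) + 1 - l) ω ^ 2) ^ 2 =
            1 / 4 * (scaleRatio g n l k - 1) ^ 2 * ε ((k : ℤ) + 1 - l) ω ^ 4 := fun ω => by ring
        simp only [h1]
        rw [integral_const_mul, hε.integral_sq_sub_one_sq,
          hε.integral_comp _ (f := fun x => x ^ 4) (by fun_prop)]
        ring
    _ ≤ _ := by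
        rw [← Finset.mul_sum]
        exact mul_le_mul_of_nonneg_left (hV n) (by positivity)

omit mΩ [IsProbabilityMeasure P] in
theorem scoreTerm_zero {p : ℕ} {X : ℕ → ℕ → Ω → Fin p → ℝ} {l n k : ℕ}
    (hs : scale g n ((k : ℤ) + 1) ≠ 0) (ω : Ω) :
    scoreTerm g ε X l n k 0 ω = 1 / 2 * scaleRatio g n l k * ε ((k : ℤ) + 1 - l) ω ^ 2 *
      (ε ((k : ℤ) + 1) ω ^ 2 - 1) := by
  unfold scoreTerm scaleRatio
  split_ifs with h
  · have e : ((k - l : ℕ) : ℤ) + 1 = (k : ℤ) + 1 - l := by omega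
    rw [e]
    simp only [zero_dotProduct, sub_zero]
    field_simp
  · ring

end LeadingTerm

section Sample

variable {Ω : Type*} [mΩ : MeasurableSpace Ω] {P : Measure Ω} [IsProbabilityMeasure P] {p m : ℕ}
  {g : ℝ → ℝ} {ε : ℤ → Ω → ℝ} {a : Fin p → ℝ} {α : Fin m → ℝ} {x u : ℕ → ℤ → Ω → ℝ}

omit [IsProbabilityMeasure P] in
/-- Without ARCH effects the sample follows an autoregression with errors `h_t ε_t`. -/
theorem IsARARCH.ar_eq_of_null (hg : IsScaleFunction g) (hx : IsARARCH P g ε a α x u)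
    (hα : ∀ j, α j = 0) {n k : ℕ} (hk : k < n) (ω : Ω) :
    x n ((k : ℤ) + 1) ω = a ⬝ᵥ lags p (fun t => x n t ω) k +
      scale g n ((k : ℤ) + 1) * ε ((k : ℤ) + 1) ω := by
  obtain ⟨c, C, hc, -, hs⟩ := hg.exists_scale_bounds
  rw [hx.ar_eq n _ (by omega) (by omega), hx.error_eq n _ (by omega) (by omega)]
  simp only [hα, zero_mul, Finset.sum_const_zero, add_zero]
  rw [Real.sqrt_sq (hc.le.trans (hs n k hk).1)]
  congr 1
  refine Finset.sum_congr rfl fun i _ => ?_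
  rw [lags, show (k : ℤ) + 1 - ((i : ℕ) + 1 : ℤ) = k - ((i : ℕ) : ℤ) by ring]

theorem IsARARCH.isStateProcess (hg : IsScaleFunction g) (hx : IsARARCH P g ε a α x u)
    (hα : ∀ j, α j = 0) :
    IsStateProcess P g ε a fun n k ω => lags p (fun t => x n t ω) k where
  stable := hx.stable
  succ_eq n k hk ω := by
    ext i
    rw [Pi.add_apply, Pi.smul_apply, smul_eq_mul]
    rcases Nat.eq_zero_or_pos (i : ℕ) with hi | hi
    · rw [companion_mulVec_zero _ _ _ hi, firstVec, if_pos hi, mul_one]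
      have := hx.ar_eq_of_null hg hα hk ω
      rw [lags, hi]
      simpa [dotProduct] using this
    · rw [companion_mulVec_succ _ _ i ⟨i - 1, by omega⟩ (by simp; omega), firstVec,
        if_neg hi.ne', mul_zero, add_zero, lags, lags]
      congr 1
      push_cast [hi]
      ring
  init_measurable n := measurable_pi_iff.2 fun i => by
    simpa [lags] using hx.init_measurable n i
  init_indep n := by
    have h : (fun ω => lags p (fun t => x n t ω) ((0 : ℕ) : ℤ)) =
        fun ω (i : Fin p) => x n (-((i : ℕ) : ℤ)) ω := by
      ext ω i
      simp [lags]
    rw [h]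
    exact hx.init_indep n
  init_bdd := by
    have h : ∀ i : Fin p, BddInProb P fun n => x n (-((i : ℕ) : ℤ)) := fun i δ hδ => by
      obtain ⟨C, hC⟩ := hx.init_tight δ hδ
      exact ⟨C, Eventually.of_forall fun n => hC n i⟩
    refine (BddInProb.sum Finset.univ fun i _ => (h i).abs).mono fun n ω => ?_
    have h0 : 0 ≤ ∑ i : Fin p, |x n (-((i : ℕ) : ℤ)) ω| :=
      Finset.sum_nonneg fun i _ => abs_nonneg _
    rw [abs_norm, abs_of_nonneg h0]
    refine (pi_norm_le_iff_of_nonneg h0).2 fun i => ?_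
    have := Finset.single_le_sum (f := fun i : Fin p => |x n (-((i : ℕ) : ℤ)) ω|)
      (fun i _ => abs_nonneg _) (Finset.mem_univ i)
    simpa [lags] using this

omit [IsProbabilityMeasure P] in
theorem IsARARCH.residual_eq (hg : IsScaleFunction g) (hx : IsARARCH P g ε a α x u)
    (hα : ∀ j, α j = 0) {n k : ℕ} (hk : k < n) (ω : Ω) (θ : Fin p → ℝ) :
    residual (fun t => x n t ω) θ ((k : ℤ) + 1) =
      scale g n ((k : ℤ) + 1) * ε ((k : ℤ) + 1) ω -
        (θ - a) ⬝ᵥ lags p (fun t => x n t ω) k := by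
  rw [residual, if_pos (by omega), hx.ar_eq_of_null hg hα hk, sub_dotProduct]
  have : ∑ i : Fin p, θ i * x n ((k : ℤ) + 1 - ((i : ℕ) + 1 : ℤ)) ω =
      θ ⬝ᵥ lags p (fun t => x n t ω) k := by
    refine Finset.sum_congr rfl fun i _ => ?_
    rw [lags, show (k : ℤ) + 1 - ((i : ℕ) + 1 : ℤ) = k - ((i : ℕ) : ℤ) by ring]
  rw [this]
  ring

omit [IsProbabilityMeasure P] in
theorem IsARARCH.score_eq (hg : IsScaleFunction g) (hx : IsARARCH P g ε a α x u)
    (hα : ∀ j, α j = 0) (n : ℕ) (ω : Ω) (θ : Fin p → ℝ) (j : Fin m) :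
    score m n (scale g n) (fun t => x n t ω) θ j = 1 / √(n : ℝ) * ∑ k ∈ Finset.range n,
      scoreTerm g ε (fun n k ω => lags p (fun t => x n t ω) k) ((j : ℕ) + 1) n k (θ - a) ω := by
  obtain ⟨c, C, hc, -, hs⟩ := hg.exists_scale_bounds
  rw [score_apply _ _ _ fun k hk => (hc.trans_le (hs n k hk).1).ne']
  congr 1
  refine Finset.sum_congr rfl fun k hk => ?_
  have hk' := Finset.mem_range.1 hk
  rw [scoreTerm, hx.residual_eq hg hα hk']
  split_ifs with h
  · have e : (k : ℤ) + 1 - ((j : ℕ) + 1 : ℤ) = ((k - ((j : ℕ) + 1) : ℕ) : ℤ) + 1 := by omega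
    rw [e, hx.residual_eq hg hα (by omega)]
  -- The lagged time is nonpositive, where residuals vanish by convention; this is the zero branch
  -- of `scoreTerm`.
  · have e : residual (fun t => x n t ω) θ ((k : ℤ) + 1 - ((j : ℕ) + 1 : ℤ)) = 0 :=
      if_neg (by omega)
    rw [e]
    ring

theorem gls_eq (p n : ℕ) (h x : ℤ → ℝ) :
    gls p n h x = (∑ k ∈ Finset.range n, ((h ((k : ℤ) + 1) ^ 2)⁻¹ *
      x ((k : ℤ) + 1)) • lags p x k) ᵥ*
      (∑ k ∈ Finset.range n,
        (h ((k : ℤ) + 1) ^ 2)⁻¹ • vecMulVec (lags p x k) (lags p x k))⁻¹ := by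
  simp only [gls, sum_Icc_one_eq_sum_range, add_sub_cancel_right]

omit [IsProbabilityMeasure P] in
/-- The normal equations for the error of the generalized least-squares estimator. -/
theorem IsARARCH.gls_sub_vecMul (hg : IsScaleFunction g) (hx : IsARARCH P g ε a α x u)
    (hα : ∀ j, α j = 0) (n : ℕ) (ω : Ω)
    (hdet : (∑ k ∈ Finset.range n, (scale g n ((k : ℤ) + 1) ^ 2)⁻¹ •
      vecMulVec (lags p (fun t => x n t ω) k) (lags p (fun t => x n t ω) k)).det ≠ 0) :
    (gls p n (scale g n) (fun t => x n t ω) - a) ᵥ* (∑ k ∈ Finset.range n,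
        (scale g n ((k : ℤ) + 1) ^ 2)⁻¹ •
          vecMulVec (lags p (fun t => x n t ω) k) (lags p (fun t => x n t ω) k)) =
      fun i => ∑ k ∈ Finset.range n,
        (scale g n ((k : ℤ) + 1))⁻¹ * lags p (fun t => x n t ω) k i * ε ((k : ℤ) + 1) ω := by
  obtain ⟨c, C, hc, -, hs⟩ := hg.exists_scale_bounds
  rw [gls_eq]
  set M := ∑ k ∈ Finset.range n, (scale g n ((k : ℤ) + 1) ^ 2)⁻¹ •
      vecMulVec (lags p (fun t => x n t ω) k) (lags p (fun t => x n t ω) k) with hM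
  rw [sub_vecMul, vecMul_vecMul, nonsing_inv_mul _ (isUnit_iff_ne_zero.2 hdet), vecMul_one, hM,
    vecMul_sum, ← Finset.sum_sub_distrib]
  ext i
  rw [Finset.sum_apply]
  refine Finset.sum_congr rfl fun k hk => ?_
  have hk' := Finset.mem_range.1 hk
  have h0 := (hc.trans_le (hs n k hk').1).ne'
  rw [vecMul_smul, vecMul_vecMulVec, hx.ar_eq_of_null hg hα hk']
  simp only [Pi.sub_apply, Pi.smul_apply, smul_eq_mul]
  field_simp
  ring

end Sample

section Measurability

variable {Ω : Type*} [mΩ : MeasurableSpace Ω] {p : ℕ}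

theorem measurable_matrix_det {M : Ω → Matrix (Fin p) (Fin p) ℝ}
    (hM : ∀ i j, Measurable fun ω => M ω i j) : Measurable fun ω => (M ω).det := by
  simp only [det_apply]
  exact Finset.measurable_sum _ fun σ _ =>
    (Finset.measurable_prod _ fun i _ => hM _ _).const_smul _

/-- Cramer's rule; since `0⁻¹ = 0` agrees with the convention for singular matrices, no case
distinction is needed. -/
theorem measurable_matrix_inv_apply {M : Ω → Matrix (Fin p) (Fin p) ℝ}
    (hM : ∀ i j, Measurable fun ω => M ω i j) (i j : Fin p) : Measurable fun ω => (M ω)⁻¹ i j := by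
  simp only [inv_def, Ring.inverse_eq_inv', Matrix.smul_apply, smul_eq_mul, adjugate_apply]
  refine (measurable_matrix_det hM).inv.mul (measurable_matrix_det fun k l => ?_)
  simp only [updateRow_apply]
  split_ifs
  · exact measurable_const
  · exact hM k l

end Measurability

section Convergence

variable {Ω : Type*} [mΩ : MeasurableSpace Ω] {P : Measure Ω} [IsProbabilityMeasure P] {p m : ℕ}
  {g : ℝ → ℝ} {ε : ℤ → Ω → ℝ} {a : Fin p → ℝ} {α : Fin m → ℝ} {x u : ℕ → ℤ → Ω → ℝ}

theorem IsARARCH.measurable_lags (hg : IsScaleFunction g) (hε : IsInnovation P ε)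
    (hx : IsARARCH P g ε a α x u) (hα : ∀ j, α j = 0) {n k : ℕ} (hk : k ≤ n) :
    Measurable fun ω => lags p (fun t => x n t ω) k :=
  have hX := hx.isStateProcess hg hα
  (hX.measurable_state hk).mono (pastSigma_le hε.measurable (hX.init_measurable n) k) le_rfl

theorem IsARARCH.measurable_gls (hg : IsScaleFunction g) (hε : IsInnovation P ε)
    (hx : IsARARCH P g ε a α x u) (hα : ∀ j, α j = 0) (n : ℕ) :
    Measurable fun ω => gls p n (scale g n) fun t => x n t ω := by
  have hl : ∀ k ∈ Finset.range n, ∀ i, Measurable fun ω => lags p (fun t => x n t ω) k i :=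
    fun k hk i => (measurable_pi_apply i).comp
      (hx.measurable_lags hg hε hα (Finset.mem_range.1 hk).le)
  have hxm : ∀ k ∈ Finset.range n, Measurable fun ω => x n ((k : ℤ) + 1) ω := fun k hk => by
    have h : (fun ω => x n ((k : ℤ) + 1) ω) = fun ω => a ⬝ᵥ lags p (fun t => x n t ω) k +
        scale g n ((k : ℤ) + 1) * ε ((k : ℤ) + 1) ω :=
      funext fun ω => hx.ar_eq_of_null hg hα (Finset.mem_range.1 hk) ω
    rw [h]
    exact (Finset.measurable_sum _ fun i _ => (hl k hk i).const_mul _).add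
      ((hε.measurable _).const_mul _)
  simp only [gls_eq]
  refine measurable_pi_iff.2 fun j => ?_
  simp only [vecMul, dotProduct]
  refine Finset.measurable_sum _ fun i _ => Measurable.mul ?_ (measurable_matrix_inv_apply ?_ i j)
  · simp only [Finset.sum_apply, Pi.smul_apply, smul_eq_mul]
    exact Finset.measurable_sum _ fun k hk => ((hxm k hk).const_mul _).mul (hl k hk i)
  · intro i j
    simp only [Matrix.sum_apply, Matrix.smul_apply, vecMulVec_apply, smul_eq_mul]
    exact Finset.measurable_sum _ fun k hk => ((hl k hk i).mul (hl k hk j)).const_mul _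

theorem IsARARCH.measurable_score_gls (hg : IsScaleFunction g) (hε : IsInnovation P ε)
    (hx : IsARARCH P g ε a α x u) (hα : ∀ j, α j = 0) (n : ℕ) :
    Measurable fun ω => score m n (scale g n) (fun t => x n t ω)
      (gls p n (scale g n) fun t => x n t ω) := by
  have hdot : ∀ k ≤ n, Measurable fun ω => (gls p n (scale g n) (fun t => x n t ω) - a) ⬝ᵥ
      lags p (fun t => x n t ω) k := fun k hk =>
    Finset.measurable_sum _ fun i _ => ((measurable_pi_apply i).comp
      ((hx.measurable_gls hg hε hα n).sub_const a)).mul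
        ((measurable_pi_apply i).comp (hx.measurable_lags hg hε hα hk))
  have hcoord : Measurable fun ω => fun j => score m n (scale g n) (fun t => x n t ω)
      (gls p n (scale g n) fun t => x n t ω) j := by
    refine measurable_pi_iff.2 fun j => ?_
    simp only [hx.score_eq hg hα]
    refine Measurable.const_mul (Finset.measurable_sum _ fun k hk => ?_) _
    have hk' := Finset.mem_range.1 hk
    unfold scoreTerm
    split_ifs
    · have h1 := hdot k hk'.le
      have h2 := hdot (k - ((j : ℕ) + 1)) (by omega)
      have h3 := hε.measurable ((k : ℤ) + 1)
      have h4 := hε.measurable (((k - ((j : ℕ) + 1) : ℕ) : ℤ) + 1)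
      fun_prop
    · exact measurable_const
  exact (WithLp.measurable_toLp 2 (Fin m → ℝ)).comp hcoord

/-- The feasible score differs from its leading term by `o_P(1)`. -/
theorem IsARARCH.tendstoInMeasure_score_sub (hg : IsScaleFunction g) (hε : IsInnovation P ε)
    (hx : IsARARCH P g ε a α x u) (hα : ∀ j, α j = 0) :
    TendstoInMeasure P (fun (n : ℕ) ω => score m n (scale g n) (fun t => x n t ω)
      (gls p n (scale g n) fun t => x n t ω) - leadingScore ε m n ω) atTop fun _ => 0 := by
  obtain ⟨c, C, hc, -, hs⟩ := hg.exists_scale_bounds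
  have hX := hx.isStateProcess hg hα
  have hd := hX.bddInProb_error hg hε (θ := fun n ω => gls p n (scale g n) fun t => x n t ω)
    (hx.gls_sub_vecMul hg hα)
  -- The scale-ratio error and the estimation error of the unnormalized sum are both `O_P(1)`; the
  -- factor `1 / √n` of the score makes them negligible.
  have hQ := fun j : Fin m => (hε.bddInProb_scaleRatio_sub_one hg (Nat.succ_pos j)).add
    (hX.exists_bddInProb_scoreTerm_sub hg hε (Nat.succ_pos j) hd)
  have hsqrt : Tendsto (fun n : ℕ => 1 / √(n : ℝ)) atTop (𝓝 0) := by
    have : Tendsto (fun n : ℕ => √(n : ℝ)) atTop atTop :=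
      Real.tendsto_sqrt_atTop.comp tendsto_natCast_atTop_atTop
    simpa using! tendsto_inv_atTop_zero.comp this
  refine (BddInProb.sum Finset.univ fun j _ => (hQ j).abs).tendstoInMeasure hsqrt fun n ω => ?_
  set D := score m n (scale g n) (fun t => x n t ω) (gls p n (scale g n) fun t => x n t ω) -
    leadingScore ε m n ω with hD
  have hnorm : ‖D‖ ≤ ∑ j, |D j| := by
    have h0 : 0 ≤ ∑ j, |D j| := Finset.sum_nonneg fun j _ => abs_nonneg _
    rw [EuclideanSpace.norm_eq]
    refine Real.sqrt_le_iff.2 ⟨h0, ?_⟩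
    simp only [Real.norm_eq_abs]
    exact Finset.sum_sq_le_sq_sum_of_nonneg fun j _ => abs_nonneg _
  refine hnorm.trans (le_of_eq ?_)
  rw [abs_mul, Finset.abs_sum_of_nonneg fun j _ => abs_nonneg _, Finset.mul_sum]
  refine Finset.sum_congr rfl fun j _ => ?_
  rw [← abs_mul]
  congr 1
  rw [hD, PiLp.sub_apply, hx.score_eq hg hα]
  change _ - 1 / √(n : ℝ) * _ = _
  rw [← mul_sub, ← Finset.sum_sub_distrib, ← Finset.sum_add_distrib]
  congr 1
  refine Finset.sum_congr rfl fun k hk => ?_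
  rw [scoreTerm_zero (hc.trans_le (hs n k (Finset.mem_range.1 hk)).1).ne']
  push_cast
  ring

end Convergence

end ARCHTest

theorem proposition1 {Ω : Type*} [MeasurableSpace Ω] (P : Measure Ω) [IsProbabilityMeasure P]
    (p m : ℕ) (g : ℝ → ℝ) (ε : ℤ → Ω → ℝ) (a₀ : Fin p → ℝ) (α₀ : Fin m → ℝ)
    (x u : ℕ → ℤ → Ω → ℝ)
    (hg : ARCHTest.IsScaleFunction g)
    (hε : ARCHTest.IsInnovation P ε)
    (hmodel : ARCHTest.IsARARCH P g ε a₀ α₀ x u)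
    (hH0 : ∀ j, α₀ j = 0) :
    (ARCHTest.asymptoticCov P (ε 0) m).PosSemidef ∧
    TendstoInDistribution
      (fun (n : ℕ) (ω : Ω) =>
        ARCHTest.score m n (ARCHTest.scale g n) (fun t => x n t ω)
          (ARCHTest.gls p n (ARCHTest.scale g n) (fun t => x n t ω)))
      atTop (id : EuclideanSpace ℝ (Fin m) → EuclideanSpace ℝ (Fin m)) (fun _ => P)
      (multivariateGaussian 0 (ARCHTest.asymptoticCov P (ε 0) m)) := by
  -- Slutsky's lemma: the leading score converges in law and the difference tends to zero in
  -- probability.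
  exact ⟨hε.posSemidef_asymptoticCov m, tendstoInDistribution_of_tendstoInMeasure_sub _ _
    (hε.tendstoInDistribution_leadingScore m) (hmodel.tendstoInMeasure_score_sub hg hε hH0)
    fun n => (hmodel.measurable_score_gls hg hε hH0 n).aemeasurable⟩
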